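/- Let $A=(a_{ij})_{0\le i,j\le n}$ be a generalized Cartan matrix of affine type, i.e. one of $A_n^{(1)}$ ($n\ge1$), $B_n^{(1)}$ ($n\ge3$), $C_n^{(1)}$ ($n\ge2$), $D_n^{(1)}$ ($n\ge4$), $E_6^{(1)},E_7^{(1)},E_8^{(1)},F_4^{(1)},G_2^{(1)}$, $A_{2n}^{(2)}$ ($n\ge1$), $A_{2n-1}^{(2)}$ ($n\ge3$), $D_{n+1}^{(2)}$ ($n\ge2$), $E_6^{(2)}$, $D_4^{(3)}$, with the enumeration of vertices of Kac's tables and $a_{ij}=\langle\alpha_j,\check\alpha_i\rangle$. Let $a_0,\dots,a_n$ (resp. $\check a_0,\dots,\check a_n$) be the coprime positive integers with $\sum_j a_{ij}a_j=0$ (resp. $\sum_i\check a_i a_{ij}=0$), and let $\check h=\sum_i\check a_i$ be the dual Coxeter number. Let $\mathring{\mathfrak g}$ be the simple Lie algebra whose Cartan matrix is obtained from $A$ by deleting the vertex $0$; let $\mathring{\mathfrak h}$ be its Cartan subalgebra, $\mathring P$, $\mathring Q$ its weight and root lattices, $\check{\mathring P}$, $\check{\mathring Q}$ the dual lattices of $\mathring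 Q$, $\mathring P$, $\mathring W$ its Weyl group with length function $\ell$, $\theta$ its highest root, and $\mathring\rho$, $\check{\mathring\rho}$ the sums of its fundamental weights and of its fundamental coweights. Let $(\cdot|\cdot)$ be the symmetric bilinear form on $\mathring{\mathfrak h}$ with $(\check\alpha_i|\check\alpha_j)=a_j\check a_j^{-1}a_{ij}$, let $\kappa:\mathring{\mathfrak h}\to\mathring{\mathfrak h}^*$ be the induced isomorphism, and denote by $(\cdot|\cdot)$ also the transported form on $\mathring{\mathfrak h}^*$. Call $A$ of the first kind if $A=X_N^{(1)}$ or $A=A_{2n}^{(2)}$, and of the second kind otherwise. Put $M=\kappa(\check{\mathring Q})$ and $\check\theta=\kappa^{-1}(\theta)$ if $A$ is of the first kind; put $M=\mathring Q$ and let $\check\theta$ be the highest coroot of $\mathring{\mathfrak g}$ if $A$ is of the second kind. For an integer $k\ge0$ let $$P_k=\{\lambda\in\mathring P\text{ dominant}:\langle\lambda,\check\theta\rangle\le k\},\qquad \check P_k=\{\check\lambda\in\check{\mathring P}\text{ dominant}:\langle\theta,\check\lambda\rangle\le k\}.$$ In the torus $\mathring T=\mathrm{Hom}(\mathring P,\mathbb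 C^\times)$ let $$\Sigma_k=\{e^{\frac{2\pi i}{k+\check h}(\mathring\rho+\lambda|\cdot)}:\lambda\in P_k\}\ \text{(first kind)},\qquad \Sigma_k=\{e^{\frac{2\pi i}{k+\check h}\langle\cdot,\check{\mathring\rho}+\check\lambda\rangle}:\check\lambda\in\check P_k\}\ \text{(second kind)}.$$ Let $R_k(A)$ be the ring of complex-valued functions on $\Sigma_k$. For $\lambda\in P_k$ and $t\in\Sigma_k$ put $J_\lambda(t)=\sum_{w\in\mathring W}(-1)^{\ell(w)}\,t(w(\lambda+\mathring\rho))$, $\mathring\chi_\lambda(t)=J_\lambda(t)/J_0(t)$, $\Delta(t)=|J_0(t)|^2$, and for $f,g\in R_k(A)$ put $$(f,g)=\frac1{|\mathring P/(k+\check h)M|}\sum_{t\in\Sigma_k}f(t)\overline{g(t)}\,\Delta(t).$$ Then, for every such $A$ and every $k\ge0$, the set $\Sigma_k$ is finite, and 1. the Hermitian form $(\cdot,\cdot)$ on $R_k(A)$ is an inner product, i.e. positive definite; 2. the functions $\mathring\chi_\lambda$, $\lambda\in P_k$, form an orthonormal basis of $R_k(A)$ with respect to this inner product. -/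

import Mathlib

open scoped Matrix ComplexConjugate

/-- The generalized Cartan matrices of affine type, in the notation `X_N^(r)` of Kac. -/
inductive AffineType : Type
  /-- `A_n^(1)`, `n ≥ 1` -/
  | A (n : ℕ) (hn : 1 ≤ n)
  /-- `B_n^(1)`, `n ≥ 3` -/
  | B (n : ℕ) (hn : 3 ≤ n)
  /-- `C_n^(1)`, `n ≥ 2` -/
  | C (n : ℕ) (hn : 2 ≤ n)
  /-- `D_n^(1)`, `n ≥ 4` -/
  | D (n : ℕ) (hn : 4 ≤ n)
  /-- `E_6^(1)` -/
  | E6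
  /-- `E_7^(1)` -/
  | E7
  /-- `E_8^(1)` -/
  | E8
  /-- `F_4^(1)` -/
  | F4
  /-- `G_2^(1)` -/
  | G2
  /-- `A_{2n}^(2)`, `n ≥ 1` -/
  | twAeven (n : ℕ) (hn : 1 ≤ n)
  /-- `A_{2n-1}^(2)`, `n ≥ 3` -/
  | twAodd (n : ℕ) (hn : 3 ≤ n)
  /-- `D_{n+1}^(2)`, `n ≥ 2` -/
  | twD (n : ℕ) (hn : 2 ≤ n)
  /-- `E_6^(2)` -/
  | twE6
  /-- `D_4^(3)` -/
  | twD4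

namespace AffineType

/-- The rank `n`; the affine Cartan matrix has order `n + 1`, with vertices `0, …, n`. -/
def rank : AffineType → ℕ
  | A n _ => n
  | B n _ => n
  | C n _ => n
  | D n _ => n
  | E6 => 6
  | E7 => 7
  | E8 => 8
  | F4 => 4
  | G2 => 2
  | twAeven n _ => n
  | twAodd n _ => n
  | twD n _ => n
  | twE6 => 4
  | twD4 => 2

/-- The matrix of order `n + 1` with diagonal entries `2` and off-diagonal entries `-(b i j)`. -/
def ofBonds (n : ℕ) (b : ℕ → ℕ → ℕ) : Matrix (Fin (n + 1)) (Fin (n + 1)) ℤ :=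
  fun i j => if i = j then 2 else -(b i j : ℤ)

/-- `i` and `j` are neighbours in the chain `0 - 1 - 2 - ⋯`. -/
def Chain (i j : ℕ) : Prop := i + 1 = j ∨ j + 1 = i

instance (i j : ℕ) : Decidable (Chain i j) := by unfold Chain; infer_instance

/-- `i` and `j` are neighbours in the tree consisting of the chain `1 - 2 - 3 - ⋯`
and the vertex `0` attached to `2`. -/
def Fork (i j : ℕ) : Prop :=
  (Chain i j ∧ i ≠ 0 ∧ j ≠ 0) ∨ (i = 0 ∧ j = 2) ∨ (i = 2 ∧ j = 0)

instance (i j : ℕ) : Decidable (Fork i j) := by unfold Fork; infer_instance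

/-- The affine generalized Cartan matrix `a_ij = ⟨α_j, α̌_i⟩`, with the enumeration of the
vertices in Kac's tables Aff 1, Aff 2 and Aff 3. -/
def cartan : (X : AffineType) → Matrix (Fin (X.rank + 1)) (Fin (X.rank + 1)) ℤ
  | A n _ => ofBonds n fun i j =>
      if n = 1 then 2
      else if Chain i j ∨ (i = 0 ∧ j = n) ∨ (i = n ∧ j = 0) then 1 else 0
  | B n _ => ofBonds n fun i j =>
      if i = n ∧ j + 1 = n then 2 else if Fork i j then 1 else 0
  | C n _ => ofBonds n fun i j =>
      if (i = 1 ∧ j = 0) ∨ (i + 1 = n ∧ j = n) then 2 else if Chain i j then 1 else 0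
  | D n _ => ofBonds n fun i j =>
      if (Fork i j ∧ i ≠ n ∧ j ≠ n) ∨ (i + 2 = n ∧ j = n) ∨ (i = n ∧ j + 2 = n) then 1 else 0
  | E6 =>
      !![ 2,  0,  0,  0,  0,  0, -1;
          0,  2, -1,  0,  0,  0,  0;
          0, -1,  2, -1,  0,  0,  0;
          0,  0, -1,  2, -1,  0, -1;
          0,  0,  0, -1,  2, -1,  0;
          0,  0,  0,  0, -1,  2,  0;
         -1,  0,  0, -1,  0,  0,  2]
  | E7 =>
      !![ 2, -1,  0,  0,  0,  0,  0,  0;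
         -1,  2, -1,  0,  0,  0,  0,  0;
          0, -1,  2, -1,  0,  0,  0,  0;
          0,  0, -1,  2, -1,  0,  0, -1;
          0,  0,  0, -1,  2, -1,  0,  0;
          0,  0,  0,  0, -1,  2, -1,  0;
          0,  0,  0,  0,  0, -1,  2,  0;
          0,  0,  0, -1,  0,  0,  0,  2]
  | E8 =>
      !![ 2, -1,  0,  0,  0,  0,  0,  0,  0;
         -1,  2, -1,  0,  0,  0,  0,  0,  0;
          0, -1,  2, -1,  0,  0,  0,  0,  0;
          0,  0, -1,  2, -1,  0,  0,  0,  0;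
          0,  0,  0, -1,  2, -1,  0,  0,  0;
          0,  0,  0,  0, -1,  2, -1,  0, -1;
          0,  0,  0,  0,  0, -1,  2, -1,  0;
          0,  0,  0,  0,  0,  0, -1,  2,  0;
          0,  0,  0,  0,  0, -1,  0,  0,  2]
  | F4 =>
      !![ 2, -1,  0,  0,  0;
         -1,  2, -1,  0,  0;
          0, -1,  2, -1,  0;
          0,  0, -2,  2, -1;
          0,  0,  0, -1,  2]
  | G2 =>
      !![ 2, -1,  0;
         -1,  2, -1;
          0, -3,  2]
  | twAeven n _ => ofBonds n fun i j =>
      if n = 1 then (if i = 0 then 4 else 1)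
      else if (i = 0 ∧ j = 1) ∨ (i + 1 = n ∧ j = n) then 2 else if Chain i j then 1 else 0
  | twAodd n _ => ofBonds n fun i j =>
      if i + 1 = n ∧ j = n then 2 else if Fork i j then 1 else 0
  | twD n _ => ofBonds n fun i j =>
      if (i = 0 ∧ j = 1) ∨ (i = n ∧ j + 1 = n) then 2 else if Chain i j then 1 else 0
  | twE6 =>
      !![ 2, -1,  0,  0,  0;
         -1,  2, -1,  0,  0;
          0, -1,  2, -2,  0;
          0,  0, -1,  2, -1;
          0,  0,  0, -1,  2]
  | twD4 =>
      !![ 2, -1,  0;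
         -1,  2, -3;
          0, -1,  2]

/-- The labels `a_0, …, a_n` of the Dynkin diagram of `A`: the coprime positive integers
with `∑ j, a_ij a_j = 0`. -/
def marks : (X : AffineType) → Fin (X.rank + 1) → ℕ
  | A _ _ => fun _ => 1
  | B _ _ => fun i => if i.val ≤ 1 then 1 else 2
  | C n _ => fun i => if i.val = 0 ∨ i.val = n then 1 else 2
  | D n _ => fun i => if i.val ≤ 1 ∨ n ≤ i.val + 1 then 1 else 2
  | E6 => ![1, 1, 2, 3, 2, 1, 2]
  | E7 => ![1, 2, 3, 4, 3, 2, 1, 2]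
  | E8 => ![1, 2, 3, 4, 5, 6, 4, 2, 3]
  | F4 => ![1, 2, 3, 4, 2]
  | G2 => ![1, 2, 3]
  | twAeven n _ => fun i => if i.val = n then 1 else 2
  | twAodd n _ => fun i => if i.val ≤ 1 ∨ i.val = n then 1 else 2
  | twD _ _ => fun _ => 1
  | twE6 => ![1, 2, 3, 2, 1]
  | twD4 => ![1, 2, 1]

/-- The labels `ǎ_0, …, ǎ_n` of the Dynkin diagram of the transpose of `A`: the coprime
positive integers with `∑ i, ǎ_i a_ij = 0`. -/
def comarks : (X : AffineType) → Fin (X.rank + 1) → ℕ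
  | A _ _ => fun _ => 1
  | B n _ => fun i => if i.val ≤ 1 ∨ i.val = n then 1 else 2
  | C _ _ => fun _ => 1
  | D n _ => fun i => if i.val ≤ 1 ∨ n ≤ i.val + 1 then 1 else 2
  | E6 => ![1, 1, 2, 3, 2, 1, 2]
  | E7 => ![1, 2, 3, 4, 3, 2, 1, 2]
  | E8 => ![1, 2, 3, 4, 5, 6, 4, 2, 3]
  | F4 => ![1, 2, 3, 2, 1]
  | G2 => ![1, 2, 1]
  | twAeven _ _ => fun i => if i.val = 0 then 1 else 2
  | twAodd _ _ => fun i => if i.val ≤ 1 then 1 else 2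
  | twD n _ => fun i => if i.val = 0 ∨ i.val = n then 1 else 2
  | twE6 => ![1, 2, 3, 4, 2]
  | twD4 => ![1, 2, 3]

/-- The condition "`A = X_N^(1)` or `A = A_{2n}^(2)`". -/
def UntwistedOrAEven : AffineType → Prop
  | twAodd _ _ => False
  | twD _ _ => False
  | twE6 => False
  | twD4 => False
  | _ => True

/-- The dual Coxeter number `ȟ`. -/
def dualCoxeter (X : AffineType) : ℕ := ∑ i, X.comarks i

/-- The Cartan matrix of the simple Lie algebra `g̊`, obtained from `A` by deleting the
vertex `0`. Index `i` stands for the vertex `i + 1`. -/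
def finCartan (X : AffineType) : Matrix (Fin X.rank) (Fin X.rank) ℤ :=
  X.cartan.submatrix Fin.succ Fin.succ

theorem cartan_diag (X : AffineType) (i : Fin (X.rank + 1)) : X.cartan i i = 2 := by
  cases X <;> first
    | exact if_pos rfl
    | (simp only [rank] at i; fin_cases i <;> rfl)

theorem finCartan_diag (X : AffineType) (i : Fin X.rank) : X.finCartan i i = 2 :=
  X.cartan_diag i.succ

/-! ### Weights, roots and the Weyl group of `g̊` -/

/-- The weight lattice `P̊`; a weight `lam` is given by its coordinates
`lam i = ⟨lam, α̌_i⟩`, i.e. by its coefficients in the fundamental weights. -/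
abbrev Weight (X : AffineType) : Type := Fin X.rank → ℤ

/-- The simple root `α_j`, as a weight. -/
def simpleRoot (X : AffineType) (j : Fin X.rank) : X.Weight := fun i => X.finCartan i j

/-- `ρ̊`, the sum of the fundamental weights. -/
def rho (X : AffineType) : X.Weight := fun _ => 1

/-- The simple reflection `s_i lam = lam - ⟨lam, α̌_i⟩ α_i` of the weight lattice. -/
noncomputable def simpleReflection (X : AffineType) (i : Fin X.rank) : X.Weight ≃ₗ[ℤ] X.Weight :=
  Module.reflection (x := X.simpleRoot i) (f := LinearMap.proj i) (X.finCartan_diag i)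

/-- The Weyl group `W̊` of `g̊`. -/
def weylGroup (X : AffineType) : Subgroup (X.Weight ≃ₗ[ℤ] X.Weight) :=
  Subgroup.closure (Set.range X.simpleReflection)

/-- The length `ℓ(w)`: the least number of factors in an expression of `w` as a product of
simple reflections. -/
noncomputable def length (X : AffineType) (w : X.weylGroup) : ℕ :=
  sInf {m : ℕ | ∃ l : List (Fin X.rank), l.length = m ∧
    (l.map X.simpleReflection).prod = (w : X.Weight ≃ₗ[ℤ] X.Weight)}

/-- The roots attached to a Cartan matrix `C`, in coordinates with respect to the simple roots:
the images of the simple roots under products of simple reflections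
`s_i (∑ j, c j • α_j) = ∑ j, c j • α_j - (∑ j, C i j * c j) • α_i`. -/
inductive IsRoot {n : ℕ} (C : Matrix (Fin n) (Fin n) ℤ) : (Fin n → ℤ) → Prop
  | simple (i : Fin n) : IsRoot C (Pi.single i 1)
  | reflect (i : Fin n) (c : Fin n → ℤ) (hc : IsRoot C c) :
      IsRoot C (c - (C *ᵥ c) i • Pi.single i 1)

/-- `c` is the highest root: it is a root, and it exceeds every root by a nonnegative
combination of simple roots. -/
def IsHighestRoot {n : ℕ} (C : Matrix (Fin n) (Fin n) ℤ) (c : Fin n → ℤ) : Prop :=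
  IsRoot C c ∧ ∀ b, IsRoot C b → b ≤ c

/-- The highest root attached to a Cartan matrix of finite type, in coordinates with respect to
the simple roots. -/
noncomputable def highestRoot {n : ℕ} (C : Matrix (Fin n) (Fin n) ℤ) : Fin n → ℤ :=
  Classical.epsilon (IsHighestRoot C)

/-- The highest root `θ` of `g̊`, as a weight. -/
noncomputable def theta (X : AffineType) : X.Weight :=
  X.finCartan *ᵥ highestRoot X.finCartan

/-! ### The Cartan subalgebra and the normalized form

The real form of the Cartan subalgebra of `g̊` is `Fin n → ℝ`, in coordinates with respect to
the simple coroots. Its dual is also `Fin n → ℝ`, in coordinates with respect to the fundamental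
weights, so that the natural pairing is the dot product. -/

/-- The real form of the Cartan subalgebra of `g̊`; coordinates with respect to the simple
coroots. -/
abbrev CartanSpace (X : AffineType) : Type := Fin X.rank → ℝ

/-- The inclusion of the weight lattice into the (real) dual of the Cartan subalgebra. -/
def weightCast (X : AffineType) : X.Weight →+ (Fin X.rank → ℝ) where
  toFun lam := fun i => (lam i : ℝ)
  map_zero' := by ext; simp
  map_add' _ _ := by ext; simp

/-- The natural pairing `⟨lam, x⟩`. -/
def pairing (X : AffineType) (lam : X.Weight) (x : X.CartanSpace) : ℝ := X.weightCast lam ⬝ᵥ x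

/-- The Gram matrix `(α̌_i | α̌_j) = a_j ǎ_j⁻¹ a_ij` of the normalized form. It is also the matrix
of the induced isomorphism `κ` from the Cartan subalgebra to its dual,
`κ (α̌_j) = (a_j / ǎ_j) α_j`. -/
noncomputable def kappa (X : AffineType) : Matrix (Fin X.rank) (Fin X.rank) ℝ :=
  fun i j => (X.marks j.succ : ℝ) / (X.comarks j.succ : ℝ) * (X.finCartan i j : ℝ)

/-- `κ⁻¹ (lam)` for a weight `lam`; the form on weights is `(lam | mu) = ⟨mu, κ⁻¹ lam⟩`. -/
noncomputable def kappaInv (X : AffineType) (lam : X.Weight) : X.CartanSpace :=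
  X.kappa⁻¹ *ᵥ X.weightCast lam

open scoped Classical in
/-- `M = κ(Q̊ˇ)` if `A = X_N^(1)` or `A = A_{2n}^(2)`, and `M = Q̊` otherwise; as a subgroup of
the weight lattice. -/
noncomputable def latticeM (X : AffineType) : AddSubgroup X.Weight :=
  if X.UntwistedOrAEven then
    (AddSubgroup.closure
      (Set.range fun i : Fin X.rank => X.kappa *ᵥ (Pi.single i 1 : X.CartanSpace))).comap X.weightCast
  else AddSubgroup.closure (Set.range X.simpleRoot)

/-- The sublattice `(k + ȟ) M` of the weight lattice. -/
noncomputable def scaledM (X : AffineType) (k : ℕ) : AddSubgroup X.Weight :=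
  X.latticeM.map (nsmulAddMonoidHom (k + X.dualCoxeter))

open scoped Classical in
/-- `θˇ = κ⁻¹(θ)` if `A = X_N^(1)` or `A = A_{2n}^(2)`, and `θˇ` is the highest coroot of `g̊`
otherwise. -/
noncomputable def thetaCheck (X : AffineType) : X.CartanSpace :=
  if X.UntwistedOrAEven then X.kappaInv X.theta
  else fun i => (highestRoot X.finCartanᵀ i : ℝ)

/-- `P_k`: the dominant weights `lam` with `⟨lam, θˇ⟩ ≤ k`. -/
def levelWeights (X : AffineType) (k : ℕ) : Set X.Weight :=
  {lam | (∀ i, 0 ≤ lam i) ∧ X.pairing lam X.thetaCheck ≤ k}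

/-- `Pˇ_k`: the dominant coweights `x` with `⟨θ, x⟩ ≤ k`. -/
def levelCoweights (X : AffineType) (k : ℕ) : Set X.CartanSpace :=
  {x | (∀ beta ∈ AddSubgroup.closure (Set.range X.simpleRoot), ∃ m : ℤ, X.pairing beta x = m) ∧
    (∀ i, 0 ≤ X.pairing (X.simpleRoot i) x) ∧ X.pairing X.theta x ≤ k}

/-- The fundamental coweight `ω̌_i`, characterized by `⟨α_j, ω̌_i⟩ = δ_ij`. -/
noncomputable def fundamentalCoweight (X : AffineType) (i : Fin X.rank) : X.CartanSpace :=
  (X.finCartan.map (Int.cast : ℤ → ℝ))ᵀ⁻¹ *ᵥ Pi.single i 1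

/-- `ρ̊ˇ`, the sum of the fundamental coweights. -/
noncomputable def rhoCheck (X : AffineType) : X.CartanSpace := ∑ i, X.fundamentalCoweight i

/-! ### The torus, the functions `J` and `χ`, and the Hermitian form -/

/-- The torus `T̊ = Hom(P̊, ℂˣ)` (the values of an additive character are nonzero). -/
abbrev Torus (X : AffineType) : Type := AddChar X.Weight ℂ

/-- The element `exp (2πi/(k+ȟ) ⟨·, x⟩)` of the torus. -/
noncomputable def expPoint (X : AffineType) (k : ℕ) (x : X.CartanSpace) : X.Torus where
  toFun mu := Complex.exp
    (2 * Real.pi * Complex.I / ((k + X.dualCoxeter : ℕ) : ℂ) * (X.pairing mu x : ℂ))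
  map_zero_eq_one' := by simp [pairing]
  map_add_eq_mul' a b := by
    rw [← Complex.exp_add]; congr 1; simp [pairing, add_dotProduct]; ring

open scoped Classical in
/-- The finite set `Σ_k` in the torus. -/
noncomputable def sigmaSet (X : AffineType) (k : ℕ) : Set X.Torus :=
  if X.UntwistedOrAEven then
    {t | ∃ lam ∈ X.levelWeights k, t = X.expPoint k (X.kappaInv (X.rho + lam))}
  else {t | ∃ x ∈ X.levelCoweights k, t = X.expPoint k (X.rhoCheck + x)}

/-- The ring `R_k(A)` of complex functions on `Σ_k`. -/
abbrev FusionRing (X : AffineType) (k : ℕ) : Type := X.sigmaSet k → ℂ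

/-- `J_lam(t)`, the sum over the (finite) Weyl group of `(-1)^ℓ(w) w(lam + ρ̊)(t)`. -/
noncomputable def J (X : AffineType) (lam : X.Weight) (t : X.Torus) : ℂ :=
  ∑ᶠ w : X.weylGroup, (-1 : ℂ) ^ X.length w * t ((w : X.Weight ≃ₗ[ℤ] X.Weight) (lam + X.rho))

/-- `χ̊_lam = J_lam / J_0`, as a function on `Σ_k`. -/
noncomputable def chi (X : AffineType) (k : ℕ) (lam : X.levelWeights k) : X.FusionRing k :=
  fun t => X.J lam t / X.J 0 t

/-- The Hermitian form
`(f, g) = |P̊/(k+ȟ)M|⁻¹ ∑_{t ∈ Σ_k} f(t) conj(g(t)) Δ(t)` with `Δ(t) = |J_0(t)|^2`. -/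
noncomputable def hermForm (X : AffineType) (k : ℕ) (f g : X.FusionRing k) : ℂ :=
  1 / (Nat.card (X.Weight ⧸ X.scaledM k) : ℂ) *
    ∑ᶠ t : X.sigmaSet k, f t * conj (g t) * ((‖X.J 0 t‖ ^ 2 : ℝ) : ℂ)

end AffineType

set_option linter.unusedSectionVars false

/-! Put `K = k + ȟ`. Up to the factor `|P/KM|^(1/2)`, the matrix `(J_λ(t))` indexed by `P_k` and
`Σ_k` is unitary, and everything follows from this. Shifting by `ρ` turns `P_k` into the lattice
points of an open alcove for `W ⋉ KM`. In the same way `Σ_k` becomes the set of characters `x ↦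
exp(2πi⟨x, y⟩/K)` with `y` in an open alcove of a second lattice: the weight lattice again for the
first kind, the coweight lattice for the second. The two lattices modulo their scaled translation
lattices are dual finite groups.

An alternating sum over `W` vanishes at every point fixed by an affine transformation of determinant
`-1`. All remaining points lie in free orbits, and each such orbit meets the alcove exactly once. A
sum over the alcove is therefore `1/|W|` times a sum over the whole finite group, where characters
are orthogonal. This gives orthogonality of rows (`Duality.sum_altSum_mul_conj`), and of columns
after exchanging the two sides (`Duality.swap`). A zero of `J_0` would be a zero of every `J_λ`
(`alternant_eq_zero`), contradicting the nonzero norm of a column. Hence `J_λ / J_0` makes sense on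
`Σ_k`, and the weight `|J_0|^2` cancels the denominators. Rows then give orthonormality and
independence, columns give spanning.

The alcove geometry comes from the Cartan matrix alone. Conjugates of simple roots satisfy a norm
and a divisibility condition, and these force all coordinates to have one sign
(`NormRoot.nonneg_or_nonpos`). The argument covers the affine case, because the semidefinite form is
positive on nonzero vectors that miss a vertex. Deletion then yields freeness and uniqueness in the
alcove (`eq_of_mem_alcove`). Existence of representatives is a descent on the distance to an
interior point (`exists_closed_alcove`). The product of `s_0` with the reflection in `θ` is a
translation (`realized_wall`), and `translations_eq_closure` finds the lattice that its conjugates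
generate.

A type of the first kind is paired with itself through `κ`. A type of the second kind is the
transpose of an untwisted one. Its partner is the transpose of the untwisted extension of its own
finite part, whose labels add up to `ȟ` (`exists_firstKind_extension`). -/

namespace CartanForm

/-! ### Reflections and the invariant form of a symmetrizable Cartan matrix -/

section Reflections

variable {ι : Type*} [Fintype ι] [DecidableEq ι]

/-- The simple reflection on coordinates with respect to the simple roots. -/
def rootRefl (A : Matrix ι ι ℤ) (i : ι) (c : ι → ℤ) : ι → ℤ :=
  c - (A *ᵥ c) i • Pi.single i 1

/-- The simple reflection on coordinates with respect to the fundamental weights. -/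
def weightRefl (A : Matrix ι ι ℤ) (i : ι) (x : ι → ℤ) : ι → ℤ := fun j => x j - x i * A j i

/-- The action of a word in the simple reflections on root coordinates. -/
def rootWord (A : Matrix ι ι ℤ) : List ι → (ι → ℤ) → (ι → ℤ)
  | [], c => c
  | i :: l, c => rootRefl A i (rootWord A l c)

/-- The action of a word in the simple reflections on weight coordinates. -/
def weightWord (A : Matrix ι ι ℤ) : List ι → (ι → ℤ) → (ι → ℤ)
  | [], x => x
  | i :: l, x => weightRefl A i (weightWord A l x)

/-- `d` symmetrizes the generalized Cartan matrix `A`. -/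
structure Symmetrizes (A : Matrix ι ι ℤ) (d : ι → ℚ) : Prop where
  diag : ∀ i, A i i = 2
  off : ∀ i j, i ≠ j → A i j ≤ 0
  pos : ∀ i, 0 < d i
  symm : ∀ i j, d i * A i j = d j * A j i

/-- The pairing of root coordinates with weight coordinates given by the invariant form. -/
def pair (d : ι → ℚ) (c x : ι → ℤ) : ℚ := ∑ i, d i * c i * x i

/-- The invariant form on root coordinates. -/
def form (A : Matrix ι ι ℤ) (d : ι → ℚ) (c c' : ι → ℤ) : ℚ := pair d c (A *ᵥ c')

/-- The conditions on norm and divisibility that single out the conjugates of simple roots. -/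
def NormRoot (A : Matrix ι ι ℤ) (d : ι → ℚ) (i : ι) (c : ι → ℤ) : Prop :=
  (∀ j, ∃ m : ℤ, d j * c j = m * d i) ∧ form A d c c = 2 * d i

/-- The form is positive on nonzero nonnegative vectors of non-full support. -/
def ProperPos (A : Matrix ι ι ℤ) (d : ι → ℚ) : Prop :=
  ∀ c : ι → ℤ, 0 ≤ c → c ≠ 0 → (∃ i, c i = 0) → 0 < form A d c c

variable {A : Matrix ι ι ℤ} {d : ι → ℚ}

theorem pair_sub_left (c c' x : ι → ℤ) : pair d (c - c') x = pair d c x - pair d c' x := by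
  simp only [pair, ← Finset.sum_sub_distrib]
  exact Finset.sum_congr rfl fun i _ => by simp; ring

theorem pair_sub_right (c x x' : ι → ℤ) : pair d c (x - x') = pair d c x - pair d c x' := by
  simp only [pair, ← Finset.sum_sub_distrib]
  exact Finset.sum_congr rfl fun i _ => by simp; ring

theorem pair_single (i : ι) (x : ι → ℤ) : pair d (Pi.single i 1) x = d i * x i := by
  rw [pair, Finset.sum_eq_single i] <;> simp +contextual

theorem form_eq_sum (c c' : ι → ℤ) :
    form A d c c' = ∑ i, ∑ j, d i * A i j * c i * c' j := by
  simp only [form, pair, Matrix.mulVec, dotProduct]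
  refine Finset.sum_congr rfl fun i _ => ?_
  push_cast
  rw [Finset.mul_sum]
  exact Finset.sum_congr rfl fun j _ => by ring

theorem form_comm (h : Symmetrizes A d) (c c' : ι → ℤ) : form A d c c' = form A d c' c := by
  rw [form_eq_sum, form_eq_sum, Finset.sum_comm]
  refine Finset.sum_congr rfl fun i _ => Finset.sum_congr rfl fun j _ => ?_
  rw [h.symm j i]; ring

theorem form_sub_left (c c' x : ι → ℤ) : form A d (c - c') x = form A d c x - form A d c' x :=
  pair_sub_left _ _ _

theorem form_sub_right (c x x' : ι → ℤ) : form A d c (x - x') = form A d c x - form A d c x' := by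
  rw [form, Matrix.mulVec_sub, pair_sub_right]; rfl

theorem form_sub_self (h : Symmetrizes A d) (p q : ι → ℤ) :
    form A d (p - q) (p - q) = form A d p p + form A d q q - 2 * form A d p q := by
  rw [form_sub_left, form_sub_right, form_sub_right, form_comm h q p]; ring

theorem form_single_left (i : ι) (c : ι → ℤ) :
    form A d (Pi.single i 1) c = d i * (A *ᵥ c) i := pair_single _ _

theorem mulVec_single_one_apply (i j : ι) : (A *ᵥ Pi.single i 1) j = A j i := by
  simp

theorem mulVec_rootRefl_apply (i j : ι) (c : ι → ℤ) :
    (A *ᵥ rootRefl A i c) j = (A *ᵥ c) j - (A *ᵥ c) i * A j i := by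
  rw [rootRefl, Matrix.mulVec_sub, Matrix.mulVec_smul, Pi.sub_apply, Pi.smul_apply,
    mulVec_single_one_apply, smul_eq_mul]

theorem weightRefl_mulVec (i : ι) (c : ι → ℤ) :
    weightRefl A i (A *ᵥ c) = A *ᵥ (rootRefl A i c) := by
  ext j
  rw [mulVec_rootRefl_apply]; rfl

theorem weightWord_mulVec (l : List ι) (c : ι → ℤ) :
    weightWord A l (A *ᵥ c) = A *ᵥ (rootWord A l c) := by
  induction l with
  | nil => rfl
  | cons i l ih => rw [weightWord, ih, weightRefl_mulVec]; rfl

theorem rootRefl_rootRefl (h : Symmetrizes A d) (i : ι) (c : ι → ℤ) :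
    rootRefl A i (rootRefl A i c) = c := by
  have : (A *ᵥ (rootRefl A i c)) i = - (A *ᵥ c) i := by
    rw [mulVec_rootRefl_apply, h.diag]; ring
  rw [rootRefl, this, rootRefl]; simp

theorem weightRefl_weightRefl (h : Symmetrizes A d) (i : ι) (x : ι → ℤ) :
    weightRefl A i (weightRefl A i x) = x := by
  ext j; simp [weightRefl, h.diag]; ring

/-- The reflection uses row `i` of `A` on root coordinates and column `i` on weight coordinates;
symmetry of `d i * A i j` exchanges the two. -/
theorem pair_rootRefl (h : Symmetrizes A d) (i : ι) (c x : ι → ℤ) :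
    pair d (rootRefl A i c) x = pair d c (weightRefl A i x) := by
  have e1 : pair d (rootRefl A i c) x = pair d c x - (A *ᵥ c) i * (d i * x i) := by
    rw [rootRefl, pair_sub_left, ← pair_single (d := d), sub_right_inj]
    simp only [pair, Finset.mul_sum]
    exact Finset.sum_congr rfl fun j _ => by simp; ring
  have e2 : pair d c (weightRefl A i x) = pair d c x - x i * ∑ j, d i * A i j * c j := by
    simp only [pair, Finset.mul_sum, ← Finset.sum_sub_distrib]
    refine Finset.sum_congr rfl fun j _ => ?_
    rw [h.symm i j]; simp [weightRefl]; ring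
  rw [e1, e2]
  simp only [Matrix.mulVec, dotProduct]
  push_cast
  rw [Finset.sum_mul, Finset.mul_sum]
  congr 1
  exact Finset.sum_congr rfl fun j _ => by ring

theorem pair_rootRefl_weightRefl (h : Symmetrizes A d) (i : ι) (c x : ι → ℤ) :
    pair d (rootRefl A i c) (weightRefl A i x) = pair d c x := by
  rw [pair_rootRefl h, weightRefl_weightRefl h]

theorem pair_word (h : Symmetrizes A d) (l : List ι) (c x : ι → ℤ) :
    pair d (rootWord A l c) (weightWord A l x) = pair d c x := by
  induction l with
  | nil => rfl
  | cons i l ih => rw [rootWord, weightWord, pair_rootRefl_weightRefl h, ih]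

theorem form_rootRefl (h : Symmetrizes A d) (i : ι) (c c' : ι → ℤ) :
    form A d (rootRefl A i c) (rootRefl A i c') = form A d c c' := by
  rw [form, ← weightRefl_mulVec, pair_rootRefl_weightRefl h]; rfl

theorem form_rootWord (h : Symmetrizes A d) (l : List ι) (c c' : ι → ℤ) :
    form A d (rootWord A l c) (rootWord A l c') = form A d c c' := by
  rw [form, ← weightWord_mulVec, pair_word h]; rfl

theorem rootWord_append (l l' : List ι) (c : ι → ℤ) :
    rootWord A (l ++ l') c = rootWord A l (rootWord A l' c) := by
  induction l with
  | nil => rfl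
  | cons i l ih => simp [rootWord, ih]

theorem weightWord_append (l l' : List ι) (x : ι → ℤ) :
    weightWord A (l ++ l') x = weightWord A l (weightWord A l' x) := by
  induction l with
  | nil => rfl
  | cons i l ih => simp [weightWord, ih]

theorem rootWord_reverse (h : Symmetrizes A d) (l : List ι) (c : ι → ℤ) :
    rootWord A l (rootWord A l.reverse c) = c := by
  induction l generalizing c with
  | nil => rfl
  | cons i l ih =>
    rw [List.reverse_cons, rootWord, rootWord_append, ih]
    exact rootRefl_rootRefl h i c

theorem weightWord_reverse (h : Symmetrizes A d) (l : List ι) (x : ι → ℤ) :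
    weightWord A l (weightWord A l.reverse x) = x := by
  induction l generalizing x with
  | nil => rfl
  | cons i l ih =>
    rw [List.reverse_cons, weightWord, weightWord_append, ih]
    exact weightRefl_weightRefl h i x

theorem rootRefl_sub (i : ι) (c c' : ι → ℤ) :
    rootRefl A i (c - c') = rootRefl A i c - rootRefl A i c' := by
  simp only [rootRefl, Matrix.mulVec_sub, Pi.sub_apply, sub_smul]; abel

theorem rootRefl_smul (i : ι) (m : ℤ) (c : ι → ℤ) :
    rootRefl A i (m • c) = m • rootRefl A i c := by
  simp only [rootRefl, Matrix.mulVec_smul, Pi.smul_apply, smul_sub, smul_smul, smul_eq_mul]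

theorem rootWord_sub (l : List ι) (c c' : ι → ℤ) :
    rootWord A l (c - c') = rootWord A l c - rootWord A l c' := by
  induction l with
  | nil => rfl
  | cons i l ih => rw [rootWord, ih, rootRefl_sub]; rfl

theorem rootWord_smul (l : List ι) (m : ℤ) (c : ι → ℤ) :
    rootWord A l (m • c) = m • rootWord A l c := by
  induction l with
  | nil => rfl
  | cons i l ih => rw [rootWord, ih, rootRefl_smul]; rfl

theorem pair_left_ext (hd : ∀ i, 0 < d i) {x y : ι → ℤ} (h : ∀ c, pair d c x = pair d c y) :
    x = y := by
  ext i
  have := h (Pi.single i 1)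
  rw [pair_single, pair_single] at this
  exact_mod_cast mul_left_cancel₀ (hd i).ne' this

/-- A word that acts trivially on roots acts trivially on weights. -/
theorem weightWord_eq_self (h : Symmetrizes A d) {l : List ι} (hl : ∀ c, rootWord A l c = c)
    (x : ι → ℤ) : weightWord A l x = x :=
  pair_left_ext h.pos fun c => by
    conv_lhs => rw [← hl c]
    exact pair_word h l c x

/-! ### Sign coherence of roots -/

/-- Modulo 2 the terms at `(i, j)` and `(j, i)` cancel, and the diagonal is even. -/
theorem even_sum_of_symm (f : ι → ι → ℤ) (hs : ∀ i j, f i j = f j i) (hd : ∀ i, Even (f i i)) :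
    Even (∑ i, ∑ j, f i j) := by
  rw [even_iff_two_dvd]
  refine (ZMod.intCast_zmod_eq_zero_iff_dvd _ 2).1 ?_
  rw [← Finset.sum_product']
  push_cast
  refine Finset.sum_involution (fun p _ => p.swap) ?_ ?_ (by simp) (by simp)
  · rintro ⟨i, j⟩ -
    simp only [Prod.fst_swap, Prod.snd_swap, hs j i]
    exact CharTwo.add_self_eq_zero _
  · rintro ⟨i, j⟩ - hne heq
    obtain rfl : j = i := congrArg Prod.fst heq
    refine hne ((ZMod.intCast_zmod_eq_zero_iff_dvd _ 2).2 ?_)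
    exact_mod_cast even_iff_two_dvd.1 (hd j)

/-- Writing `d j * c j = m j * d i` gives `(c, c) = d i * ∑ m j * A j l * c l`, a symmetric integer
matrix with even diagonal. Norms of such vectors are thus quantized in steps of `2 * d i`. -/
theorem form_self_mem (h : Symmetrizes A d) (i : ι) (c : ι → ℤ)
    (hc : ∀ j, ∃ m : ℤ, d j * c j = m * d i) : ∃ m : ℤ, form A d c c = 2 * d i * m := by
  choose m hm using hc
  have hdi := (h.pos i).ne'
  obtain ⟨k, hk⟩ := even_sum_of_symm (fun j l => m j * A j l * c l) (fun j l => by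
    have : d i * (m j * A j l * c l) = d i * (m l * A l j * c j) := by
      linear_combination (-(A j l : ℚ) * c l) * hm j + (A l j * c j : ℚ) * hm l +
        (c j * c l : ℚ) * h.symm j l
    exact_mod_cast mul_left_cancel₀ hdi this) (fun j => by
    rw [h.diag]; exact ⟨m j * c j, by ring⟩)
  refine ⟨k, ?_⟩
  have : form A d c c = d i * ((∑ j, ∑ l, m j * A j l * c l : ℤ) : ℚ) := by
    rw [form_eq_sum]
    push_cast
    simp only [Finset.mul_sum]
    refine Finset.sum_congr rfl fun j _ => Finset.sum_congr rfl fun l _ => ?_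
    linear_combination (A j l * c l : ℚ) * hm j
  rw [this, hk]; push_cast; ring

theorem le_form_self (h : Symmetrizes A d) (i : ι) (c : ι → ℤ)
    (hc : ∀ j, ∃ m : ℤ, d j * c j = m * d i) (hpos : 0 < form A d c c) :
    2 * d i ≤ form A d c c := by
  obtain ⟨m, hm⟩ := form_self_mem h i c hc
  have hdi := h.pos i
  rw [hm] at hpos ⊢
  have : (0 : ℚ) < m := by
    by_contra hcon
    push Not at hcon
    nlinarith
  have : (1 : ℚ) ≤ m := by exact_mod_cast this
  nlinarith

theorem form_nonpos_of_disjoint (h : Symmetrizes A d) {p q : ι → ℤ} (hp : 0 ≤ p) (hq : 0 ≤ q)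
    (hpq : ∀ i, p i = 0 ∨ q i = 0) : form A d p q ≤ 0 := by
  rw [form_eq_sum]
  refine Finset.sum_nonpos fun i _ => Finset.sum_nonpos fun j _ => ?_
  by_cases hij : i = j
  · subst hij; rcases hpq i with h | h <;> simp [h]
  · have h1 : (A i j : ℚ) ≤ 0 := by exact_mod_cast h.off i j hij
    have h2 : (0 : ℚ) ≤ p i := by exact_mod_cast hp i
    have h3 : (0 : ℚ) ≤ q j := by exact_mod_cast hq j
    have : 0 ≤ d i * p i * q j := by have := h.pos i; positivity
    nlinarith

theorem div_max (i : ι) {c : ι → ℤ} (hc : ∀ j, ∃ m : ℤ, d j * c j = m * d i) :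
    ∀ j, ∃ m : ℤ, d j * ((fun j => max (c j) 0) j : ℤ) = m * d i := fun j => by
  rcases le_total (c j) 0 with h | h
  · exact ⟨0, by simp [max_eq_right h]⟩
  · simpa [max_eq_left h] using hc j

theorem div_neg {i : ι} {c : ι → ℤ} (hc : ∀ j, ∃ m : ℤ, d j * c j = m * d i) :
    ∀ j, ∃ m : ℤ, d j * ((-c) j : ℤ) = m * d i := fun j => by
  obtain ⟨m, hm⟩ := hc j
  exact ⟨-m, by simp [hm]⟩

/-- Every root is nonnegative or nonpositive. -/
theorem NormRoot.nonneg_or_nonpos (h : Symmetrizes A d) (hp : ProperPos A d) {i : ι} {c : ι → ℤ}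
    (hc : NormRoot A d i c) : 0 ≤ c ∨ c ≤ 0 := by
  set p : ι → ℤ := fun j => max (c j) 0
  set q : ι → ℤ := fun j => max ((-c) j) 0
  have hcpq : c = p - q := by
    ext j; simp only [p, q, Pi.sub_apply, Pi.neg_apply]; omega
  have hp0 : 0 ≤ p := fun j => le_max_right _ _
  have hq0 : 0 ≤ q := fun j => le_max_right _ _
  have hdis : ∀ j, p j = 0 ∨ q j = 0 := fun j => by
    simp only [p, q, Pi.neg_apply]; omega
  by_cases hpz : p = 0
  · right; intro j; have := congrFun hpz j; simp [p] at this; exact this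
  by_cases hqz : q = 0
  · left; intro j; have := congrFun hqz j; simp [q] at this; exact this
  exfalso
  obtain ⟨j, hj⟩ := Function.ne_iff.1 hpz
  obtain ⟨l, hl⟩ := Function.ne_iff.1 hqz
  -- The positive and negative parts each miss a vertex of the other, so `ProperPos` applies to
  -- both. Two norms of at least `2 * d i` and a nonpositive cross term exceed the norm `2 * d i` of
  -- `c`.
  have n1 := le_form_self h i p (div_max i hc.1)
    (hp p hp0 hpz ⟨l, (hdis l).resolve_right hl⟩)
  have n2 := le_form_self h i q (div_max i (div_neg hc.1))
    (hp q hq0 hqz ⟨j, (hdis j).resolve_left hj⟩)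
  have n3 := form_nonpos_of_disjoint h hp0 hq0 hdis
  have n4 := hc.2
  rw [hcpq, form_sub_self h] at n4
  have := h.pos i
  linarith

theorem normRoot_single (h : Symmetrizes A d) (i : ι) : NormRoot A d i (Pi.single i 1) := by
  refine ⟨fun j => ?_, by rw [form_single_left]; simp [h.diag]; ring⟩
  by_cases hj : j = i
  · subst hj; exact ⟨1, by simp⟩
  · exact ⟨0, by simp [hj]⟩

/-- Only the coordinate at `j` changes, by `(A *ᵥ c) j`; by symmetry, `d j` times this is the
integer combination `∑ A k j * m k` of multiples of `d i`. -/
theorem NormRoot.rootRefl (h : Symmetrizes A d) {i : ι} {c : ι → ℤ} (hc : NormRoot A d i c)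
    (j : ι) : NormRoot A d i (rootRefl A j c) := by
  refine ⟨fun l => ?_, by rw [form_rootRefl h, hc.2]⟩
  choose m hm using hc.1
  by_cases hl : l = j
  · subst hl
    refine ⟨m l - ∑ k, A k l * m k, ?_⟩
    have : d l * ((A *ᵥ c) l : ℤ) = (∑ k, A k l * m k : ℤ) * d i := by
      simp only [Matrix.mulVec, dotProduct]
      push_cast
      rw [Finset.mul_sum, Finset.sum_mul]
      refine Finset.sum_congr rfl fun k _ => ?_
      linear_combination (c k : ℚ) * h.symm l k + (A k l : ℚ) * hm k
    simp only [CartanForm.rootRefl, Pi.sub_apply, Pi.smul_apply, Pi.single_eq_same, smul_eq_mul,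
      mul_one]
    push_cast at this ⊢
    linear_combination hm l - this
  · exact ⟨m l, by simp [CartanForm.rootRefl, hl, hm]⟩

theorem NormRoot.rootWord (h : Symmetrizes A d) {i : ι} {c : ι → ℤ} (hc : NormRoot A d i c)
    (l : List ι) : NormRoot A d i (rootWord A l c) := by
  induction l with
  | nil => exact hc
  | cons j l ih => exact ih.rootRefl h j

theorem NormRoot.ne_zero (h : Symmetrizes A d) {i : ι} {c : ι → ℤ} (hc : NormRoot A d i c) :
    c ≠ 0 := by
  rintro rfl
  have h1 := hc.2
  have h2 := h.pos i
  simp [form, pair] at h1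
  linarith

/-- A positive root made negative by a simple reflection is the corresponding simple root. -/
theorem NormRoot.eq_single (h : Symmetrizes A d) {i j : ι} {c : ι → ℤ} (hc : NormRoot A d i c)
    (h0 : 0 ≤ c) (h1 : CartanForm.rootRefl A j c ≤ 0) : c = Pi.single j 1 ∧ d j = d i := by
  have hz : ∀ l, l ≠ j → c l = 0 := fun l hl => by
    have := h1 l
    simp [CartanForm.rootRefl, hl] at this
    exact le_antisymm this (h0 l)
  have hcs : c = c j • Pi.single j 1 := by
    ext l
    by_cases hl : l = j
    · subst hl; simp
    · simp [hl, hz l hl]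
  set k := c j
  have hk0 : 0 ≤ k := h0 j
  obtain ⟨m, hm⟩ := hc.1 j
  have hn := hc.2
  have hAc : (A *ᵥ c) j = 2 * k := by
    rw [hcs, Matrix.mulVec_smul]; simp [h.diag]; ring
  have : form A d c c = k * (d j * (2 * k)) := by
    have e : form A d c c = form A d (k • Pi.single j 1) c := by rw [← hcs]
    have e2 : (2 * k : ℚ) = ((A *ᵥ c) j : ℤ) := by rw [hAc]; push_cast; ring
    rw [e, e2, ← pair_single (d := d)]
    simp only [form, pair, Finset.mul_sum]
    exact Finset.sum_congr rfl fun l _ => by simp; ring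
  rw [this] at hn
  change d j * (k : ℚ) = _ at hm
  have hi := h.pos i
  -- Divisibility says `d j * k = m * d i` and the norm says `d j * k ^ 2 = d i`, so the integer `k`
  -- is a unit.
  have h3 : (k : ℚ) * m = 1 := by
    have : d i * (k * m) = d i * 1 := by linear_combination hn / 2 - (k : ℚ) * hm
    exact mul_left_cancel₀ hi.ne' this
  have h4 : k * m = 1 := by exact_mod_cast h3
  have hk1 : k = 1 := by
    rcases Int.eq_one_or_neg_one_of_mul_eq_one h4 with h | h <;> omega
  rw [hk1] at hn hcs
  refine ⟨by rw [hcs, one_smul], ?_⟩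
  push_cast at hn
  linarith

/-! ### Deletion and the fundamental chamber -/

/-- By sign coherence there is a single letter at which the root passes from positive to negative,
and there it must be the simple root of that letter. -/
theorem exists_split_of_nonpos (h : Symmetrizes A d) (hp : ProperPos A d) {i : ι} {c : ι → ℤ}
    (hc : NormRoot A d i c) (h0 : 0 ≤ c) (l : List ι) (hl : rootWord A l c ≤ 0) :
    ∃ l₁ j l₂, l = l₁ ++ j :: l₂ ∧ rootWord A l₂ c = Pi.single j 1 ∧ d j = d i := by
  induction l with
  | nil => exact absurd (le_antisymm hl h0) (hc.ne_zero h)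
  | cons j l ih =>
    rcases (hc.rootWord h l).nonneg_or_nonpos h hp with h1 | h1
    · exact ⟨[], j, l, rfl, (hc.rootWord h l).eq_single h h1 hl⟩
    · obtain ⟨l₁, j', l₂, e, h2⟩ := ih h1
      exact ⟨j :: l₁, j', l₂, by rw [e]; rfl, h2⟩

/-- Conjugating a reflection by an isometry gives the reflection in the image root; equality of `d
j` and `d k` makes the corresponding coroots agree as well. -/
theorem rootWord_conj (h : Symmetrizes A d) {l : List ι} {j k : ι}
    (hl : rootWord A l (Pi.single k 1) = Pi.single j 1) (hd : d j = d k) (c : ι → ℤ) :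
    rootWord A l (rootRefl A k c) = rootRefl A j (rootWord A l c) := by
  have : (A *ᵥ c) k = (A *ᵥ rootWord A l c) j := by
    have h1 := form_single_left (A := A) (d := d) k c
    rw [← form_rootWord h l, hl, form_single_left, hd] at h1
    exact_mod_cast (mul_left_cancel₀ (h.pos k).ne' h1).symm
  rw [rootRefl, rootWord_sub, rootWord_smul, hl, this]; rfl

/-- The last letter of a word of minimal length is sent to a positive root by the rest. -/
theorem rootWord_nonneg_of_reduced (h : Symmetrizes A d) (hp : ProperPos A d) (l : List ι) (k : ι)
    (hred : ∀ l', (∀ c, rootWord A l' c = rootWord A (l ++ [k]) c) → l.length < l'.length) :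
    0 ≤ rootWord A l (Pi.single k 1) := by
  have hs := normRoot_single h k
  have hs0 : (0 : ι → ℤ) ≤ Pi.single k 1 := by simp
  refine ((hs.rootWord h l).nonneg_or_nonpos h hp).resolve_right fun hn => ?_
  -- Here `l₂ s_k = s_j l₂`, so `l₁ s_j l₂ s_k` acts as `l₁ l₂`, which is two letters shorter.
  obtain ⟨l₁, j, l₂, e, h1, h2⟩ := exists_split_of_nonpos h hp hs hs0 l hn
  have := hred (l₁ ++ l₂) fun c => by
    rw [e, rootWord_append, rootWord_append, rootWord_append, rootWord, ← rootWord_conj h h1 h2]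
    simp only [rootWord]
    rw [rootRefl_rootRefl h]
  rw [e] at this
  simp at this

theorem exists_reduced (A : Matrix ι ι ℤ) (l : List ι) : ∃ l₀, (∀ c, rootWord A l₀ c = rootWord A l c) ∧
    ∀ l', (∀ c, rootWord A l' c = rootWord A l c) → l₀.length ≤ l'.length := by
  classical
  obtain ⟨l₀, h1, h2⟩ := WellFounded.has_min (measure (List.length (α := ι))).wf
    {l' | ∀ c, rootWord A l' c = rootWord A l c} ⟨l, fun _ => rfl⟩
  exact ⟨l₀, h1, fun l' hl' => not_lt.1 (h2 l' hl')⟩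

theorem pair_nonneg (hd : ∀ i, 0 < d i) {c x : ι → ℤ} (hc : 0 ≤ c) (hx : 0 ≤ x) :
    0 ≤ pair d c x := Finset.sum_nonneg fun i _ => by
  have h1 : (0 : ℚ) ≤ c i := by exact_mod_cast hc i
  have h2 : (0 : ℚ) ≤ x i := by exact_mod_cast hx i
  have := hd i
  positivity

theorem rootWord_neg (l : List ι) (c : ι → ℤ) : rootWord A l (-c) = - rootWord A l c := by
  simpa using rootWord_smul (A := A) l (-1) c

/-- Transport of the action from one word to another with the same action on roots. -/
theorem weightWord_congr (h : Symmetrizes A d) {l l' : List ι}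
    (hl : ∀ c, rootWord A l c = rootWord A l' c) (x : ι → ℤ) :
    weightWord A l x = weightWord A l' x :=
  pair_left_ext h.pos fun c => by
    rw [← rootWord_reverse h l c, pair_word h, hl, pair_word h]

/-- For a word ending in `k`, minimal for its action, the coordinate `x k` vanishes if both `x` and
its image are dominant. -/
theorem last_coord_eq_zero (h : Symmetrizes A d) (hp : ProperPos A d) (l : List ι) (k : ι)
    (hred : ∀ l', (∀ c, rootWord A l' c = rootWord A (l ++ [k]) c) → l.length < l'.length)
    {x : ι → ℤ} (hx : 0 ≤ x) (hy : 0 ≤ weightWord A (l ++ [k]) x) : x k = 0 := by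
  have h1 := rootWord_nonneg_of_reduced h hp l k hred
  have h2 : rootWord A (l ++ [k]) (Pi.single k 1) = - rootWord A l (Pi.single k 1) := by
    rw [rootWord_append, ← rootWord_neg]
    congr 1
    simp only [rootWord, rootRefl, mulVec_single_one_apply, h.diag]
    ext j; simp; ring
  -- The word sends `α_k` to minus a positive root. Invariance of the pairing equates `d k * x k`
  -- with minus a pairing of nonnegative vectors.
  have h3 := pair_word h (l ++ [k]) (Pi.single k 1) x
  rw [h2, pair_single] at h3
  have h4 := pair_nonneg h.pos h1 hy
  have h5 : pair d (-rootWord A l (Pi.single k 1)) (weightWord A (l ++ [k]) x) =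
      - pair d (rootWord A l (Pi.single k 1)) (weightWord A (l ++ [k]) x) := by
    simp [pair]
  rw [h5] at h3
  have h6 : d k * x k ≤ 0 := by linarith
  have h7 : (x k : ℚ) ≤ 0 := by
    by_contra hcon
    push Not at hcon
    have := mul_pos (h.pos k) hcon
    linarith
  exact le_antisymm (by exact_mod_cast h7) (hx k)

/-- A word carrying a strictly dominant vector to a dominant one acts trivially. -/
theorem rootWord_eq_of_pos (h : Symmetrizes A d) (hp : ProperPos A d) (l : List ι) {x : ι → ℤ}
    (hx : ∀ i, 0 < x i) (hy : 0 ≤ weightWord A l x) (c : ι → ℤ) : rootWord A l c = c := by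
  obtain ⟨l₀, h1, h2⟩ := exists_reduced A l
  rcases List.eq_nil_or_concat l₀ with rfl | ⟨l', k, rfl⟩
  · exact (h1 c).symm
  · rw [List.concat_eq_append] at h1 h2
    refine absurd (last_coord_eq_zero h hp l' k (fun l'' hl'' => ?_) (fun i => (hx i).le) ?_)
      (hx k).ne'
    · have := h2 l'' fun c => (hl'' c).trans (h1 c)
      simp at this; omega
    · rwa [weightWord_congr h h1]

/-- Two dominant vectors in the same orbit coincide. -/
theorem weightWord_eq_of_dominant (h : Symmetrizes A d) (hp : ProperPos A d) (l : List ι)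
    {x : ι → ℤ} (hx : 0 ≤ x) (hy : 0 ≤ weightWord A l x) : weightWord A l x = x := by
  induction hn : l.length using Nat.strong_induction_on generalizing l with
  | _ n ih =>
  obtain ⟨l₀, h1, h2⟩ := exists_reduced A l
  rw [← weightWord_congr h h1] at hy ⊢
  rcases List.eq_nil_or_concat l₀ with rfl | ⟨l', k, rfl⟩
  · rfl
  · rw [List.concat_eq_append] at h1 h2 hy ⊢
    have hk := last_coord_eq_zero h hp l' k (fun l'' hl'' => by
      have := h2 l'' fun c => (hl'' c).trans (h1 c)
      simp at this; omega) hx hy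
    -- Since `x k = 0`, the last letter fixes `x` and can be dropped, which shortens the word.
    have hs : weightWord A [k] x = x := by
      ext j; simp [weightWord, weightRefl, hk]
    rw [weightWord_append, hs] at hy ⊢
    refine ih l'.length ?_ l' hy rfl
    have := h2 l fun _ => rfl
    simp at this; omega

end Reflections

end CartanForm

namespace CartanForm

/-! ### Positive definite Cartan matrices and highest roots -/

section PosDef

variable {n : ℕ} {C : Matrix (Fin n) (Fin n) ℤ} {d : Fin n → ℚ}

theorem properPos_of_posDef (hpos : ∀ c, c ≠ 0 → 0 < form C d c c) : ProperPos C d :=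
  fun c _ h _ => hpos c h

/-- A positive vector satisfying the norm conditions is conjugate to a simple root. -/
theorem NormRoot.exists_word (h : Symmetrizes C d) (hpos : ∀ c, c ≠ 0 → 0 < form C d c c)
    {i : Fin n} {c : Fin n → ℤ} (hc : NormRoot C d i c) (h0 : 0 ≤ c) :
    ∃ l j, CartanForm.rootWord C l (Pi.single j 1) = c ∧ d j = d i := by
  have hp := properPos_of_posDef hpos
  obtain ⟨N, hN⟩ : ∃ N : ℕ, ∑ j, c j = N := Int.eq_ofNat_of_zero_le (Finset.sum_nonneg fun j _ => h0 j)
  induction N using Nat.strong_induction_on generalizing c with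
  | _ N ih =>
  have hf := hpos c (hc.ne_zero h)
  -- The positive norm is the sum of `d j * c j * (C c) j`, so some `(C c) j` is positive;
  -- reflecting there lowers the sum of the coordinates, which serves as induction variable.
  obtain ⟨j, -, hj⟩ := Finset.exists_lt_of_sum_lt (s := Finset.univ) (f := fun _ => (0 : ℚ))
    (g := fun j => d j * c j * ((C *ᵥ c) j : ℤ)) (by rw [Finset.sum_const_zero]; exact hf)
  have hj' : 0 < (C *ᵥ c) j := by
    have h1 : (0 : ℚ) ≤ d j * c j := mul_nonneg (h.pos j).le (by exact_mod_cast h0 j)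
    have := pos_of_mul_pos_right hj h1
    exact_mod_cast this
  rcases (hc.rootRefl h j).nonneg_or_nonpos h hp with h1 | h1
  · have hs : ∑ k, CartanForm.rootRefl C j c k = N - (C *ᵥ c) j := by
      simp only [CartanForm.rootRefl, Pi.sub_apply, Finset.sum_sub_distrib, hN, Pi.smul_apply,
        smul_eq_mul, ← Finset.mul_sum, Finset.sum_pi_single']
      simp
    have hnn : 0 ≤ ∑ k, CartanForm.rootRefl C j c k := Finset.sum_nonneg fun k _ => h1 k
    obtain ⟨N', hN'⟩ := Int.eq_ofNat_of_zero_le hnn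
    obtain ⟨l, k, h2, h3⟩ := ih N' (by omega) (hc.rootRefl h j) h1 hN'
    exact ⟨j :: l, k, by rw [CartanForm.rootWord, h2, rootRefl_rootRefl h], h3⟩
  · obtain ⟨h2, h3⟩ := hc.eq_single h h0 h1
    exact ⟨[], j, h2.symm, h3⟩

theorem isRoot_rootWord (l : List (Fin n)) (j : Fin n) :
    AffineType.IsRoot C (rootWord C l (Pi.single j 1)) := by
  induction l with
  | nil => exact .simple j
  | cons i l ih => exact .reflect i _ ih

theorem exists_normRoot (h : Symmetrizes C d) {b : Fin n → ℤ} (hb : AffineType.IsRoot C b) :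
    ∃ i, NormRoot C d i b := by
  induction hb with
  | simple i => exact ⟨i, normRoot_single h i⟩
  | reflect i c _ ih =>
    obtain ⟨k, hk⟩ := ih
    exact ⟨k, hk.rootRefl h i⟩

/-- A strictly positive dominant vector whose norm is that of the longest simple roots is the
highest root. -/
theorem isHighestRoot_of_dominant (h : Symmetrizes C d) (hpos : ∀ c, c ≠ 0 → 0 < form C d c c)
    {i : Fin n} {c : Fin n → ℤ} (hc : NormRoot C d i c) (h0 : ∀ j, 0 < c j)
    (hdom : 0 ≤ C *ᵥ c) (hlong : ∀ j, ∃ m : ℤ, d i = m * d j) : AffineType.IsHighestRoot C c := by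
  refine ⟨?_, fun b hb => ?_⟩
  · obtain ⟨l, j, rfl, -⟩ := hc.exists_word h hpos fun j => (h0 j).le
    exact isRoot_rootWord l j
  obtain ⟨k, hk⟩ := exists_normRoot h hb
  set p : Fin n → ℤ := fun j => max ((c - b) j) 0
  set q : Fin n → ℤ := fun j => max ((-(c - b)) j) 0
  have hbpq : b = (c - p) + q := by
    ext j; simp only [p, q, Pi.sub_apply, Pi.neg_apply, Pi.add_apply]; omega
  have hp0 : 0 ≤ p := fun j => le_max_right _ _
  have hq0 : 0 ≤ q := fun j => le_max_right _ _
  have hdis : ∀ j, p j = 0 ∨ q j = 0 := fun j => by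
    simp only [p, q, Pi.neg_apply]; omega
  by_cases hqz : q = 0
  · intro j
    have := congrFun hqz j
    simp [q] at this
    exact this
  exfalso
  have hcb : ∀ j, ∃ m : ℤ, d j * ((c - b) j : ℤ) = m * d k := fun j => by
    obtain ⟨m₁, h₁⟩ := hc.1 j
    obtain ⟨m₂, h₂⟩ := hk.1 j
    obtain ⟨m₃, h₃⟩ := hlong k
    exact ⟨m₁ * m₃ - m₂, by
      push_cast [Pi.sub_apply]; linear_combination h₁ - h₂ + (m₁ : ℚ) * h₃⟩
  -- Expanding the norm of `b = (c - p) + q`: the part `q` alone contributes at least `2 * d k`,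
  -- which is the norm of `b`, and the cross terms are nonnegative. So `c - p` has norm zero and `c
  -- = p`, yet `p` vanishes wherever `q` does not, while `c` is positive everywhere.
  have n1 := le_form_self h k q (div_max k (div_neg hcb)) (hpos q hqz)
  have n2 := form_nonpos_of_disjoint h hp0 hq0 hdis
  have n3 : 0 ≤ form C d c q := by
    rw [form_comm h, form]
    exact pair_nonneg h.pos hq0 hdom
  have n4 := hk.2
  have e : form C d b b = form C d (c - p) (c - p) + form C d q q + 2 * form C d (c - p) q := by
    have : b = (c - p) - (-q) := by rw [hbpq]; abel
    rw [this, form_sub_self h]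
    have e1 : form C d (-q) (-q) = form C d q q := by simp [form, pair, Matrix.mulVec_neg]
    have e2 : form C d (c - p) (-q) = - form C d (c - p) q := by simp [form, pair, Matrix.mulVec_neg]
    rw [e1, e2]; ring
  rw [form_sub_left c p q] at e
  have hcp : c - p = 0 := by
    by_contra hne
    have := hpos _ hne
    linarith
  obtain ⟨j, hj⟩ := Function.ne_iff.1 hqz
  have h1 := congrFun hcp j
  have h2 := (hdis j).resolve_right hj
  have h3 := h0 j
  simp only [Pi.sub_apply, Pi.zero_apply, h2] at h1
  omega

theorem highestRoot_eq {c : Fin n → ℤ} (hc : AffineType.IsHighestRoot C c) :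
    AffineType.highestRoot C = c := by
  have : AffineType.IsHighestRoot C (AffineType.highestRoot C) := Classical.epsilon_spec ⟨c, hc⟩
  exact le_antisymm (hc.2 _ this.1) (this.2 _ hc.1)

theorem det_ne_zero (hpos : ∀ c, c ≠ 0 → 0 < form C d c c) : C.det ≠ 0 := by
  intro h0
  obtain ⟨v, hv, hv0⟩ := Matrix.exists_mulVec_eq_zero_iff.2 h0
  have := hpos v hv
  rw [form, hv0] at this
  simp [pair] at this

end PosDef

/-! ### Affine Cartan matrices -/

/-- A symmetrizable affine Cartan matrix with labels `a` and dual labels `b`, such that the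
vertex `0` has dual label `1` and `∑ i ≥ 1, a i • α_i` is conjugate to a simple root. -/
structure AffineDatum {n : ℕ} (A : Matrix (Fin (n + 1)) (Fin (n + 1)) ℤ) (a b : Fin (n + 1) → ℤ) :
    Prop where
  diag : ∀ i, A i i = 2
  off : ∀ i j, i ≠ j → A i j ≤ 0
  a_pos : ∀ i, 0 < a i
  b_pos : ∀ i, 0 < b i
  symm : ∀ i j, b i * a j * A i j = b j * a i * A j i
  null : A *ᵥ a = 0
  b_zero : b 0 = 1
  conn : ∀ f : Fin (n + 1) → ℚ, (∀ i j, A i j ≠ 0 → f i = f j) → ∀ i j, f i = f j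
  long : ∃ i : Fin n, b i.succ = a 0 * a i.succ
  dvd : ∀ i : Fin n, a 0 ∣ b i.succ

/-- The affine Cartan matrices whose finite part is reached, from a vertex `i` with
`b i = a 0 * a i`, by steps along entries `-1`. -/
structure FirstKind {n : ℕ} (A : Matrix (Fin (n + 1)) (Fin (n + 1)) ℤ) (a b : Fin (n + 1) → ℤ) :
    Prop where
  diag : ∀ i, A i i = 2
  off : ∀ i j, i ≠ j → A i j ≤ 0
  a_pos : ∀ i, 0 < a i
  b_pos : ∀ i, 0 < b i
  symm : ∀ i j, b i * a j * A i j = b j * a i * A j i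
  null : A *ᵥ a = 0
  b_zero : b 0 = 1
  reach : ∃ i : Fin n, b i.succ = a 0 * a i.succ ∧ ∀ S : Fin n → Prop, S i →
    (∀ j k, S j → A j.succ k.succ = -1 → S k) → ∀ j, S j
  dvd : ∀ i : Fin n, a 0 ∣ b i.succ
  dvd' : ∀ i : Fin n, b i.succ ∣ a 0 * a i.succ

section Affine

variable {n : ℕ} {A : Matrix (Fin (n + 1)) (Fin (n + 1)) ℤ} {a b : Fin (n + 1) → ℤ}

theorem FirstKind.affineDatum (h : FirstKind A a b) : AffineDatum A a b where
  diag := h.diag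
  off := h.off
  a_pos := h.a_pos
  b_pos := h.b_pos
  symm := h.symm
  null := h.null
  b_zero := h.b_zero
  long := let ⟨i, hi, _⟩ := h.reach; ⟨i, hi⟩
  dvd := h.dvd
  conn := fun f hf => by
    obtain ⟨i, -, hi⟩ := h.reach
    have h1 := hi (fun j => f j.succ = f i.succ) rfl fun j k hj hjk => by
      rw [← hf j.succ k.succ (by rw [hjk]; decide), hj]
    -- The vertex `0` is not isolated: otherwise row `0` of `A a = 0` would read `2 * a 0 = 0`.
    obtain ⟨j, hj⟩ : ∃ j : Fin n, A 0 j.succ ≠ 0 := by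
      by_contra hcon
      push Not at hcon
      have := congrFun h.null 0
      simp only [Matrix.mulVec, dotProduct, Fin.sum_univ_succ, hcon, h.diag, Pi.zero_apply] at this
      have := h.a_pos 0
      simp_all
    have h0 : f 0 = f i.succ := (hf 0 j.succ hj).trans (h1 j)
    have h2 : ∀ k, f k = f i.succ := Fin.cases h0 h1
    intro k l
    rw [h2 k, h2 l]

/-- By symmetry `b` is a left null vector, so transposition exchanges the two systems of labels; `a
0 = 1` supplies the normalization of the new dual label at `0`. -/
theorem FirstKind.affineDatum_transpose (h : FirstKind A a b) (ha : a 0 = 1) :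
    AffineDatum Aᵀ b a where
  diag := h.diag
  off := fun i j hij => h.off j i hij.symm
  a_pos := h.b_pos
  b_pos := h.a_pos
  symm := fun i j => by simp only [Matrix.transpose_apply]; linear_combination h.symm j i
  null := by
    ext j
    have h1 := congrFun h.null j
    simp only [Matrix.mulVec, dotProduct, Pi.zero_apply, Matrix.transpose_apply] at h1 ⊢
    have : a j * ∑ i, A i j * b i = b j * ∑ i, A j i * a i := by
      rw [Finset.mul_sum, Finset.mul_sum]
      exact Finset.sum_congr rfl fun i _ => by linear_combination h.symm i j
    rw [h1, mul_zero] at this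
    exact (mul_eq_zero.1 this).resolve_left (h.a_pos j).ne'
  b_zero := ha
  long := let ⟨i, hi, _⟩ := h.reach; ⟨i, by rw [hi, ha, h.b_zero]; ring⟩
  dvd := fun i => by rw [h.b_zero]; exact one_dvd _
  conn := fun f hf => h.affineDatum.conn f fun i j hij => (hf j i hij).symm

/-! ### The semidefinite affine form and the wall vector -/

namespace AffineDatum

/-- The half squared lengths of the simple roots. -/
def norms (a b : Fin (n + 1) → ℤ) (i : Fin (n + 1)) : ℚ := b i / a i

/-- The half squared lengths of the simple roots other than `α_0`. -/
def finNorms (a b : Fin (n + 1) → ℤ) (i : Fin n) : ℚ := norms a b i.succ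

/-- The Cartan matrix obtained by deleting the vertex `0`. -/
def fin (A : Matrix (Fin (n + 1)) (Fin (n + 1)) ℤ) : Matrix (Fin n) (Fin n) ℤ :=
  A.submatrix Fin.succ Fin.succ

theorem norms_mul (h : AffineDatum A a b) (i : Fin (n + 1)) : norms a b i * a i = b i :=
  div_mul_cancel₀ _ (by exact_mod_cast (h.a_pos i).ne')

theorem symmetrizes (h : AffineDatum A a b) : Symmetrizes A (norms a b) where
  diag := h.diag
  off := h.off
  pos := fun i => div_pos (by exact_mod_cast h.b_pos i) (by exact_mod_cast h.a_pos i)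
  symm := fun i j => by
    have h1 : (a i : ℚ) ≠ 0 := by exact_mod_cast (h.a_pos i).ne'
    have h2 : (a j : ℚ) ≠ 0 := by exact_mod_cast (h.a_pos j).ne'
    have h3 : (b i * a j * A i j : ℚ) = b j * a i * A j i := by exact_mod_cast h.symm i j
    simp only [norms]
    field_simp
    linear_combination h3

theorem symmetrizes_fin (h : AffineDatum A a b) : Symmetrizes (fin A) (finNorms a b) where
  diag := fun i => h.diag _
  off := fun i j hij => h.off _ _ (by simpa using hij)
  pos := fun i => h.symmetrizes.pos _
  symm := fun i j => h.symmetrizes.symm _ _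

/-- As `a` is a null vector, the rows and columns of `d i * A i j * a i * a j` sum to zero, so the
quadratic form in `c i / a i` depends only on differences and becomes a sum of squares. -/
theorem form_eq (h : AffineDatum A a b) (c : Fin (n + 1) → ℤ) :
    2 * form A (norms a b) c c = ∑ i, ∑ j, -(norms a b i * A i j * a i * a j) *
      ((c i : ℚ) / a i - c j / a j) ^ 2 := by
  set d := norms a b
  have ha : ∀ i, (a i : ℚ) ≠ 0 := fun i => by exact_mod_cast (h.a_pos i).ne'
  have hrow : ∀ i, ∑ j, (A i j : ℚ) * a j = 0 := fun i => by
    have := congrFun h.null i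
    simp only [Matrix.mulVec, dotProduct, Pi.zero_apply] at this
    exact_mod_cast this
  have e1 : ∀ g : Fin (n + 1) → ℚ, ∑ i, ∑ j, d i * A i j * a i * a j * g i = 0 := fun g => by
    refine Finset.sum_eq_zero fun i _ => ?_
    have : ∑ j, d i * A i j * a i * a j * g i = d i * a i * g i * ∑ j, (A i j : ℚ) * a j := by
      rw [Finset.mul_sum]; exact Finset.sum_congr rfl fun j _ => by ring
    rw [this, hrow, mul_zero]
  have e2 : ∀ g : Fin (n + 1) → ℚ, ∑ i, ∑ j, d i * A i j * a i * a j * g j = 0 := fun g => by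
    rw [Finset.sum_comm, ← e1 g]
    refine Finset.sum_congr rfl fun i _ => Finset.sum_congr rfl fun j _ => ?_
    rw [h.symmetrizes.symm j i]; ring
  have e3 := e1 fun i => ((c i : ℚ) / a i) ^ 2
  have e4 := e2 fun i => ((c i : ℚ) / a i) ^ 2
  have e5 : ∑ i, ∑ j, -(d i * A i j * a i * a j) * ((c i : ℚ) / a i - c j / a j) ^ 2 =
      2 * form A d c c - ∑ i, ∑ j, d i * A i j * a i * a j * ((c i : ℚ) / a i) ^ 2
        - ∑ i, ∑ j, d i * A i j * a i * a j * ((c j : ℚ) / a j) ^ 2 := by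
    rw [form_eq_sum, Finset.mul_sum, ← Finset.sum_sub_distrib, ← Finset.sum_sub_distrib]
    refine Finset.sum_congr rfl fun i _ => ?_
    rw [Finset.mul_sum, ← Finset.sum_sub_distrib, ← Finset.sum_sub_distrib]
    refine Finset.sum_congr rfl fun j _ => ?_
    have := ha i
    have := ha j
    field_simp
    ring
  rw [e5, e3, e4]; ring

theorem term_nonneg (h : AffineDatum A a b) (c : Fin (n + 1) → ℤ) (i j : Fin (n + 1)) :
    0 ≤ -(norms a b i * A i j * a i * a j) * ((c i : ℚ) / a i - c j / a j) ^ 2 := by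
  by_cases hij : i = j
  · subst hij; simp
  · have h1 : (0 : ℚ) ≤ -A i j := by
      have := h.off i j hij
      exact_mod_cast neg_nonneg.2 this
    have h2 := h.symmetrizes.pos i
    have h3 : (0 : ℚ) < a i := by exact_mod_cast h.a_pos i
    have h4 : (0 : ℚ) < a j := by exact_mod_cast h.a_pos j
    have : -(norms a b i * A i j * a i * a j) = norms a b i * (-A i j) * a i * a j := by ring
    rw [this]
    positivity

/-- If the sum of squares vanishes, `c i / a i` is constant along edges, hence constant on the
connected diagram, and a single zero coordinate makes it zero. -/
theorem form_self_pos (h : AffineDatum A a b) {c : Fin (n + 1) → ℤ} (hc : c ≠ 0) (i : Fin (n + 1))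
    (hi : c i = 0) : 0 < form A (norms a b) c c := by
  have h1 := h.form_eq c
  have h2 : 0 ≤ ∑ i, ∑ j, -(norms a b i * A i j * a i * a j) *
      ((c i : ℚ) / a i - c j / a j) ^ 2 :=
    Finset.sum_nonneg fun i _ => Finset.sum_nonneg fun j _ => h.term_nonneg c i j
  refine lt_of_le_of_ne (by linarith) fun h0 => hc ?_
  rw [← h0, mul_zero] at h1
  have h3 := (Finset.sum_eq_zero_iff_of_nonneg fun i _ =>
    Finset.sum_nonneg fun j _ => h.term_nonneg c i j).1 h1.symm
  have h4 : ∀ i j, A i j ≠ 0 → (c i : ℚ) / a i = c j / a j := fun i j hij => by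
    have h5 := (Finset.sum_eq_zero_iff_of_nonneg fun j _ => h.term_nonneg c i j).1
      (h3 i (Finset.mem_univ _)) j (Finset.mem_univ _)
    have h6 : (norms a b i * A i j * a i * a j) ≠ 0 := by
      have h2 := (h.symmetrizes.pos i).ne'
      have h3 := (h.a_pos i).ne'
      have h4 := (h.a_pos j).ne'
      have : (A i j : ℚ) ≠ 0 := by exact_mod_cast hij
      have : (a i : ℚ) ≠ 0 := by exact_mod_cast h3
      have : (a j : ℚ) ≠ 0 := by exact_mod_cast h4
      positivity
    have := (mul_eq_zero.1 h5).resolve_left (neg_ne_zero.2 h6)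
    exact sub_eq_zero.1 (pow_eq_zero_iff (two_ne_zero) |>.1 this)
  ext j
  have := h.conn _ h4 j i
  rw [hi] at this
  have h7 : (a j : ℚ) ≠ 0 := by exact_mod_cast (h.a_pos j).ne'
  simpa [h7] using this

theorem properPos (h : AffineDatum A a b) : ProperPos A (norms a b) :=
  fun _ _ hc ⟨i, hi⟩ => h.form_self_pos hc i hi

theorem form_fin_pos (h : AffineDatum A a b) (c : Fin n → ℤ) (hc : c ≠ 0) :
    0 < form (fin A) (finNorms a b) c c := by
  have hne : (Fin.cons 0 c : Fin (n + 1) → ℤ) ≠ 0 := fun h0 => hc <| by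
    ext i; simpa using congrFun h0 i.succ
  have := h.form_self_pos hne 0 rfl
  rw [form_eq_sum] at this ⊢
  simpa [Fin.sum_univ_succ, finNorms, fin] using this

theorem det_fin_ne_zero (h : AffineDatum A a b) : (fin A).det ≠ 0 := det_ne_zero h.form_fin_pos

theorem left_null (h : AffineDatum A a b) (j : Fin (n + 1)) : ∑ i, b i * A i j = 0 := by
  have h1 := congrFun h.null j
  simp only [Matrix.mulVec, dotProduct, Pi.zero_apply] at h1
  have : a j * ∑ i, b i * A i j = b j * ∑ i, A j i * a i := by
    rw [Finset.mul_sum, Finset.mul_sum]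
    exact Finset.sum_congr rfl fun i _ => by linear_combination h.symm i j
  rw [h1, mul_zero] at this
  exact (mul_eq_zero.1 this).resolve_left (h.a_pos j).ne'

/-- The vector `θ / a_0`, that is `-α_0` modulo the null root, in weight coordinates. -/
def wall (A : Matrix (Fin (n + 1)) (Fin (n + 1)) ℤ) (i : Fin n) : ℤ := -A i.succ 0

theorem wall_nonneg (h : AffineDatum A a b) : 0 ≤ wall A := fun i => by
  have := h.off i.succ 0 (Fin.succ_ne_zero i)
  simp only [wall, Pi.zero_apply]; omega

theorem fin_mulVec_tail (h : AffineDatum A a b) :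
    fin A *ᵥ (fun i => a i.succ) = a 0 • wall A := by
  ext i
  have := congrFun h.null i.succ
  simp only [Matrix.mulVec, dotProduct, Fin.sum_univ_succ, Pi.zero_apply] at this
  simp only [Matrix.mulVec, dotProduct, fin, Matrix.submatrix_apply, Pi.smul_apply, wall, smul_eq_mul]
  linarith

theorem sum_b_wall (h : AffineDatum A a b) : ∑ i : Fin n, b i.succ * wall A i = 2 := by
  have := h.left_null 0
  rw [Fin.sum_univ_succ, h.b_zero, h.diag] at this
  simp only [wall, mul_neg, Finset.sum_neg_distrib]
  omega

theorem sum_b_fin (h : AffineDatum A a b) (j : Fin n) :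
    ∑ i : Fin n, b i.succ * fin A i j = -A 0 j.succ := by
  have := h.left_null j.succ
  rw [Fin.sum_univ_succ, h.b_zero] at this
  simp only [fin, Matrix.submatrix_apply]
  omega

theorem finNorms_eq (h : AffineDatum A a b) {i : Fin n} (hi : b i.succ = a 0 * a i.succ) :
    finNorms a b i = a 0 := by
  have : (a i.succ : ℚ) ≠ 0 := by exact_mod_cast (h.a_pos _).ne'
  rw [finNorms, norms, hi]; push_cast; field_simp

/-- For `θ = ∑ a_i α_i` over `i ≥ 1`, `d j * a j = b j` is a multiple of `a 0` by `dvd`, and `(θ, θ)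
= a 0 * ∑ b_i wall_i = 2 * a 0`, where `d i = a 0`. -/
theorem normRoot_tail (h : AffineDatum A a b) {i : Fin n} (hi : b i.succ = a 0 * a i.succ) :
    NormRoot (fin A) (finNorms a b) i (fun i => a i.succ) := by
  rw [NormRoot, h.finNorms_eq hi]
  refine ⟨fun j => ?_, ?_⟩
  · obtain ⟨m, hm⟩ := h.dvd j
    refine ⟨m, ?_⟩
    rw [finNorms, h.norms_mul, hm]; push_cast; ring
  · rw [form, h.fin_mulVec_tail, pair]
    have h1 : ∑ i : Fin n, (b i.succ : ℚ) * wall A i = 2 := by exact_mod_cast h.sum_b_wall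
    rw [mul_comm, ← h1, Finset.mul_sum]
    refine Finset.sum_congr rfl fun j _ => ?_
    rw [finNorms, h.norms_mul, Pi.smul_apply, smul_eq_mul]; push_cast; ring

end AffineDatum

/-- The vector is dominant because column `0` of `A` is nonpositive below the diagonal, and `dvd'`
makes its norm an integral multiple of that of every simple root. -/
theorem FirstKind.isHighestRoot (h : FirstKind A a b) :
    AffineType.IsHighestRoot (AffineDatum.fin A) (fun i => a i.succ) := by
  obtain ⟨i, hi, -⟩ := h.reach
  have h' := h.affineDatum
  refine isHighestRoot_of_dominant h'.symmetrizes_fin h'.form_fin_pos (h'.normRoot_tail hi)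
    (fun j => h.a_pos _) ?_ fun j => ?_
  · rw [h'.fin_mulVec_tail]
    exact smul_nonneg (h.a_pos 0).le h'.wall_nonneg
  · obtain ⟨m, hm⟩ := h.dvd' j
    refine ⟨m, ?_⟩
    have h1 : (a j.succ : ℚ) ≠ 0 := by exact_mod_cast (h.a_pos _).ne'
    rw [h'.finNorms_eq hi, AffineDatum.finNorms, AffineDatum.norms]
    field_simp
    have : (a 0 * a j.succ : ℚ) = b j.succ * m := by exact_mod_cast hm
    linear_combination this

end Affine

end CartanForm

namespace CartanForm

/-! ### The Weyl group of a Cartan matrix, acting on weights -/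

section Weyl

variable {n : ℕ} (C : Matrix (Fin n) (Fin n) ℤ) (hC : ∀ i, C i i = 2)

/-- The simple reflection as a linear automorphism of the weight lattice. -/
noncomputable def simpleRefl (i : Fin n) : (Fin n → ℤ) ≃ₗ[ℤ] (Fin n → ℤ) :=
  Module.reflection (x := fun j => C j i) (f := LinearMap.proj i) (hC i)

/-- The group generated by the simple reflections. -/
def weyl : Subgroup ((Fin n → ℤ) ≃ₗ[ℤ] (Fin n → ℤ)) := Subgroup.closure (Set.range (simpleRefl C hC))

variable {C hC}

theorem simpleRefl_apply (i : Fin n) (x : Fin n → ℤ) : simpleRefl C hC i x = weightRefl C i x := by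
  have := Module.reflection_apply (x := fun j => C j i) (f := LinearMap.proj i) x (hC i)
  refine this.trans ?_
  ext j; simp [weightRefl]

theorem simpleRefl_mem (i : Fin n) : simpleRefl C hC i ∈ weyl C hC :=
  Subgroup.subset_closure ⟨i, rfl⟩

/-- A reflection is the transvection `x ↦ x + f x • v` with `f v = -2`, whose determinant is `1 + f
v`. -/
theorem det_simpleRefl (i : Fin n) : LinearEquiv.det (simpleRefl C hC i) = -1 := by
  ext
  rw [LinearEquiv.coe_det]
  have : (simpleRefl C hC i : (Fin n → ℤ) →ₗ[ℤ] (Fin n → ℤ)) =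
      LinearMap.transvection (LinearMap.proj i) (-fun j => C j i) := by
    ext1 x
    ext j
    simp [simpleRefl_apply, LinearMap.transvection.apply, weightRefl, sub_eq_add_neg]
  rw [this, LinearMap.transvection.det]
  simp [hC]

theorem exists_list_of_mem_weyl {w : (Fin n → ℤ) ≃ₗ[ℤ] (Fin n → ℤ)} (hw : w ∈ weyl C hC) :
    ∃ l : List (Fin n), (l.map (simpleRefl C hC)).prod = w := by
  induction hw using Subgroup.closure_induction with
  | mem x hx => obtain ⟨i, rfl⟩ := hx; exact ⟨[i], by simp⟩
  | one => exact ⟨[], rfl⟩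
  | mul x y _ _ hx hy =>
    obtain ⟨l, rfl⟩ := hx
    obtain ⟨l', rfl⟩ := hy
    exact ⟨l ++ l', by simp⟩
  | inv x _ hx =>
    obtain ⟨l, rfl⟩ := hx
    refine ⟨l.reverse, ?_⟩
    rw [List.prod_inv_reverse, List.map_map, List.map_reverse]
    rfl

theorem prod_simpleRefl_apply (l : List (Fin n)) (x : Fin n → ℤ) :
    (l.map (simpleRefl C hC)).prod x = weightWord C l x := by
  induction l generalizing x with
  | nil => rfl
  | cons i l ih =>
    rw [List.map_cons, List.prod_cons, LinearEquiv.mul_apply, ih, simpleRefl_apply]; rfl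

theorem prod_simpleRefl_mem (l : List (Fin n)) : (l.map (simpleRefl C hC)).prod ∈ weyl C hC :=
  Subgroup.list_prod_mem _ fun x hx => by
    obtain ⟨i, -, rfl⟩ := List.mem_map.1 hx
    exact simpleRefl_mem i

theorem det_prod_simpleRefl (l : List (Fin n)) :
    LinearEquiv.det (l.map (simpleRefl C hC)).prod = (-1) ^ l.length := by
  induction l with
  | nil => simp
  | cons i l ih => rw [List.map_cons, List.prod_cons, map_mul, ih, det_simpleRefl, List.length_cons,
      pow_succ']

/-! ### The averaged invariant form -/

section Average

variable [Fintype (weyl C hC)]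

/-- The sum over the Weyl group of the standard scalar products. -/
def avg (x y : Fin n → ℤ) : ℤ := ∑ w : weyl C hC, ∑ i,
  (w : (Fin n → ℤ) ≃ₗ[ℤ] (Fin n → ℤ)) x i * (w : (Fin n → ℤ) ≃ₗ[ℤ] (Fin n → ℤ)) y i

local notation "⟪" x ", " y "⟫" => avg (C := C) (hC := hC) x y

theorem avg_comm (x y : Fin n → ℤ) : ⟪x, y⟫ = ⟪y, x⟫ := by simp only [avg, mul_comm]

theorem avg_add_left (x x' y : Fin n → ℤ) : ⟪x + x', y⟫ = ⟪x, y⟫ + ⟪x', y⟫ := by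
  simp only [avg, ← Finset.sum_add_distrib, map_add, Pi.add_apply, add_mul]

theorem avg_smul_left (m : ℤ) (x y : Fin n → ℤ) : ⟪m • x, y⟫ = m * ⟪x, y⟫ := by
  simp only [avg, Finset.mul_sum, map_smul, Pi.smul_apply, smul_eq_mul, mul_assoc]

theorem avg_add_right (x y y' : Fin n → ℤ) : ⟪x, y + y'⟫ = ⟪x, y⟫ + ⟪x, y'⟫ := by
  rw [avg_comm, avg_add_left, avg_comm y, avg_comm y']

theorem avg_smul_right (m : ℤ) (x y : Fin n → ℤ) : ⟪x, m • y⟫ = m * ⟪x, y⟫ := by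
  rw [avg_comm, avg_smul_left, avg_comm y]

theorem avg_map (w : (Fin n → ℤ) ≃ₗ[ℤ] (Fin n → ℤ)) (hw : w ∈ weyl C hC) (x y : Fin n → ℤ) :
    ⟪w x, w y⟫ = ⟪x, y⟫ :=
  Fintype.sum_equiv (Equiv.mulRight ⟨w, hw⟩) _ _ fun _ => rfl

theorem avg_self_nonneg (x : Fin n → ℤ) : 0 ≤ ⟪x, x⟫ :=
  Finset.sum_nonneg fun _ _ => Finset.sum_nonneg fun _ _ => mul_self_nonneg _

theorem avg_self_pos {x : Fin n → ℤ} (hx : x ≠ 0) : 0 < ⟪x, x⟫ := by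
  refine Finset.sum_pos (fun w _ => ?_) ⟨1, Finset.mem_univ _⟩
  obtain ⟨i, hi⟩ := Function.ne_iff.1 ((LinearEquiv.map_ne_zero_iff (w : (Fin n → ℤ) ≃ₗ[ℤ] (Fin n → ℤ))).2 hx)
  exact Finset.sum_pos' (fun _ _ => mul_self_nonneg _) ⟨i, Finset.mem_univ _, mul_self_pos.2 hi⟩

/-- For a reflection `y ↦ y - f y • v` in the Weyl group, `2 ⟪y, v⟫ = f y ⟪v, v⟫`. -/
theorem two_mul_avg {r : (Fin n → ℤ) ≃ₗ[ℤ] (Fin n → ℤ)} (hr : r ∈ weyl C hC)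
    {f : (Fin n → ℤ) → ℤ} {v : Fin n → ℤ} (hf : ∀ y, r y = y - f y • v) (hv : f v = 2)
    (y : Fin n → ℤ) : 2 * ⟪y, v⟫ = f y * ⟪v, v⟫ := by
  have h1 := avg_map r hr y v
  have h2 : r v = (-1 : ℤ) • v := by rw [hf, hv]; module
  have h3 : r y = y + (-f y) • v := by rw [hf]; module
  rw [h2, h3, avg_smul_right, avg_add_left, avg_smul_left] at h1
  linear_combination -h1

theorem avg_add_smul_self {r : (Fin n → ℤ) ≃ₗ[ℤ] (Fin n → ℤ)} (hr : r ∈ weyl C hC)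
    {f : (Fin n → ℤ) → ℤ} {v : Fin n → ℤ} (hf : ∀ y, r y = y - f y • v) (hv : f v = 2)
    (z : Fin n → ℤ) (t : ℤ) :
    ⟪z + t • v, z + t • v⟫ = ⟪z, z⟫ + t * (f z + t) * ⟪v, v⟫ := by
  have h1 := two_mul_avg hr hf hv z
  simp only [avg_add_left, avg_add_right, avg_smul_left, avg_smul_right, avg_comm v z]
  linear_combination t * h1

end Average

end Weyl

/-! ### The affine Weyl group and its alcove -/

section Alcove

variable {n : ℕ} {A : Matrix (Fin (n + 1)) (Fin (n + 1)) ℤ} {a b : Fin (n + 1) → ℤ}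

namespace AffineDatum

theorem fin_diag (h : AffineDatum A a b) (i : Fin n) : fin A i i = 2 := h.diag _

/-- The functional `∑ i ≥ 1, b i • α̌_i`. -/
def height (b : Fin (n + 1) → ℤ) (x : Fin n → ℤ) : ℤ := ∑ i, b i.succ * x i

/-- The weight of level `K` with finite part `x`. -/
def lift (b : Fin (n + 1) → ℤ) (K : ℤ) (x : Fin n → ℤ) : Fin (n + 1) → ℤ :=
  Fin.cons (K - height b x) x

theorem height_add (x y : Fin n → ℤ) : height b (x + y) = height b x + height b y := by
  simp only [height, ← Finset.sum_add_distrib, Pi.add_apply, mul_add]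

theorem height_smul (m : ℤ) (x : Fin n → ℤ) : height b (m • x) = m * height b x := by
  simp only [height, Finset.mul_sum, Pi.smul_apply, smul_eq_mul]
  exact Finset.sum_congr rfl fun i _ => by ring

theorem height_sub (x y : Fin n → ℤ) : height b (x - y) = height b x - height b y := by
  simp only [height, ← Finset.sum_sub_distrib, Pi.sub_apply, mul_sub]

theorem height_wall (h : AffineDatum A a b) : height b (wall A) = 2 := h.sum_b_wall

theorem lift_injective (K : ℤ) : Function.Injective (lift b K) := fun _ _ e =>
  (Fin.cons_injective2 e).2

/-- Because `b` is a left null vector, affine reflections preserve the level, and the coordinate at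
`0` follows the others automatically. -/
theorem weightRefl_succ_lift (h : AffineDatum A a b) (i : Fin n) (K : ℤ) (x : Fin n → ℤ) :
    weightRefl A i.succ (lift b K x) = lift b K (weightRefl (fin A) i x) := by
  ext j
  refine Fin.cases ?_ (fun j => ?_) j
  · have e : height b (weightRefl (fin A) i x) = height b x + x i * A 0 i.succ := by
      have := h.sum_b_fin i
      simp only [height, weightRefl, mul_sub, Finset.sum_sub_distrib]
      have e2 : ∑ j : Fin n, b j.succ * (x i * fin A j i) = x i * ∑ j, b j.succ * fin A j i := by
        rw [Finset.mul_sum]; exact Finset.sum_congr rfl fun _ _ => by ring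
      rw [e2, this]; ring
    change (K - height b x) - x i * A 0 i.succ = K - height b (weightRefl (fin A) i x)
    rw [e]; ring
  · simp [lift, weightRefl, fin]

/-- On finite parts `s_0` is the affine reflection in the hyperplane `height = K`. -/
theorem weightRefl_zero_lift (h : AffineDatum A a b) (K : ℤ) (x : Fin n → ℤ) :
    weightRefl A 0 (lift b K x) = lift b K (x + (K - height b x) • wall A) := by
  ext j
  refine Fin.cases ?_ (fun j => ?_) j
  · simp only [weightRefl, lift, Fin.cons_zero, height_add, height_smul, h.height_wall, h.diag]
    ring
  · simp [lift, weightRefl, wall, sub_eq_add_neg]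

/-- The affine transformation `x ↦ w x + K • t` of weights of level `K`, for all `K`, is a product
of affine simple reflections. -/
def Realized (A : Matrix (Fin (n + 1)) (Fin (n + 1)) ℤ) (b : Fin (n + 1) → ℤ)
    (w : (Fin n → ℤ) ≃ₗ[ℤ] (Fin n → ℤ)) (t : Fin n → ℤ) : Prop :=
  ∃ l, ∀ K x, weightWord A l (lift b K x) = lift b K (w x + K • t)

theorem Realized.mul {w w' : (Fin n → ℤ) ≃ₗ[ℤ] (Fin n → ℤ)} {t t' : Fin n → ℤ}
    (h : Realized A b w t) (h' : Realized A b w' t') : Realized A b (w * w') (w t' + t) := by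
  obtain ⟨l, hl⟩ := h
  obtain ⟨l', hl'⟩ := h'
  refine ⟨l ++ l', fun K x => ?_⟩
  rw [weightWord_append, hl', hl, map_add, map_smul, LinearEquiv.mul_apply, smul_add, add_assoc]

theorem Realized.neg (h : AffineDatum A a b) {t : Fin n → ℤ} (ht : Realized A b 1 t) :
    Realized A b 1 (-t) := by
  obtain ⟨l, hl⟩ := ht
  refine ⟨l.reverse, fun K x => ?_⟩
  have := hl K (x - K • t)
  rw [LinearEquiv.coe_one, id, sub_add_cancel] at this
  rw [← this]
  have h2 := weightWord_reverse h.symmetrizes l.reverse (lift b K (x - K • t))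
  rw [List.reverse_reverse] at h2
  rw [h2, LinearEquiv.coe_one, id, smul_neg, ← sub_eq_add_neg]

theorem realized_one : Realized A b 1 0 := ⟨[], fun K x => by simp [weightWord]⟩

theorem realized_of_mem (h : AffineDatum A a b) {w : (Fin n → ℤ) ≃ₗ[ℤ] (Fin n → ℤ)}
    (hw : w ∈ weyl (fin A) h.fin_diag) : Realized A b w 0 := by
  obtain ⟨l, rfl⟩ := exists_list_of_mem_weyl hw
  clear hw
  induction l with
  | nil => exact realized_one
  | cons i l ih =>
    have : Realized A b (simpleRefl (fin A) h.fin_diag i) 0 := ⟨[i.succ], fun K x => by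
      rw [smul_zero, add_zero, simpleRefl_apply, ← h.weightRefl_succ_lift]; rfl⟩
    simpa using this.mul ih

/-- The wall vector and the corresponding reflection are conjugate to a simple root and its
reflection. -/
theorem exists_conj_wall (h : AffineDatum A a b) : ∃ u ∈ weyl (fin A) h.fin_diag, ∃ j,
    finNorms a b j = a 0 ∧ (u fun i => fin A i j) = a 0 • wall A ∧
    ∀ x, a 0 * u⁻¹ x j = height b x := by
  obtain ⟨i, hi⟩ := h.long
  obtain ⟨l, j, h1, h2⟩ := (h.normRoot_tail hi).exists_word h.symmetrizes_fin h.form_fin_pos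
    fun i => (h.a_pos _).le
  rw [h.finNorms_eq hi] at h2
  refine ⟨_, prod_simpleRefl_mem l, j, h2, ?_, fun x => ?_⟩
  · rw [prod_simpleRefl_apply, ← h.fin_mulVec_tail, ← h1, ← weightWord_mulVec]
    congr 1
    ext i; simp
  · have h3 := pair_word h.symmetrizes_fin l (Pi.single j 1)
      ((l.map (simpleRefl (fin A) h.fin_diag)).prod⁻¹ x)
    rw [h1, ← prod_simpleRefl_apply (hC := h.fin_diag), ← LinearEquiv.mul_apply, mul_inv_cancel,
      LinearEquiv.coe_one, id, pair_single, h2, pair] at h3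
    have h4 : (height b x : ℚ) = ∑ i, finNorms a b i * (a i.succ : ℤ) * x i := by
      rw [height]; push_cast
      exact Finset.sum_congr rfl fun i _ => by rw [finNorms, h.norms_mul]
    rw [← h4] at h3
    exact_mod_cast h3.symm

/-- Take `u s_j u⁻¹` with `u α_j = θ`; the factor `a 0` between `θ` and the wall vector cancels
against the one in the coroot. -/
theorem exists_wall_reflection (h : AffineDatum A a b) : ∃ r ∈ weyl (fin A) h.fin_diag,
    LinearEquiv.det r = -1 ∧ ∀ x, r x = x - height b x • wall A := by
  obtain ⟨u, hu, j, -, h1, h2⟩ := h.exists_conj_wall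
  refine ⟨u * simpleRefl _ _ j * u⁻¹, mul_mem (mul_mem hu (simpleRefl_mem j)) (inv_mem hu), ?_,
    fun x => ?_⟩
  · rw [map_mul, map_mul, map_inv, det_simpleRefl, mul_inv_cancel_comm]
  · rw [LinearEquiv.mul_apply, LinearEquiv.mul_apply, simpleRefl_apply]
    have : weightRefl (fin A) j (u⁻¹ x) = u⁻¹ x - (u⁻¹ x j) • fun i => fin A i j := by
      ext i; simp [weightRefl]
    rw [this, map_sub, map_smul, h1, smul_smul, mul_comm, h2, ← LinearEquiv.mul_apply,
      mul_inv_cancel, LinearEquiv.coe_one, id]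

/-- Reflecting first in `height = 0` and then in the parallel hyperplane `height = K` is a
translation along the wall vector, of coefficient `K` since that vector has height `2`. -/
theorem realized_wall (h : AffineDatum A a b) : Realized A b 1 (wall A) := by
  obtain ⟨r, hr, -, h1⟩ := h.exists_wall_reflection
  obtain ⟨l, hl⟩ := h.realized_of_mem hr
  refine ⟨0 :: l, fun K x => ?_⟩
  rw [weightWord, hl, smul_zero, add_zero, h.weightRefl_zero_lift, h1, height_sub, height_smul,
    h.height_wall, LinearEquiv.coe_one, id]
  congr 1
  module

/-- The lattice spanned by the Weyl group orbit of the wall vector. -/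
def translations (h : AffineDatum A a b) : AddSubgroup (Fin n → ℤ) :=
  AddSubgroup.closure {t | ∃ w ∈ weyl (fin A) h.fin_diag, t = w (wall A)}

theorem map_mem_translations (h : AffineDatum A a b) {w : (Fin n → ℤ) ≃ₗ[ℤ] (Fin n → ℤ)}
    (hw : w ∈ weyl (fin A) h.fin_diag) {t : Fin n → ℤ} (ht : t ∈ h.translations) :
    w t ∈ h.translations := by
  induction ht using AddSubgroup.closure_induction with
  | mem x hx =>
    obtain ⟨w', hw', rfl⟩ := hx
    exact AddSubgroup.subset_closure ⟨w * w', mul_mem hw hw', rfl⟩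
  | zero => rw [map_zero]; exact zero_mem _
  | add x y _ _ hx hy => rw [map_add]; exact add_mem hx hy
  | neg x _ hx => rw [map_neg]; exact neg_mem hx

theorem wall_mem_translations (h : AffineDatum A a b) : wall A ∈ h.translations :=
  AddSubgroup.subset_closure ⟨1, one_mem _, rfl⟩

theorem realized_translation (h : AffineDatum A a b) {t : Fin n → ℤ} (ht : t ∈ h.translations) :
    Realized A b 1 t := by
  induction ht using AddSubgroup.closure_induction with
  | mem x hx =>
    obtain ⟨w, hw, rfl⟩ := hx
    simpa using ((h.realized_of_mem hw).mul h.realized_wall).mul (h.realized_of_mem (inv_mem hw))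
  | zero => exact realized_one
  | add x y _ _ hx hy => simpa [add_comm] using hx.mul hy
  | neg x _ hx => exact hx.neg h

theorem realized (h : AffineDatum A a b) {w : (Fin n → ℤ) ≃ₗ[ℤ] (Fin n → ℤ)}
    (hw : w ∈ weyl (fin A) h.fin_diag) {t : Fin n → ℤ} (ht : t ∈ h.translations) :
    Realized A b w t := by
  simpa using (h.realized_translation ht).mul (h.realized_of_mem hw)

/-! ### The alcove as a fundamental domain, and finiteness of the Weyl group -/

/-- The open alcove of level `K`. -/
def alcove (b : Fin (n + 1) → ℤ) (K : ℤ) : Set (Fin n → ℤ) := {x | ∀ i, 0 < lift b K x i}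

theorem mem_alcove {K : ℤ} {x : Fin n → ℤ} :
    x ∈ alcove b K ↔ (∀ i, 0 < x i) ∧ height b x < K := by
  simp [alcove, Fin.forall_fin_succ, lift, and_comm]

/-- The affine Weyl group acts freely on the points of the open alcove, which lie in different
orbits. -/
theorem eq_of_mem_alcove (h : AffineDatum A a b) {w : (Fin n → ℤ) ≃ₗ[ℤ] (Fin n → ℤ)}
    (hw : w ∈ weyl (fin A) h.fin_diag) {t : Fin n → ℤ} (ht : t ∈ h.translations) {K : ℤ}
    {x : Fin n → ℤ} (hx : x ∈ alcove b K) (hy : w x + K • t ∈ alcove b K) :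
    w = 1 ∧ w x + K • t = x := by
  -- One word realizes the transformation at all levels. Positivity at level `K` shows that it acts
  -- trivially; at level `0` the translation disappears and `w = 1` can be read off.
  obtain ⟨l, hl⟩ := h.realized hw ht
  have h1 := weightWord_eq_self h.symmetrizes
    (rootWord_eq_of_pos h.symmetrizes h.properPos l hx (by rw [hl]; exact fun i => (hy i).le))
  refine ⟨LinearEquiv.ext fun y => ?_, lift_injective (b := b) K ?_⟩
  · have := hl 0 y
    rw [h1, zero_smul, add_zero] at this
    exact (lift_injective 0 this).symm
  · rw [← hl, h1]

theorem eq_of_dominant (h : AffineDatum A a b) {w : (Fin n → ℤ) ≃ₗ[ℤ] (Fin n → ℤ)}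
    (hw : w ∈ weyl (fin A) h.fin_diag) {x : Fin n → ℤ} (hx : 0 ≤ x) (hy : 0 ≤ w x) : w x = x := by
  obtain ⟨l, rfl⟩ := exists_list_of_mem_weyl hw
  rw [prod_simpleRefl_apply] at hy ⊢
  exact weightWord_eq_of_dominant h.symmetrizes_fin (properPos_of_posDef h.form_fin_pos) l hx hy

theorem finite_quotient {m : ℤ} (hm : m ≠ 0) (N : AddSubgroup (Fin n → ℤ))
    (hN : ∀ x, m • x ∈ N) : Finite ((Fin n → ℤ) ⧸ N) := by
  have : Module.Finite ℤ ((Fin n → ℤ) ⧸ N) := Module.Finite.of_surjective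
    (QuotientAddGroup.mk' N).toIntLinearMap (QuotientAddGroup.mk'_surjective N)
  refine Module.finite_of_fg_torsion _ fun x => ?_
  obtain ⟨x, rfl⟩ := QuotientAddGroup.mk'_surjective N x
  refine ⟨⟨m, mem_nonZeroDivisors_of_ne_zero hm⟩, ?_⟩
  change m • QuotientAddGroup.mk' N x = 0
  rw [← map_zsmul, QuotientAddGroup.mk'_apply, QuotientAddGroup.eq_zero_iff]
  exact hN x

theorem one_mem_alcove (h : AffineDatum A a b) : (1 : Fin n → ℤ) ∈ alcove b (∑ i, b i) := by
  rw [mem_alcove, Fin.sum_univ_succ, h.b_zero]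
  simp [height]

/-- A Weyl group whose translation lattice has full rank is finite. -/
theorem finite_weyl (h : AffineDatum A a b) {m : ℤ} (hm : m ≠ 0)
    (hT : ∀ x, m • x ∈ h.translations) : Finite (weyl (fin A) h.fin_diag) := by
  -- This is the level at which `ρ` lies in the open alcove. By freeness there, `w ↦ w ρ` is
  -- injective modulo `K` times the translations, a lattice of finite index.
  set K := ∑ i, b i
  have hK : K ≠ 0 := (Finset.sum_pos (fun i _ => h.b_pos i) Finset.univ_nonempty).ne'
  set N : AddSubgroup (Fin n → ℤ) := h.translations.map (zsmulAddGroupHom K)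
  have : Finite ((Fin n → ℤ) ⧸ N) := finite_quotient (mul_ne_zero hK hm) N fun x =>
    ⟨m • x, hT x, by simp [mul_smul]⟩
  refine Finite.of_injective (β := (Fin n → ℤ) ⧸ N)
    (fun w => ((w : (Fin n → ℤ) ≃ₗ[ℤ] _) 1 : (Fin n → ℤ))) fun w w' e => ?_
  obtain ⟨t, ht, e⟩ := QuotientAddGroup.eq.1 e
  have h1 : (w : (Fin n → ℤ) ≃ₗ[ℤ] (Fin n → ℤ))⁻¹ * w' ∈ weyl (fin A) h.fin_diag :=
    mul_mem (inv_mem w.2) w'.2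
  have h2 : ((w : (Fin n → ℤ) ≃ₗ[ℤ] (Fin n → ℤ))⁻¹ * w') 1 +
      K • (-((w : (Fin n → ℤ) ≃ₗ[ℤ] (Fin n → ℤ))⁻¹ t)) = 1 := by
    have e' : (w' : (Fin n → ℤ) ≃ₗ[ℤ] (Fin n → ℤ)) 1 = (w : (Fin n → ℤ) ≃ₗ[ℤ] (Fin n → ℤ)) 1 + K • t := by
      have : K • t = _ := e
      rw [this]; abel
    rw [LinearEquiv.mul_apply, e', map_add, map_smul, ← LinearEquiv.mul_apply, inv_mul_cancel,
      LinearEquiv.coe_one, id]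
    module
  have h3 := h.eq_of_mem_alcove h1 (neg_mem (h.map_mem_translations (inv_mem w.2) ht))
    h.one_mem_alcove (by rw [h2]; exact h.one_mem_alcove)
  exact Subtype.ext (inv_mul_eq_one.1 h3.1)

theorem wall_ne_zero (h : AffineDatum A a b) : wall A ≠ 0 := fun h0 => by
  have := h.height_wall
  rw [h0] at this
  simp [height] at this

/-- Every orbit of the affine Weyl group meets the closed alcove. -/
theorem exists_closed_alcove (h : AffineDatum A a b) [Finite (weyl (fin A) h.fin_diag)] {K : ℤ}
    (hK : 0 < K) (x : Fin n → ℤ) : ∃ w ∈ weyl (fin A) h.fin_diag, ∃ t ∈ h.translations,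
    ∀ i, 0 ≤ lift b K (w x + K • t) i := by
  have := Fintype.ofFinite (weyl (fin A) h.fin_diag)
  set g : ℤ := ∑ i, b i
  have hg : 0 < g := Finset.sum_pos (fun i _ => h.b_pos i) Finset.univ_nonempty
  -- Up to the factor `g ^ 2`, this is the squared distance from `y` to `(K / g) ρ`, a point
  -- interior to the alcove; clearing denominators keeps it an integer, so the descent terminates.
  set q : (Fin n → ℤ) → ℤ := fun y =>
    avg (C := fin A) (hC := h.fin_diag) (g • y - K • 1) (g • y - K • 1)
  obtain ⟨N, hN⟩ : ∃ N : ℕ, q x = N := Int.eq_ofNat_of_zero_le (avg_self_nonneg _)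
  induction N using Nat.strong_induction_on generalizing x with
  | _ N ih =>
  by_cases hx : ∀ i, 0 ≤ lift b K x i
  · exact ⟨1, one_mem _, 0, zero_mem _, by simpa using hx⟩
  push Not at hx
  obtain ⟨r, hr, s, hs, hlt⟩ : ∃ r ∈ weyl (fin A) h.fin_diag, ∃ s ∈ h.translations,
      q (r x + K • s) < q x := by
    -- Moving `x` by `m • v` changes `q` by `g * m * s * ⟪v, v⟫`. For a violated wall, `m` is the
    -- coefficient of the reflection across it and `s` is `K` at the affine wall, `-K` at a finite
    -- one, so `m * s < 0`.
    have key : ∀ r ∈ weyl (fin A) h.fin_diag, ∀ (f : (Fin n → ℤ) → ℤ) (v : Fin n → ℤ),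
        (∀ y, r y = y - f y • v) → f v = 2 → v ≠ 0 → ∀ m s, m * s < 0 →
        f (g • x - K • 1) + g * m = s → q (x + m • v) < q x := fun r hr f v hf hv hv0 m s hm e => by
      have e1 : g • (x + m • v) - K • 1 = (g • x - K • 1) + (g * m) • v := by module
      simp only [q]
      rw [e1, avg_add_smul_self hr hf hv, e]
      have h1 := avg_self_pos (C := fin A) (hC := h.fin_diag) hv0
      have h2 : g * m * s < 0 := by rw [mul_assoc]; exact mul_neg_of_pos_of_neg hg hm
      have h3 := mul_neg_of_neg_of_pos h2 h1
      linarith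
    obtain ⟨i, hi⟩ := hx
    revert hi
    refine Fin.cases (fun hi => ?_) (fun i hi => ?_) i
    · obtain ⟨r, hr, -, hrf⟩ := h.exists_wall_reflection
      refine ⟨r, hr, wall A, h.wall_mem_translations, ?_⟩
      have := key r hr (height b) (wall A) hrf h.height_wall h.wall_ne_zero (K - height b x) K
        (mul_neg_of_neg_of_pos hi hK) (by
        have : height b (1 : Fin n → ℤ) = g - 1 := by
          simp only [g]; rw [Fin.sum_univ_succ, h.b_zero]; simp [height]
        rw [height_sub, height_smul, height_smul, this]; ring)
      rw [hrf]
      convert this using 2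
      module
    · refine ⟨_, simpleRefl_mem i, 0, zero_mem _, ?_⟩
      have e : ∀ y, simpleRefl (fin A) h.fin_diag i y = y - y i • fun j => fin A j i := fun y => by
        rw [simpleRefl_apply]; ext j; simp [weightRefl]
      have := key _ (simpleRefl_mem i) (fun y => y i) (fun j => fin A j i) e (h.fin_diag i)
        (fun h0 => by have := congrFun h0 i; simp [h.fin_diag] at this) (-x i) (-K)
        (by rw [neg_mul_neg]; exact mul_neg_of_neg_of_pos hi hK) (by simp; ring)
      rw [e, smul_zero, add_zero]
      convert this using 2
      module
  have hq : 0 ≤ q (r x + K • s) := avg_self_nonneg _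
  obtain ⟨N', hN'⟩ := Int.eq_ofNat_of_zero_le hq
  obtain ⟨w, hw, t, ht, h1⟩ := ih N' (by omega) (r x + K • s) hN'
  refine ⟨w * r, mul_mem hw hr, w s + t, add_mem (h.map_mem_translations hw hs) ht, ?_⟩
  rwa [map_add, map_smul, add_assoc, ← smul_add] at h1

/-- A point whose orbit avoids the open alcove is fixed by an affine transformation of
determinant `-1`. -/
theorem exists_alcove_or_fixed (h : AffineDatum A a b) [Finite (weyl (fin A) h.fin_diag)] {K : ℤ}
    (hK : 0 < K) (x : Fin n → ℤ) :
    (∃ w ∈ weyl (fin A) h.fin_diag, ∃ t ∈ h.translations, w x + K • t ∈ alcove b K) ∨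
    ∃ w ∈ weyl (fin A) h.fin_diag, LinearEquiv.det w = -1 ∧ ∃ t ∈ h.translations,
      w x + K • t = x := by
  obtain ⟨w, hw, t, ht, hc⟩ := h.exists_closed_alcove hK x
  by_cases h0 : ∀ i, lift b K (w x + K • t) i ≠ 0
  · exact Or.inl ⟨w, hw, t, ht, fun i => lt_of_le_of_ne (hc i) (h0 i).symm⟩
  push Not at h0
  right
  obtain ⟨r, hr, hrd, s, hs, hfix⟩ : ∃ r ∈ weyl (fin A) h.fin_diag, LinearEquiv.det r = -1 ∧
      ∃ s ∈ h.translations, r (w x + K • t) + K • s = w x + K • t := by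
    obtain ⟨i, hi⟩ := h0
    revert hi
    refine Fin.cases (fun hi => ?_) (fun i hi => ?_) i
    · obtain ⟨r, hr, hrd, hrf⟩ := h.exists_wall_reflection
      refine ⟨r, hr, hrd, wall A, h.wall_mem_translations, ?_⟩
      have : height b (w x + K • t) = K := (sub_eq_zero.1 hi).symm
      rw [hrf, this]; abel
    · refine ⟨_, simpleRefl_mem i, det_simpleRefl i, 0, zero_mem _, ?_⟩
      rw [smul_zero, add_zero, simpleRefl_apply]
      have : (w x + K • t) i = 0 := hi
      ext j
      rw [weightRefl, this, zero_mul, sub_zero]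
  -- Conjugating the reflection that fixes the representative in the closed alcove back to `x` does
  -- not change the determinant.
  refine ⟨w⁻¹ * r * w, mul_mem (mul_mem (inv_mem hw) hr) hw, ?_, w⁻¹ (r t + s - t),
    h.map_mem_translations (inv_mem hw)
      (sub_mem (add_mem (h.map_mem_translations hr ht) hs) ht), ?_⟩
  · rw [map_mul, map_mul, map_inv, hrd]; simp
  · have e : x = w⁻¹ (w x) := by
      rw [← LinearEquiv.mul_apply, inv_mul_cancel]; rfl
    rw [LinearEquiv.mul_apply, LinearEquiv.mul_apply, ← map_smul, ← map_add]
    conv_rhs => rw [e]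
    congr 1
    rw [map_add, map_smul] at hfix
    linear_combination (exp := 1) hfix

/-! ### Generators of the translation lattice -/

/-- If the vectors `g l` are permuted by the simple reflections up to the lattice they span, as
coroots are, and are reached from a vertex of maximal norm, then they span the translation
lattice. -/
theorem translations_eq_closure (h : AffineDatum A a b) (g : Fin n → Fin n → ℤ)
    (R : Fin n → Fin n → ℤ)
    (hg : ∀ k l, weightRefl (fin A) l (g k) = g k - R k l • g l)
    (hgl : ∀ j, finNorms a b j = a 0 → (fun i => fin A i j) = a 0 • g j)
    (hback : ∀ k l, R k l = -1 → finNorms a b l = a 0 → finNorms a b k = a 0 ∧ R l k = -1)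
    (hreach : ∃ i, ∀ S : Fin n → Prop, S i → (∀ j k, S j → R j k = -1 → S k) → ∀ j, S j) :
    h.translations = AddSubgroup.closure (Set.range g) := by
  have hstep : ∀ (T : AddSubgroup (Fin n → ℤ)) (k l), R k l = -1 → g k ∈ T →
      (∀ t ∈ T, weightRefl (fin A) l t ∈ T) → g l ∈ T := fun T k l hkl hk hT => by
    have h1 := hT _ hk
    rw [hg, hkl] at h1
    have := sub_mem h1 hk
    simpa using this
  obtain ⟨u, hu, j, hj, huj, -⟩ := h.exists_conj_wall
  have huj' : u (g j) = wall A := by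
    rw [hgl j hj, map_smul] at huj
    exact smul_right_injective _ (h.a_pos 0).ne' huj
  apply le_antisymm
  · have hstable : ∀ l, ∀ t ∈ AddSubgroup.closure (Set.range g),
        simpleRefl (fin A) h.fin_diag l t ∈ AddSubgroup.closure (Set.range g) := fun l t ht => by
      induction ht using AddSubgroup.closure_induction with
      | mem x hx =>
        obtain ⟨k, rfl⟩ := hx
        rw [simpleRefl_apply, hg]
        exact sub_mem (AddSubgroup.subset_closure (Set.mem_range_self k))
          (zsmul_mem (AddSubgroup.subset_closure (Set.mem_range_self l)) (R k l))
      | zero => rw [map_zero]; exact zero_mem _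
      | add x y _ _ hx hy => rw [map_add]; exact add_mem hx hy
      | neg x _ hx => rw [map_neg]; exact neg_mem hx
    have hstable' : ∀ w ∈ weyl (fin A) h.fin_diag, ∀ t ∈ AddSubgroup.closure (Set.range g),
        w t ∈ AddSubgroup.closure (Set.range g) := fun w hw t ht => by
      obtain ⟨l, rfl⟩ := exists_list_of_mem_weyl hw
      clear hw
      induction l with
      | nil => exact ht
      | cons i l ih => rw [List.map_cons, List.prod_cons, LinearEquiv.mul_apply]; exact hstable i _ ih
    rw [translations, AddSubgroup.closure_le]
    rintro t ⟨w, hw, rfl⟩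
    have hm : g j ∈ AddSubgroup.closure (Set.range g) :=
      AddSubgroup.subset_closure (Set.mem_range_self j)
    have := hstable' w hw _ (hstable' u hu _ hm)
    rwa [huj'] at this
  · have hT : ∀ l, ∀ t ∈ h.translations, weightRefl (fin A) l t ∈ h.translations :=
      fun l t ht => by
        rw [← simpleRefl_apply (hC := h.fin_diag)]
        exact h.map_mem_translations (simpleRefl_mem l) ht
    have hgj : g j ∈ h.translations := by
      have := h.map_mem_translations (inv_mem hu) h.wall_mem_translations
      rwa [← huj', ← LinearEquiv.mul_apply, inv_mul_cancel] at this
    obtain ⟨i, hi⟩ := hreach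
    have hgi : g i ∈ h.translations := by
      -- Only `g j` is known to be a translation, and `j` need not be the base vertex `i`. The
      -- predicate carries membership backwards along the path from `i` to `j`: by `hback` all
      -- vertices on it have maximal norm and its edges can be traversed both ways. From `i` every
      -- vertex is then reached forwards.
      refine hi (fun l => finNorms a b l = a 0 → g l ∈ h.translations → g i ∈ h.translations)
        (fun _ h => h) (fun k l ih hkl hl hgl' => ?_) j hj hgj
      obtain ⟨hk, hlk⟩ := hback k l hkl hl
      exact ih hk (hstep _ l k hlk hgl' (hT k))
    rw [AddSubgroup.closure_le]
    rintro t ⟨k, rfl⟩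
    exact hi (fun l => g l ∈ h.translations) hgi (fun k l hk hkl => hstep _ k l hkl hk (hT l)) k

end AffineDatum

end Alcove

end CartanForm

namespace CartanForm

/-! ### Orthogonality of alternating sums -/

/-- A perfect pairing modulo lattices, invariant under a finite group with a sign character, together
with fundamental domains for the regular orbits on both sides. -/
structure Duality {H L₁ L₂ : Type*} [Group H] [AddCommGroup L₁] [AddCommGroup L₂]
    (φ₁ : H →* (L₁ ≃ₗ[ℤ] L₁)) (φ₂ : H →* (L₂ ≃ₗ[ℤ] L₂)) (sgn : H →* ℤˣ) (e : L₁ → L₂ → ℂ)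
    (N₁ : AddSubgroup L₁) (N₂ : AddSubgroup L₂) (C₁ : Set L₁) (C₂ : Set L₂) : Prop where
  add_left : ∀ x x' y, e (x + x') y = e x y * e x' y
  add_right : ∀ x y y', e x (y + y') = e x y * e x y'
  norm_eq : ∀ x y, ‖e x y‖ = 1
  inv : ∀ h x y, e (φ₁ h x) (φ₂ h y) = e x y
  mem_left : ∀ x, x ∈ N₁ ↔ ∀ y, e x y = 1
  mem_right : ∀ y, y ∈ N₂ ↔ ∀ x, e x y = 1
  finite_left : Finite (L₁ ⧸ N₁)
  finite_right : Finite (L₂ ⧸ N₂)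
  free_left : ∀ h, ∀ x ∈ C₁, ∀ x' ∈ C₁, φ₁ h x - x' ∈ N₁ → h = 1 ∧ x = x'
  free_right : ∀ h, ∀ y ∈ C₂, ∀ y' ∈ C₂, φ₂ h y - y' ∈ N₂ → h = 1 ∧ y = y'
  dich_left : ∀ x, (∃ h, ∃ c ∈ C₁, φ₁ h x - c ∈ N₁) ∨ ∃ h, sgn h = -1 ∧ φ₁ h x - x ∈ N₁
  dich_right : ∀ y, (∃ h, ∃ c ∈ C₂, φ₂ h y - c ∈ N₂) ∨ ∃ h, sgn h = -1 ∧ φ₂ h y - y ∈ N₂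

namespace Duality

variable {H L₁ L₂ : Type*} [Group H] [Fintype H] [AddCommGroup L₁] [AddCommGroup L₂]
  {φ₁ : H →* (L₁ ≃ₗ[ℤ] L₁)} {φ₂ : H →* (L₂ ≃ₗ[ℤ] L₂)} {sgn : H →* ℤˣ} {e : L₁ → L₂ → ℂ}
  {N₁ : AddSubgroup L₁} {N₂ : AddSubgroup L₂} {C₁ : Set L₁} {C₂ : Set L₂}

theorem swap (D : Duality φ₁ φ₂ sgn e N₁ N₂ C₁ C₂) :
    Duality φ₂ φ₁ sgn (fun y x => e x y) N₂ N₁ C₂ C₁ where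
  add_left := fun y y' x => D.add_right x y y'
  add_right := fun y x x' => D.add_left x x' y
  norm_eq := fun y x => D.norm_eq x y
  inv := fun h y x => D.inv h x y
  mem_left := D.mem_right
  mem_right := D.mem_left
  finite_left := D.finite_right
  finite_right := D.finite_left
  free_left := D.free_right
  free_right := D.free_left
  dich_left := D.dich_right
  dich_right := D.dich_left

/-- The alternating sum over the orbit of `x`. -/
def altSum (φ₁ : H →* (L₁ ≃ₗ[ℤ] L₁)) (sgn : H →* ℤˣ) (e : L₁ → L₂ → ℂ) (x : L₁) (y : L₂) : ℂ :=
  ∑ h, ((sgn h : ℤ) : ℂ) * e (φ₁ h x) y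

theorem sgn_inv (h : H) : sgn h⁻¹ = sgn h := by rw [map_inv, Int.units_inv_eq_self]

/-- Invariance of the pairing moves `h` to the other argument as `h⁻¹`, which has the same sign.
This makes the situation symmetric in the two sides. -/
theorem altSum_swap (D : Duality φ₁ φ₂ sgn e N₁ N₂ C₁ C₂) (x : L₁) (y : L₂) :
    altSum φ₂ sgn (fun y x => e x y) y x = altSum φ₁ sgn e x y := by
  refine Fintype.sum_equiv (Equiv.inv H) _ _ fun h => ?_
  change _ * e x (φ₂ h y) = _
  rw [Equiv.inv_apply, sgn_inv, ← D.inv h⁻¹ x, ← LinearEquiv.mul_apply, ← map_mul, inv_mul_cancel,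
    map_one, LinearEquiv.coe_one, id]

theorem altSum_map_right (D : Duality φ₁ φ₂ sgn e N₁ N₂ C₁ C₂) (x : L₁) (h : H) (y : L₂) :
    altSum φ₁ sgn e x (φ₂ h y) = ((sgn h : ℤ) : ℂ) * altSum φ₁ sgn e x y := by
  rw [altSum, altSum, Finset.mul_sum]
  refine Fintype.sum_equiv (Equiv.mulLeft h⁻¹) _ _ fun g => ?_
  rw [Equiv.coe_mulLeft, map_mul, sgn_inv, map_mul, LinearEquiv.mul_apply, ← D.inv h (φ₁ h⁻¹ _),
    ← LinearEquiv.mul_apply (φ₁ h), ← map_mul φ₁, mul_inv_cancel, map_one, LinearEquiv.coe_one, id,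
    ← mul_assoc]
  congr 1
  have : (sgn h : ℤ) * (sgn h : ℤ) = 1 := by
    rw [← Units.val_mul, Int.units_mul_self, Units.val_one]
  push_cast
  rw [← mul_assoc]
  have h2 : ((sgn h : ℤ) : ℂ) * ((sgn h : ℤ) : ℂ) = 1 := by exact_mod_cast this
  rw [h2, one_mul]

theorem e_add_mem (D : Duality φ₁ φ₂ sgn e N₁ N₂ C₁ C₂) (x : L₁) {y y' : L₂} (hy : y - y' ∈ N₂) :
    e x y = e x y' := by
  have h1 := (D.mem_right _).1 hy x
  rw [← sub_add_cancel y y', D.add_right, h1, one_mul]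

theorem altSum_congr (D : Duality φ₁ φ₂ sgn e N₁ N₂ C₁ C₂) (x : L₁) {y y' : L₂} (hy : y - y' ∈ N₂) :
    altSum φ₁ sgn e x y = altSum φ₁ sgn e x y' :=
  Finset.sum_congr rfl fun h _ => by rw [D.e_add_mem _ hy]

theorem map_mem_right (D : Duality φ₁ φ₂ sgn e N₁ N₂ C₁ C₂) (h : H) {y : L₂} (hy : y ∈ N₂) :
    φ₂ h y ∈ N₂ := by
  rw [D.mem_right] at hy ⊢
  intro x
  have := D.inv h ((φ₁ h)⁻¹ x) y
  rw [← LinearEquiv.mul_apply, mul_inv_cancel, LinearEquiv.coe_one, id] at this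
  rw [this, hy]

/-- The regular orbits modulo `N₂` are free and meet `C₂` only once, so `H × C₂` parametrizes their
union. -/
theorem injective_mk (D : Duality φ₁ φ₂ sgn e N₁ N₂ C₁ C₂) :
    Function.Injective fun p : H × C₂ => (QuotientAddGroup.mk (φ₂ p.1 p.2) : L₂ ⧸ N₂) := by
  rintro ⟨h, c⟩ ⟨h', c'⟩ heq
  have h1 := D.map_mem_right h⁻¹ (QuotientAddGroup.eq.1 heq)
  simp only [map_add, map_neg] at h1
  rw [← LinearEquiv.mul_apply, ← LinearEquiv.mul_apply, ← map_mul, ← map_mul, inv_mul_cancel,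
    map_one, LinearEquiv.coe_one, id, neg_add_eq_sub] at h1
  obtain ⟨h2, h3⟩ := D.free_right _ _ c'.2 _ c.2 h1
  exact Prod.ext (inv_mul_eq_one.1 h2) (Subtype.ext h3.symm)

theorem finite_right_domain (D : Duality φ₁ φ₂ sgn e N₁ N₂ C₁ C₂) : Finite C₂ := by
  have := D.finite_right
  exact Finite.of_injective _ (D.injective_mk.comp (Prod.mk_right_injective (1 : H)))

/-- Orthogonality of characters: translating by a `y` with `e z y ≠ 1` multiplies the sum by `e z
y`. -/
theorem sum_char (D : Duality φ₁ φ₂ sgn e N₁ N₂ C₁ C₂) [Fintype (L₂ ⧸ N₂)] (z : L₁)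
    [Decidable (z ∈ N₁)] :
    ∑ q : L₂ ⧸ N₂, e z q.out = if z ∈ N₁ then (Nat.card (L₂ ⧸ N₂) : ℂ) else 0 := by
  split_ifs with hz
  · rw [D.mem_left] at hz
    simp [hz, Nat.card_eq_fintype_card]
  · rw [D.mem_left] at hz
    push Not at hz
    obtain ⟨y, hy⟩ := hz
    have h1 : ∑ q : L₂ ⧸ N₂, e z q.out = e z y * ∑ q : L₂ ⧸ N₂, e z q.out := by
      rw [Finset.mul_sum]
      symm
      refine Fintype.sum_equiv (Equiv.addLeft (QuotientAddGroup.mk y)) _ _ fun q => ?_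
      rw [← D.add_right]
      refine D.e_add_mem z ?_
      rw [← neg_sub, neg_mem_iff, ← neg_add_eq_sub]
      apply QuotientAddGroup.eq.1
      simp
    have h2 : (1 - e z y) * ∑ q : L₂ ⧸ N₂, e z q.out = 0 := by linear_combination h1
    exact (mul_eq_zero.1 h2).resolve_left (sub_ne_zero.2 hy.symm)

/-- Both cardinalities evaluate the double sum of `e` over the two quotients, according to which
variable is summed first. -/
theorem card_eq (D : Duality φ₁ φ₂ sgn e N₁ N₂ C₁ C₂) :
    Nat.card (L₁ ⧸ N₁) = Nat.card (L₂ ⧸ N₂) := by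
  classical
  have := D.finite_left
  have := D.finite_right
  have := Fintype.ofFinite (L₁ ⧸ N₁)
  have := Fintype.ofFinite (L₂ ⧸ N₂)
  have key : ∀ p : L₁ ⧸ N₁, p.out ∈ N₁ ↔ p = 0 := fun p => by
    rw [← QuotientAddGroup.eq_zero_iff, QuotientAddGroup.out_eq']
  have key' : ∀ p : L₂ ⧸ N₂, p.out ∈ N₂ ↔ p = 0 := fun p => by
    rw [← QuotientAddGroup.eq_zero_iff, QuotientAddGroup.out_eq']
  have h1 : ∑ p : L₁ ⧸ N₁, ∑ q : L₂ ⧸ N₂, e p.out q.out = (Nat.card (L₂ ⧸ N₂) : ℂ) := by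
    simp [D.sum_char, key]
  have h2 : ∑ p : L₁ ⧸ N₁, ∑ q : L₂ ⧸ N₂, e p.out q.out = (Nat.card (L₁ ⧸ N₁) : ℂ) := by
    rw [Finset.sum_comm]
    simp [D.swap.sum_char, key']
  exact_mod_cast h2.symm.trans h1

theorem e_neg (D : Duality φ₁ φ₂ sgn e N₁ N₂ C₁ C₂) (x : L₁) (y : L₂) :
    e (-x) y = conj (e x y) := by
  have h0 : e 0 y = 1 := (D.mem_left 0).1 (zero_mem _) y
  have h1 : e x y * e (-x) y = 1 := by rw [← D.add_left, add_neg_cancel, h0]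
  have h2 : e x y * conj (e x y) = 1 := by
    rw [Complex.mul_conj, Complex.normSq_eq_norm_sq, D.norm_eq]; simp
  have h3 : e x y ≠ 0 := left_ne_zero_of_mul_eq_one h1
  exact mul_left_cancel₀ h3 (h1.trans h2.symm)

/-- Orthogonality of the alternating sums attached to points of the fundamental domain. -/
theorem sum_altSum_mul_conj (D : Duality φ₁ φ₂ sgn e N₁ N₂ C₁ C₂) [Fintype C₂] {x x' : L₁}
    (hx : x ∈ C₁) (hx' : x' ∈ C₁) [Decidable (x = x')] :
    ∑ y : C₂, altSum φ₁ sgn e x y * conj (altSum φ₁ sgn e x' y) =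
      if x = x' then (Nat.card (L₂ ⧸ N₂) : ℂ) else 0 := by
  classical
  have := D.finite_right
  have := Fintype.ofFinite (L₂ ⧸ N₂)
  set F : L₂ → ℂ := fun y => altSum φ₁ sgn e x y * conj (altSum φ₁ sgn e x' y)
  have hsq : ∀ h, ((sgn h : ℤ) : ℂ) * ((sgn h : ℤ) : ℂ) = 1 := fun h => by
    have : (sgn h : ℤ) * (sgn h : ℤ) = 1 := by
      rw [← Units.val_mul, Int.units_mul_self, Units.val_one]
    exact_mod_cast this
  have hFN : ∀ y y', y - y' ∈ N₂ → F y = F y' := fun y y' h => by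
    simp only [F, D.altSum_congr _ h]
  have hFH : ∀ h y, F (φ₂ h y) = F y := fun h y => by
    simp only [F, D.altSum_map_right, map_mul, map_intCast]
    linear_combination (altSum φ₁ sgn e x y * conj (altSum φ₁ sgn e x' y)) * hsq h
  have hout : ∀ y, F (QuotientAddGroup.mk y : L₂ ⧸ N₂).out = F y := fun y => hFN _ _ <| by
    rw [← neg_sub, neg_mem_iff, ← neg_add_eq_sub]
    apply QuotientAddGroup.eq.1
    simp
  -- The product of one alternating sum with a conjugate one is `H`-invariant, and outside the
  -- regular orbits it vanishes because each factor equals its own negative.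
  have e1 : ∑ p : H × C₂, F p.2 = ∑ q : L₂ ⧸ N₂, F q.out := by
    refine Fintype.sum_of_injective _ D.injective_mk _ _ (fun q hq => ?_) fun p => ?_
    · obtain ⟨y, rfl⟩ := QuotientAddGroup.mk_surjective q
      rw [hout]
      rcases D.dich_right y with ⟨h, c, hc, h1⟩ | ⟨h, h1, h2⟩
      · refine absurd ⟨⟨h⁻¹, c, hc⟩, ?_⟩ hq
        rw [QuotientAddGroup.eq]
        have := D.map_mem_right h⁻¹ h1
        rwa [map_sub, ← LinearEquiv.mul_apply, ← map_mul, inv_mul_cancel, map_one,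
          LinearEquiv.coe_one, id, ← neg_add_eq_sub] at this
      · have h3 : altSum φ₁ sgn e x y = - altSum φ₁ sgn e x y := by
          conv_lhs => rw [← D.altSum_congr x h2, D.altSum_map_right, h1]
          simp
        have h4 : altSum φ₁ sgn e x y = 0 := self_eq_neg.1 h3
        simp only [F, h4, zero_mul]
    · rw [hout, hFH]
  -- Expanding both alternating sums leaves character sums of `h x - h' x'`; freeness on the left
  -- keeps only `h = h'` and `x = x'`, that is `|H|` terms.
  have e2 : ∑ q : L₂ ⧸ N₂, F q.out = Fintype.card H *
      if x = x' then (Nat.card (L₂ ⧸ N₂) : ℂ) else 0 := by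
    have h1 : ∀ y, F y = ∑ h, ∑ h', (((sgn h : ℤ) : ℂ) * ((sgn h' : ℤ) : ℂ)) *
        e (φ₁ h x - φ₁ h' x') y := fun y => by
      simp only [F, altSum, map_sum, Finset.sum_mul_sum, map_mul, map_intCast]
      refine Finset.sum_congr rfl fun h _ => Finset.sum_congr rfl fun h' _ => ?_
      rw [sub_eq_add_neg, D.add_left, D.e_neg]; ring
    simp only [h1]
    rw [Finset.sum_comm]
    have h2 : ∀ h h', φ₁ h x - φ₁ h' x' ∈ N₁ ↔ h = h' ∧ x = x' := fun h h' => by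
      constructor
      · intro hm
        have := D.swap.map_mem_right h'⁻¹ hm
        rw [map_sub, ← LinearEquiv.mul_apply, ← LinearEquiv.mul_apply, ← map_mul, ← map_mul,
          inv_mul_cancel, map_one, LinearEquiv.coe_one, id] at this
        obtain ⟨h3, h4⟩ := D.free_left _ _ hx _ hx' this
        exact ⟨(inv_mul_eq_one.1 h3).symm, h4⟩
      · rintro ⟨rfl, rfl⟩
        rw [sub_self]; exact zero_mem _
    have h3 : ∀ h, ∑ q : L₂ ⧸ N₂, ∑ h', (((sgn h : ℤ) : ℂ) * ((sgn h' : ℤ) : ℂ)) *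
        e (φ₁ h x - φ₁ h' x') q.out = if x = x' then (Nat.card (L₂ ⧸ N₂) : ℂ) else 0 := fun h => by
      rw [Finset.sum_comm]
      simp only [← Finset.mul_sum, D.sum_char, h2]
      by_cases hxx : x = x'
      · simp [hxx, hsq]
      · simp [hxx]
    simp only [h3, Finset.sum_const, Finset.card_univ, nsmul_eq_mul]
  have e3 : ∑ p : H × C₂, F p.2 = Fintype.card H * ∑ y : C₂, F y := by
    rw [Fintype.sum_prod_type]
    simp [Finset.card_univ]
  have hH : (Fintype.card H : ℂ) ≠ 0 := Nat.cast_ne_zero.2 Fintype.card_ne_zero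
  exact mul_left_cancel₀ hH (e3.symm.trans (e1.trans e2))

end Duality

/-! ### Vanishing of all alternating sums at a zero of the denominator -/

section Denominator

variable {n : ℕ} {A : Matrix (Fin (n + 1)) (Fin (n + 1)) ℤ} {a b : Fin (n + 1) → ℤ}

namespace AffineDatum

/-- The alternating sum of a character over a Weyl group orbit. -/
noncomputable def alternant (h : AffineDatum A a b) [Fintype (weyl (fin A) h.fin_diag)]
    (t : AddChar (Fin n → ℤ) ℂ) (x : Fin n → ℤ) : ℂ :=
  ∑ w : weyl (fin A) h.fin_diag,
    (((LinearEquiv.det (w : (Fin n → ℤ) ≃ₗ[ℤ] (Fin n → ℤ)) : ℤˣ) : ℤ) : ℂ) *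
      t ((w : (Fin n → ℤ) ≃ₗ[ℤ] (Fin n → ℤ)) x)

theorem alternant_map (h : AffineDatum A a b) [Fintype (weyl (fin A) h.fin_diag)]
    (t : AddChar (Fin n → ℤ) ℂ) (x : Fin n → ℤ) {u : (Fin n → ℤ) ≃ₗ[ℤ] (Fin n → ℤ)}
    (hu : u ∈ weyl (fin A) h.fin_diag) :
    h.alternant t (u x) = (((LinearEquiv.det u : ℤˣ) : ℤ) : ℂ) * h.alternant t x := by
  rw [alternant, alternant, Finset.mul_sum]
  refine Fintype.sum_equiv (Equiv.mulRight ⟨u, hu⟩) _ _ fun w => ?_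
  have h1 : (((LinearEquiv.det u : ℤˣ) : ℤ) : ℂ) * (((LinearEquiv.det u : ℤˣ) : ℤ) : ℂ) = 1 := by
    have : ((LinearEquiv.det u : ℤˣ) : ℤ) * ((LinearEquiv.det u : ℤˣ) : ℤ) = 1 := by
      rw [← Units.val_mul, Int.units_mul_self, Units.val_one]
    exact_mod_cast this
  rw [Equiv.coe_mulRight, Subgroup.coe_mul, map_mul, LinearEquiv.mul_apply]
  push_cast
  linear_combination (-(((LinearEquiv.det (w : (Fin n → ℤ) ≃ₗ[ℤ] (Fin n → ℤ)) : ℤˣ) : ℤ) : ℂ) *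
    t ((w : (Fin n → ℤ) ≃ₗ[ℤ] (Fin n → ℤ)) (u x))) * h1

theorem simpleRefl_eq (h : AffineDatum A a b) (i : Fin n) (y : Fin n → ℤ) :
    simpleRefl (fin A) h.fin_diag i y = y - y i • fun j => fin A j i := by
  rw [simpleRefl_apply]; ext j; simp [weightRefl]

/-- A point at which the scalar product with `ρ` is maximal on its orbit is dominant. -/
theorem nonneg_of_avg_max (h : AffineDatum A a b) [Fintype (weyl (fin A) h.fin_diag)]
    {y : Fin n → ℤ} (hy : ∀ u ∈ weyl (fin A) h.fin_diag,
      avg (C := fin A) (hC := h.fin_diag) (u y) 1 ≤ avg (C := fin A) (hC := h.fin_diag) y 1) :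
    0 ≤ y := fun i => by
  have h1 := hy _ (simpleRefl_mem i)
  -- At `ρ` this gives `2 ⟪ρ, α_i⟫ = ⟪α_i, α_i⟫ > 0`, so a negative coordinate `y i` would let `s_i`
  -- increase the product with `ρ`.
  have h2 := two_mul_avg (simpleRefl_mem i) (f := fun y => y i) (h.simpleRefl_eq i) (h.fin_diag i) 1
  have h3 : (fun j => fin A j i) ≠ 0 := fun h0 => by
    have := congrFun h0 i; simp [h.fin_diag] at this
  have h4 := avg_self_pos (C := fin A) (hC := h.fin_diag) h3
  rw [h.simpleRefl_eq, sub_eq_add_neg, ← neg_smul, avg_add_left, avg_smul_left,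
    avg_comm (fun j => fin A j i) 1] at h1
  simp only [Pi.one_apply, one_mul] at h2
  simp only [Pi.zero_apply]
  by_contra hcon
  push Not at hcon
  nlinarith

theorem exists_avg_max (h : AffineDatum A a b) [Fintype (weyl (fin A) h.fin_diag)]
    (y : Fin n → ℤ) : ∃ w ∈ weyl (fin A) h.fin_diag, ∀ u ∈ weyl (fin A) h.fin_diag,
      avg (C := fin A) (hC := h.fin_diag) (u y) 1 ≤
        avg (C := fin A) (hC := h.fin_diag) (w y) 1 := by
  obtain ⟨w, hw⟩ := Finite.exists_max fun w : weyl (fin A) h.fin_diag =>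
    avg (C := fin A) (hC := h.fin_diag) ((w : (Fin n → ℤ) ≃ₗ[ℤ] (Fin n → ℤ)) y) 1
  exact ⟨w, w.2, fun u hu => hw ⟨u, hu⟩⟩

theorem exists_dominant (h : AffineDatum A a b) [Fintype (weyl (fin A) h.fin_diag)]
    (y : Fin n → ℤ) : ∃ w ∈ weyl (fin A) h.fin_diag, 0 ≤ w y := by
  obtain ⟨w, hw, h1⟩ := h.exists_avg_max y
  exact ⟨w, hw, h.nonneg_of_avg_max fun u hu => h1 (u * w) (mul_mem hu hw)⟩

/-- The product with `ρ` attains its maximum on an orbit only at dominant points, and an orbit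
contains only one of these. -/
theorem avg_map_lt (h : AffineDatum A a b) [Fintype (weyl (fin A) h.fin_diag)]
    {x : Fin n → ℤ} (hx : 0 ≤ x) {w : (Fin n → ℤ) ≃ₗ[ℤ] (Fin n → ℤ)}
    (hw : w ∈ weyl (fin A) h.fin_diag) (hne : w x ≠ x) :
    avg (C := fin A) (hC := h.fin_diag) (w x) 1 < avg (C := fin A) (hC := h.fin_diag) x 1 := by
  obtain ⟨v, hv, h1⟩ := h.exists_avg_max x
  have h2 := h.eq_of_dominant hv hx (h.nonneg_of_avg_max fun u hu => h1 (u * v) (mul_mem hu hv))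
  rw [h2] at h1
  refine lt_of_le_of_ne (h1 w hw) fun heq => hne ?_
  exact h.eq_of_dominant hw hx (h.nonneg_of_avg_max fun u hu => heq ▸ h1 (u * w) (mul_mem hu hw))

/-- If the alternating sum of `ρ` vanishes at `t`, then so do all alternating sums. -/
theorem alternant_eq_zero (h : AffineDatum A a b) [Fintype (weyl (fin A) h.fin_diag)]
    {t : AddChar (Fin n → ℤ) ℂ} (ht : h.alternant t 1 = 0) (x : Fin n → ℤ) :
    h.alternant t x = 0 := by
  obtain ⟨N, hN⟩ : ∃ N : ℕ, avg (C := fin A) (hC := h.fin_diag) x x = N :=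
    Int.eq_ofNat_of_zero_le (avg_self_nonneg _)
  induction N using Nat.strong_induction_on generalizing x with
  | _ N ih =>
  obtain ⟨w, hw, hdom⟩ := h.exists_dominant x
  have hunit : ∀ u : ℤˣ, ((u : ℤ) : ℂ) ≠ 0 := fun u => by
    exact_mod_cast u.ne_zero
  rw [← (mul_eq_zero_iff_left (hunit (LinearEquiv.det w))), ← h.alternant_map t x hw]
  rw [← avg_map w hw] at hN
  set z := w x
  by_cases hz : ∃ i, z i = 0
  · obtain ⟨i, hi⟩ := hz
    have h1 := h.alternant_map t z (simpleRefl_mem i)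
    rw [h.simpleRefl_eq, hi, zero_smul, sub_zero, det_simpleRefl] at h1
    exact self_eq_neg.1 (by simpa using h1)
  push Not at hz
  set y := z - 1
  have hzy : z = y + 1 := by simp [y]
  have hy : 0 ≤ y := fun i => by
    have h1 := hz i
    have h2 := hdom i
    simp only [y, Pi.sub_apply, Pi.one_apply, Pi.zero_apply] at h2 ⊢
    omega
  -- Multiply the vanishing alternating sum of `ρ` by the orbit sum of `y`, where `z = y + ρ`; by
  -- invariance the product is the sum of the alternating sums of `v y + ρ`.
  have hsum : ∑ v : weyl (fin A) h.fin_diag,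
      h.alternant t ((v : (Fin n → ℤ) ≃ₗ[ℤ] (Fin n → ℤ)) y + 1) = 0 := by
    have h1 : (∑ v : weyl (fin A) h.fin_diag, t ((v : (Fin n → ℤ) ≃ₗ[ℤ] (Fin n → ℤ)) y)) *
        h.alternant t 1 = 0 := by rw [ht, mul_zero]
    rw [← h1]
    simp only [alternant, Finset.sum_mul_sum]
    rw [Finset.sum_comm]
    conv_rhs => rw [Finset.sum_comm]
    refine Finset.sum_congr rfl fun u _ => ?_
    refine Fintype.sum_equiv (Equiv.mulLeft u) _ _ fun v => ?_
    rw [Equiv.coe_mulLeft, Subgroup.coe_mul, LinearEquiv.mul_apply, map_add, AddChar.map_add_eq_mul]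
    ring
  -- Moving `y` off itself lowers its product with `ρ` and keeps its norm, so `v y + ρ` is shorter
  -- than `z` and the induction hypothesis applies.
  have hterm : ∀ v : weyl (fin A) h.fin_diag, (v : (Fin n → ℤ) ≃ₗ[ℤ] (Fin n → ℤ)) y ≠ y →
      h.alternant t ((v : (Fin n → ℤ) ≃ₗ[ℤ] (Fin n → ℤ)) y + 1) = 0 := fun v hv => by
    have h1 := h.avg_map_lt hy v.2 hv
    have h2 := avg_map (C := fin A) (hC := h.fin_diag) v v.2 y y
    obtain ⟨N', hN'⟩ := Int.eq_ofNat_of_zero_le (avg_self_nonneg (C := fin A) (hC := h.fin_diag)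
      ((v : (Fin n → ℤ) ≃ₗ[ℤ] (Fin n → ℤ)) y + 1))
    refine ih N' ?_ _ hN'
    rw [hzy] at hN
    simp only [avg_add_left, avg_add_right, avg_comm (1 : Fin n → ℤ) _, h2] at hN hN'
    omega
  classical
  -- What survives is the order of the stabilizer of `y` times the alternating sum of `z`.
  have hcount : ∑ v : weyl (fin A) h.fin_diag,
      h.alternant t ((v : (Fin n → ℤ) ≃ₗ[ℤ] (Fin n → ℤ)) y + 1) =
      (Finset.univ.filter fun v : weyl (fin A) h.fin_diag =>
        (v : (Fin n → ℤ) ≃ₗ[ℤ] (Fin n → ℤ)) y = y).card * h.alternant t z := by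
    rw [← nsmul_eq_mul, ← Finset.sum_const, Finset.sum_filter]
    refine Finset.sum_congr rfl fun v _ => ?_
    split_ifs with hv
    · rw [hv, ← hzy]
    · exact hterm v hv
  rw [hsum] at hcount
  refine (mul_eq_zero.1 hcount.symm).resolve_left (Nat.cast_ne_zero.2 ?_)
  exact (Finset.card_pos.2 ⟨1, by simp⟩).ne'

end AffineDatum

end Denominator

end CartanForm

namespace CartanForm

/-! ### The pairing of two lattices -/

/-- The bilinear pairing `(x, y) ↦ xᵀ G⁻¹ y` of integer vectors. -/
noncomputable def invPair {n : ℕ} (G : Matrix (Fin n) (Fin n) ℤ) (x y : Fin n → ℤ) : ℝ :=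
  (fun i => (x i : ℝ)) ⬝ᵥ ((G.map (Int.cast : ℤ → ℝ))⁻¹ *ᵥ fun i => (y i : ℝ))

section InvPair

variable {n : ℕ} {G : Matrix (Fin n) (Fin n) ℤ}

theorem invPair_add_left (x x' y : Fin n → ℤ) :
    invPair G (x + x') y = invPair G x y + invPair G x' y := by
  simp [invPair, ← add_dotProduct]; rfl

theorem invPair_transpose (x y : Fin n → ℤ) : invPair Gᵀ y x = invPair G x y := by
  rw [invPair, invPair, Matrix.transpose_map, ← Matrix.transpose_nonsing_inv,
    Matrix.dotProduct_mulVec, Matrix.vecMul_transpose, dotProduct_comm]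

theorem invPair_add_right (x y y' : Fin n → ℤ) :
    invPair G x (y + y') = invPair G x y + invPair G x y' := by
  rw [← invPair_transpose, invPair_add_left, invPair_transpose, invPair_transpose]

theorem invPair_smul_left (m : ℤ) (x y : Fin n → ℤ) :
    invPair G (m • x) y = m * invPair G x y := by
  have : (fun i => ((m • x) i : ℝ)) = (m : ℝ) • fun i => (x i : ℝ) := by ext; simp
  rw [invPair, this, smul_dotProduct, invPair, smul_eq_mul]

theorem invPair_smul_right (m : ℤ) (x y : Fin n → ℤ) :
    invPair G x (m • y) = m * invPair G x y := by
  rw [← invPair_transpose, invPair_smul_left, invPair_transpose]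

theorem isUnit_det_cast (hG : G.det ≠ 0) : IsUnit (G.map (Int.cast : ℤ → ℝ)).det := by
  have : (G.map (Int.cast : ℤ → ℝ)).det = (G.det : ℝ) := (Int.cast_det (R := ℝ) G).symm
  rw [this]
  exact (Int.cast_ne_zero.2 hG).isUnit

/-- Vectors proportional to `Gᵀ e_i` pair with `y` through the coordinate `y i`. -/
theorem invPair_of_row (hG : G.det ≠ 0) {x : Fin n → ℤ} {i : Fin n} {p : ℝ}
    (hx : ∀ j, (x j : ℝ) = p * G i j) (y : Fin n → ℤ) : invPair G x y = p * y i := by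
  have h1 : (fun j => (x j : ℝ)) = p • (Pi.single i 1 ᵥ* (G.map (Int.cast : ℤ → ℝ))) := by
    ext j; simp [hx]
  rw [invPair, h1, smul_dotProduct, Matrix.dotProduct_mulVec, Matrix.vecMul_vecMul,
    Matrix.mul_nonsing_inv _ (isUnit_det_cast hG), Matrix.vecMul_one]
  simp

theorem invPair_transpose_mulVec (hG : G.det ≠ 0) (c y : Fin n → ℤ) :
    invPair G (Gᵀ *ᵥ c) y = (c ⬝ᵥ y : ℤ) := by
  have h1 : (fun j => ((Gᵀ *ᵥ c) j : ℝ)) = (fun i => (c i : ℝ)) ᵥ* (G.map (Int.cast : ℤ → ℝ)) := by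
    ext j; simp [Matrix.mulVec, Matrix.vecMul, dotProduct, mul_comm]
  rw [invPair, h1, Matrix.dotProduct_mulVec, Matrix.vecMul_vecMul,
    Matrix.mul_nonsing_inv _ (isUnit_det_cast hG), Matrix.vecMul_one]
  simp [dotProduct]

theorem eq_of_invPair (hG : G.det ≠ 0) {x x' : Fin n → ℤ}
    (h : ∀ y, invPair G x y = invPair G x' y) : x = x' := by
  set R := G.map (Int.cast : ℤ → ℝ) with hR
  have hu : IsUnit R.det := isUnit_det_cast hG
  have key : ∀ (x : Fin n → ℤ) j, ((fun i => (x i : ℝ)) ᵥ* R⁻¹) j = invPair G x (Pi.single j 1) := by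
    intro x j
    have : (fun i => ((Pi.single j 1 : Fin n → ℤ) i : ℝ)) = Pi.single j 1 := by
      ext i; by_cases hij : i = j
      · subst hij; simp
      · simp [hij]
    rw [invPair, this, Matrix.dotProduct_mulVec, dotProduct_single, mul_one]
  have h1 : (fun i => (x i : ℝ)) ᵥ* R⁻¹ = (fun i => (x' i : ℝ)) ᵥ* R⁻¹ := by
    ext j; rw [key, key, h]
  have h2 := congrArg (· ᵥ* R) h1
  simp only [Matrix.vecMul_vecMul, Matrix.nonsing_inv_mul _ hu, Matrix.vecMul_one] at h2
  ext i
  exact_mod_cast congrFun h2 i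

end InvPair

/-- The root-of-unity valued function `r ↦ exp (2πi r / K)`. -/
noncomputable def expDiv (K : ℕ) (r : ℝ) : ℂ :=
  Complex.exp (2 * Real.pi * Complex.I / (K : ℂ) * (r : ℂ))

theorem expDiv_add (K : ℕ) (r s : ℝ) : expDiv K (r + s) = expDiv K r * expDiv K s := by
  rw [expDiv, expDiv, expDiv, ← Complex.exp_add]; push_cast; congr 1; ring

theorem norm_expDiv (K : ℕ) (r : ℝ) : ‖expDiv K r‖ = 1 := by
  have : (2 * Real.pi * Complex.I / (K : ℂ) * (r : ℂ)) =
      ((2 * Real.pi / K * r : ℝ) : ℂ) * Complex.I := by push_cast; ring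
  rw [expDiv, this, Complex.norm_exp_ofReal_mul_I]

theorem expDiv_eq_one_iff {K : ℕ} (hK : 0 < K) {r : ℝ} : expDiv K r = 1 ↔ ∃ m : ℤ, r = m * K := by
  have h1 : (K : ℂ) ≠ 0 := Nat.cast_ne_zero.2 hK.ne'
  rw [expDiv, Complex.exp_eq_one_iff]
  refine exists_congr fun m => ?_
  have h2 : (2 * Real.pi * Complex.I : ℂ) ≠ 0 := Complex.two_pi_I_ne_zero
  constructor
  · intro h
    have h3 : (2 * Real.pi * Complex.I : ℂ) * (r - m * K) = 0 := by
      field_simp at h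
      have h4 : (2 * Real.pi * Complex.I : ℂ) * r = (2 * Real.pi * Complex.I) * (m * K) := by
        linear_combination (2 * Real.pi * Complex.I) * h
      linear_combination h4
    have h4 := (mul_eq_zero.1 h3).resolve_left h2
    exact_mod_cast sub_eq_zero.1 h4
  · rintro rfl
    push_cast
    field_simp

/-! ### The group generated by pairs of simple reflections -/

section PairWeyl

variable {n : ℕ} {C₁ C₂ : Matrix (Fin n) (Fin n) ℤ} (hC₁ : ∀ i, C₁ i i = 2)
  (hC₂ : ∀ i, C₂ i i = 2)

/-- The group generated by the pairs of simple reflections of two Cartan matrices. -/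
def pairWeyl :
    Subgroup (((Fin n → ℤ) ≃ₗ[ℤ] (Fin n → ℤ)) × ((Fin n → ℤ) ≃ₗ[ℤ] (Fin n → ℤ))) :=
  Subgroup.closure (Set.range fun i => (simpleRefl C₁ hC₁ i, simpleRefl C₂ hC₂ i))

variable {hC₁ hC₂}

theorem prod_mem_pairWeyl (l : List (Fin n)) :
    ((l.map (simpleRefl C₁ hC₁)).prod, (l.map (simpleRefl C₂ hC₂)).prod) ∈
      pairWeyl hC₁ hC₂ := by
  induction l with
  | nil => exact one_mem _
  | cons i l ih =>
    rw [List.map_cons, List.map_cons, List.prod_cons, List.prod_cons, ← Prod.mk_mul_mk]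
    exact mul_mem (Subgroup.subset_closure (Set.mem_range_self i)) ih

theorem exists_list_of_mem_pairWeyl
    {g : ((Fin n → ℤ) ≃ₗ[ℤ] (Fin n → ℤ)) × ((Fin n → ℤ) ≃ₗ[ℤ] (Fin n → ℤ))}
    (hg : g ∈ pairWeyl hC₁ hC₂) : ∃ l : List (Fin n),
      g = ((l.map (simpleRefl C₁ hC₁)).prod, (l.map (simpleRefl C₂ hC₂)).prod) := by
  induction hg using Subgroup.closure_induction with
  | mem x hx => obtain ⟨i, rfl⟩ := hx; exact ⟨[i], by simp⟩
  | one => exact ⟨[], rfl⟩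
  | mul x y _ _ hx hy =>
    obtain ⟨l, rfl⟩ := hx
    obtain ⟨l', rfl⟩ := hy
    exact ⟨l ++ l', by simp⟩
  | inv x _ hx =>
    obtain ⟨l, rfl⟩ := hx
    refine ⟨l.reverse, ?_⟩
    rw [Prod.inv_mk, List.prod_inv_reverse, List.prod_inv_reverse, List.map_reverse,
      List.map_reverse, List.map_map, List.map_map]
    rfl

theorem fst_mem_weyl (g : pairWeyl hC₁ hC₂) : g.1.1 ∈ weyl C₁ hC₁ := by
  obtain ⟨l, hl⟩ := exists_list_of_mem_pairWeyl g.2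
  rw [hl]; exact prod_simpleRefl_mem l

theorem snd_mem_weyl (g : pairWeyl hC₁ hC₂) : g.1.2 ∈ weyl C₂ hC₂ := by
  obtain ⟨l, hl⟩ := exists_list_of_mem_pairWeyl g.2
  rw [hl]; exact prod_simpleRefl_mem l

theorem exists_fst_eq {w : (Fin n → ℤ) ≃ₗ[ℤ] (Fin n → ℤ)} (hw : w ∈ weyl C₁ hC₁) :
    ∃ g : pairWeyl hC₁ hC₂, g.1.1 = w := by
  obtain ⟨l, rfl⟩ := exists_list_of_mem_weyl hw
  exact ⟨⟨_, prod_mem_pairWeyl l⟩, rfl⟩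

theorem exists_snd_eq {w : (Fin n → ℤ) ≃ₗ[ℤ] (Fin n → ℤ)} (hw : w ∈ weyl C₂ hC₂) :
    ∃ g : pairWeyl hC₁ hC₂, g.1.2 = w := by
  obtain ⟨l, rfl⟩ := exists_list_of_mem_weyl hw
  exact ⟨⟨_, prod_mem_pairWeyl l⟩, rfl⟩

theorem det_fst_eq_det_snd (g : pairWeyl hC₁ hC₂) :
    LinearEquiv.det g.1.1 = LinearEquiv.det g.1.2 := by
  obtain ⟨l, hl⟩ := exists_list_of_mem_pairWeyl g.2
  rw [hl, det_prod_simpleRefl, det_prod_simpleRefl]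

variable (hC₁ hC₂)

/-- The action of `pairWeyl` on the first lattice. -/
def pairFst : pairWeyl hC₁ hC₂ →* ((Fin n → ℤ) ≃ₗ[ℤ] (Fin n → ℤ)) :=
  (MonoidHom.fst _ _).comp (pairWeyl hC₁ hC₂).subtype

/-- The action of `pairWeyl` on the second lattice. -/
def pairSnd : pairWeyl hC₁ hC₂ →* ((Fin n → ℤ) ≃ₗ[ℤ] (Fin n → ℤ)) :=
  (MonoidHom.snd _ _).comp (pairWeyl hC₁ hC₂).subtype

/-- The sign character of `pairWeyl`. -/
noncomputable def pairSign : pairWeyl hC₁ hC₂ →* ℤˣ := LinearEquiv.det.comp (pairFst hC₁ hC₂)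

variable {hC₁ hC₂}

/-- The two simple roots are the same multiple `p i` of row and column `i` of `G`, so they pair to
`2 * p i` with each other, and the correction terms cancel. -/
theorem invPair_simpleRefl {G : Matrix (Fin n) (Fin n) ℤ} {p : Fin n → ℝ} (hG : G.det ≠ 0)
    (hl : ∀ i j, (C₁ j i : ℝ) = p i * G i j) (hr : ∀ i j, (C₂ j i : ℝ) = p i * G j i)
    (i : Fin n) (x y : Fin n → ℤ) :
    invPair G (simpleRefl C₁ hC₁ i x) (simpleRefl C₂ hC₂ i y) = invPair G x y := by
  have e1 : simpleRefl C₁ hC₁ i x = x + (-x i) • fun j => C₁ j i := by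
    rw [simpleRefl_apply]; ext j; simp [weightRefl, sub_eq_add_neg]
  have e2 : simpleRefl C₂ hC₂ i y = y + (-y i) • fun j => C₂ j i := by
    rw [simpleRefl_apply]; ext j; simp [weightRefl, sub_eq_add_neg]
  have h1 : ∀ y, invPair G (fun j => C₁ j i) y = p i * y i := invPair_of_row hG (hl i)
  have h2 : ∀ x, invPair G x (fun j => C₂ j i) = p i * x i := fun x => by
    rw [← invPair_transpose]
    exact invPair_of_row (by rwa [Matrix.det_transpose]) (hr i) x
  rw [e1, e2]
  simp only [invPair_add_left, invPair_add_right, invPair_smul_left, invPair_smul_right, h1, h2,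
    Pi.add_apply, Pi.smul_apply, smul_eq_mul, hC₁]
  push_cast
  ring

theorem invPair_pairWeyl {G : Matrix (Fin n) (Fin n) ℤ} {p : Fin n → ℝ} (hG : G.det ≠ 0)
    (hl : ∀ i j, (C₁ j i : ℝ) = p i * G i j) (hr : ∀ i j, (C₂ j i : ℝ) = p i * G j i)
    (g : pairWeyl hC₁ hC₂) (x y : Fin n → ℤ) :
    invPair G (pairFst hC₁ hC₂ g x) (pairSnd hC₁ hC₂ g y) = invPair G x y := by
  obtain ⟨l, hl'⟩ := exists_list_of_mem_pairWeyl g.2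
  change invPair G (g.1.1 x) (g.1.2 y) = _
  rw [hl']
  clear hl'
  induction l with
  | nil => rfl
  | cons i l ih =>
    simp only [List.map_cons, List.prod_cons, LinearEquiv.mul_apply] at ih ⊢
    rw [invPair_simpleRefl hG hl hr, ih]

end PairWeyl

/-! ### The duality between two affine data -/

section Paired

variable {n : ℕ} {A₁ A₂ : Matrix (Fin (n + 1)) (Fin (n + 1)) ℤ} {a₁ b₁ a₂ b₂ : Fin (n + 1) → ℤ}

open AffineDatum

/-- Two affine data are paired by `G` if both lattices of translations are spanned by the rows,
respectively columns, of `G`, and these are proportional to the simple roots. -/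
structure Paired (h₁ : AffineDatum A₁ a₁ b₁) (h₂ : AffineDatum A₂ a₂ b₂)
    (G : Matrix (Fin n) (Fin n) ℤ) (p : Fin n → ℝ) : Prop where
  det_ne_zero : G.det ≠ 0
  left : ∀ t, t ∈ h₁.translations ↔ ∃ c, t = Gᵀ *ᵥ c
  right : ∀ t, t ∈ h₂.translations ↔ ∃ c, t = G *ᵥ c
  col_left : ∀ i j, (fin A₁ j i : ℝ) = p i * G i j
  col_right : ∀ i j, (fin A₂ j i : ℝ) = p i * G j i

namespace AffineDatum

/-- The lattice of translations, scaled by `K`. -/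
def scaledTranslations (h : AffineDatum A₁ a₁ b₁) (K : ℕ) : AddSubgroup (Fin n → ℤ) :=
  h.translations.map (nsmulAddMonoidHom K)

theorem mem_scaledTranslations {h : AffineDatum A₁ a₁ b₁} {K : ℕ} {x : Fin n → ℤ} :
    x ∈ h.scaledTranslations K ↔ ∃ t ∈ h.translations, (K : ℤ) • t = x := by
  simp [scaledTranslations, AddSubgroup.mem_map]

end AffineDatum

namespace Paired

variable {h₁ : AffineDatum A₁ a₁ b₁} {h₂ : AffineDatum A₂ a₂ b₂}
  {G : Matrix (Fin n) (Fin n) ℤ} {p : Fin n → ℝ}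

theorem symm (P : Paired h₁ h₂ G p) : Paired h₂ h₁ Gᵀ p where
  det_ne_zero := by rw [Matrix.det_transpose]; exact P.det_ne_zero
  left := P.right
  right := P.left
  col_left := P.col_right
  col_right := P.col_left

/-- The adjugate solves `Gᵀ c = det G • x` over the integers, so the lattice has full rank. -/
theorem det_smul_mem (P : Paired h₁ h₂ G p) (x : Fin n → ℤ) : G.det • x ∈ h₁.translations := by
  rw [P.left]
  refine ⟨Gᵀ.adjugate *ᵥ x, ?_⟩
  rw [Matrix.mulVec_mulVec, Matrix.mul_adjugate, Matrix.det_transpose, Matrix.smul_mulVec,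
    Matrix.one_mulVec]

theorem finite_weyl_left (P : Paired h₁ h₂ G p) : Finite (weyl (fin A₁) h₁.fin_diag) :=
  h₁.finite_weyl P.det_ne_zero P.det_smul_mem

theorem finite_quotient_left (P : Paired h₁ h₂ G p) {K : ℕ} (hK : 0 < K) :
    Finite ((Fin n → ℤ) ⧸ h₁.scaledTranslations K) := by
  refine finite_quotient (m := K * G.det) (mul_ne_zero (by exact_mod_cast hK.ne') P.det_ne_zero) _
    fun x => mem_scaledTranslations.2 ⟨_, P.det_smul_mem x, ?_⟩
  rw [mul_smul]

/-- Since `(Gᵀ c)ᵀ G⁻¹ y = c ⬝ᵥ y`, the row lattice of `G` is the dual of the integer vectors under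
the pairing; conversely the values on the standard basis, divided by `K`, recover `c`. -/
theorem mem_scaledTranslations_iff (P : Paired h₁ h₂ G p) {K : ℕ} (hK : 0 < K) (x : Fin n → ℤ) :
    x ∈ h₁.scaledTranslations K ↔ ∀ y, expDiv K (invPair G x y) = 1 := by
  simp only [expDiv_eq_one_iff hK]
  rw [mem_scaledTranslations]
  constructor
  · rintro ⟨t, ht, rfl⟩ y
    obtain ⟨c, rfl⟩ := (P.left t).1 ht
    refine ⟨c ⬝ᵥ y, ?_⟩
    rw [invPair_smul_left, invPair_transpose_mulVec P.det_ne_zero]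
    push_cast; ring
  · intro h
    choose m hm using h
    refine ⟨Gᵀ *ᵥ fun j => m (Pi.single j 1), (P.left _).2 ⟨_, rfl⟩, ?_⟩
    refine eq_of_invPair P.det_ne_zero fun y => ?_
    have hy : ∀ y : Fin n → ℤ, invPair G x y = ∑ j, y j * invPair G x (Pi.single j 1) := fun y => by
      let f : (Fin n → ℤ) →+ ℝ :=
        { toFun := invPair G x
          map_zero' := by simpa using invPair_smul_right (G := G) 0 x 0
          map_add' := invPair_add_right x }
      have h2 : y = ∑ j, y j • (Pi.single j 1 : Fin n → ℤ) := by
        simpa using (pi_eq_sum_univ' y)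
      have h3 : f y = ∑ j, f (y j • (Pi.single j 1 : Fin n → ℤ)) := by
        conv_lhs => rw [h2]
        exact map_sum f _ _
      exact h3.trans (Finset.sum_congr rfl fun j _ => invPair_smul_right _ _ _)
    rw [invPair_smul_left, invPair_transpose_mulVec P.det_ne_zero, hy y]
    simp only [hm, dotProduct]
    push_cast
    rw [Finset.mul_sum]
    exact Finset.sum_congr rfl fun j _ => by ring

/-- Nondegeneracy of the invariant pairing makes each component of a pair determine the other, so
`pairWeyl` is the same group as either Weyl group. -/
theorem eq_one_of_fst (P : Paired h₁ h₂ G p) (g : pairWeyl h₁.fin_diag h₂.fin_diag)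
    (hg : g.1.1 = 1) : g = 1 := by
  refine Subtype.ext (Prod.ext hg (LinearEquiv.ext fun y => ?_))
  refine eq_of_invPair P.symm.det_ne_zero fun x => ?_
  have h := invPair_pairWeyl P.det_ne_zero P.col_left P.col_right g x y
  change invPair G (g.1.1 x) (g.1.2 y) = _ at h
  rw [hg] at h
  rw [invPair_transpose, invPair_transpose]
  exact h

theorem eq_one_of_snd (P : Paired h₁ h₂ G p) (g : pairWeyl h₁.fin_diag h₂.fin_diag)
    (hg : g.1.2 = 1) : g = 1 := by
  refine Subtype.ext (Prod.ext (LinearEquiv.ext fun x => ?_) hg)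
  refine eq_of_invPair P.det_ne_zero fun y => ?_
  have h := invPair_pairWeyl P.det_ne_zero P.col_left P.col_right g x y
  change invPair G (g.1.1 x) (g.1.2 y) = _ at h
  rw [hg] at h
  exact h

theorem finite_pairWeyl (P : Paired h₁ h₂ G p) : Finite (pairWeyl h₁.fin_diag h₂.fin_diag) := by
  have := P.finite_weyl_left
  refine Finite.of_injective (fun g : pairWeyl h₁.fin_diag h₂.fin_diag =>
    (⟨g.1.1, fst_mem_weyl g⟩ : weyl (fin A₁) h₁.fin_diag)) fun g g' h => ?_
  have h1 : g.1.1 = g'.1.1 := congrArg Subtype.val h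
  have h2 : (g * g'⁻¹).1.1 = 1 := by simp [h1]
  exact mul_inv_eq_one.1 (P.eq_one_of_fst _ h2)

theorem free (h : AffineDatum A₁ a₁ b₁) {K : ℕ} {w : (Fin n → ℤ) ≃ₗ[ℤ] (Fin n → ℤ)}
    (hw : w ∈ weyl (fin A₁) h.fin_diag) {x x' : Fin n → ℤ} (hx : x ∈ alcove b₁ K)
    (hx' : x' ∈ alcove b₁ K) (hm : w x - x' ∈ h.scaledTranslations K) : w = 1 ∧ x = x' := by
  obtain ⟨t, ht, h1⟩ := mem_scaledTranslations.1 hm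
  have h2 : w x + (K : ℤ) • -t = x' := by rw [smul_neg, h1]; abel
  obtain ⟨h3, h4⟩ := h.eq_of_mem_alcove hw (neg_mem ht) hx (h2.symm ▸ hx')
  exact ⟨h3, h4.symm.trans h2⟩

theorem dichotomy (h : AffineDatum A₁ a₁ b₁) [Finite (weyl (fin A₁) h.fin_diag)] {K : ℕ}
    (hK : 0 < K) (x : Fin n → ℤ) :
    (∃ w ∈ weyl (fin A₁) h.fin_diag, ∃ c ∈ alcove b₁ K, w x - c ∈ h.scaledTranslations K) ∨
    ∃ w ∈ weyl (fin A₁) h.fin_diag, LinearEquiv.det w = -1 ∧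
      w x - x ∈ h.scaledTranslations K := by
  rcases h.exists_alcove_or_fixed (K := K) (by exact_mod_cast hK) x with
    ⟨w, hw, t, ht, h1⟩ | ⟨w, hw, hd, t, ht, h1⟩
  · refine Or.inl ⟨w, hw, _, h1, mem_scaledTranslations.2 ⟨-t, neg_mem ht, ?_⟩⟩
    rw [smul_neg]; abel
  · refine Or.inr ⟨w, hw, hd, mem_scaledTranslations.2 ⟨-t, neg_mem ht, ?_⟩⟩
    nth_rewrite 2 [← h1]
    rw [smul_neg]; abel

theorem duality (P : Paired h₁ h₂ G p) {K : ℕ} (hK : 0 < K) :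
    Duality (pairFst h₁.fin_diag h₂.fin_diag) (pairSnd h₁.fin_diag h₂.fin_diag)
      (pairSign h₁.fin_diag h₂.fin_diag) (fun x y => expDiv K (invPair G x y))
      (h₁.scaledTranslations K) (h₂.scaledTranslations K) (alcove b₁ K) (alcove b₂ K) where
  add_left := fun x x' y => by rw [invPair_add_left, expDiv_add]
  add_right := fun x y y' => by rw [invPair_add_right, expDiv_add]
  norm_eq := fun x y => norm_expDiv _ _
  inv := fun g x y => by rw [invPair_pairWeyl P.det_ne_zero P.col_left P.col_right]
  mem_left := P.mem_scaledTranslations_iff hK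
  mem_right := fun y => by
    rw [P.symm.mem_scaledTranslations_iff hK]
    simp only [invPair_transpose]
  finite_left := P.finite_quotient_left hK
  finite_right := P.symm.finite_quotient_left hK
  free_left := fun g x hx x' hx' hm => by
    obtain ⟨h3, h4⟩ := free h₁ (fst_mem_weyl g) hx hx' hm
    exact ⟨P.eq_one_of_fst g h3, h4⟩
  free_right := fun g x hx x' hx' hm => by
    obtain ⟨h3, h4⟩ := free h₂ (snd_mem_weyl g) hx hx' hm
    exact ⟨P.eq_one_of_snd g h3, h4⟩
  dich_left := fun x => by
    have := P.finite_weyl_left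
    rcases dichotomy h₁ hK x with ⟨w, hw, c, hc, h⟩ | ⟨w, hw, hd, h⟩
    · obtain ⟨g, rfl⟩ := exists_fst_eq (hC₂ := h₂.fin_diag) hw
      exact Or.inl ⟨g, c, hc, h⟩
    · obtain ⟨g, rfl⟩ := exists_fst_eq (hC₂ := h₂.fin_diag) hw
      exact Or.inr ⟨g, hd, h⟩
  dich_right := fun x => by
    have := P.symm.finite_weyl_left
    rcases dichotomy h₂ hK x with ⟨w, hw, c, hc, h⟩ | ⟨w, hw, hd, h⟩
    · obtain ⟨g, rfl⟩ := exists_snd_eq (hC₁ := h₁.fin_diag) hw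
      exact Or.inl ⟨g, c, hc, h⟩
    · obtain ⟨g, rfl⟩ := exists_snd_eq (hC₁ := h₁.fin_diag) hw
      exact Or.inr ⟨g, (det_fst_eq_det_snd g).trans hd, h⟩

/-- The character of the first lattice attached to a point of the second lattice. -/
noncomputable def character (G : Matrix (Fin n) (Fin n) ℤ) (K : ℕ) (y : Fin n → ℤ) :
    AddChar (Fin n → ℤ) ℂ where
  toFun x := expDiv K (invPair G x y)
  map_zero_eq_one' := by
    have : invPair G 0 y = 0 := by simpa using invPair_smul_left (G := G) 0 0 y
    simp [this, expDiv]
  map_add_eq_mul' x x' := by rw [invPair_add_left, expDiv_add]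

theorem alternant_character (P : Paired h₁ h₂ G p) (K : ℕ)
    [Fintype (weyl (fin A₁) h₁.fin_diag)] [Fintype (pairWeyl h₁.fin_diag h₂.fin_diag)]
    (x y : Fin n → ℤ) :
    h₁.alternant (character G K y) x = Duality.altSum (pairFst h₁.fin_diag h₂.fin_diag)
      (pairSign h₁.fin_diag h₂.fin_diag) (fun x y => expDiv K (invPair G x y)) x y := by
  symm
  refine Fintype.sum_bijective (fun g => ⟨g.1.1, fst_mem_weyl g⟩) ⟨fun g g' h => ?_, fun w => ?_⟩ _ _
    fun g => rfl
  · have h1 : g.1.1 = g'.1.1 := congrArg Subtype.val h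
    have h2 : (g * g'⁻¹).1.1 = 1 := by simp [h1]
    exact mul_inv_eq_one.1 (P.eq_one_of_fst _ h2)
  · obtain ⟨g, hg⟩ := exists_fst_eq (hC₂ := h₂.fin_diag) w.2
    exact ⟨g, Subtype.ext hg⟩

theorem finite_alcove (P : Paired h₁ h₂ G p) {K : ℕ} (hK : 0 < K) : (alcove b₂ K).Finite := by
  have := P.finite_pairWeyl
  have := Fintype.ofFinite (pairWeyl h₁.fin_diag h₂.fin_diag)
  exact Set.finite_coe_iff.1 (P.duality hK).finite_right_domain

theorem sum_alternant_mul_conj (P : Paired h₁ h₂ G p) {K : ℕ} (hK : 0 < K)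
    [Fintype (weyl (fin A₁) h₁.fin_diag)] [Fintype (alcove b₂ K)] {x x' : Fin n → ℤ}
    (hx : x ∈ alcove b₁ K) (hx' : x' ∈ alcove b₁ K) [Decidable (x = x')] :
    ∑ y : alcove b₂ K, h₁.alternant (character G K y) x * conj (h₁.alternant (character G K y) x') =
      if x = x' then (Nat.card ((Fin n → ℤ) ⧸ h₁.scaledTranslations K) : ℂ) else 0 := by
  have := P.finite_pairWeyl
  have := Fintype.ofFinite (pairWeyl h₁.fin_diag h₂.fin_diag)
  simp only [P.alternant_character]
  rw [(P.duality hK).card_eq]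
  exact (P.duality hK).sum_altSum_mul_conj hx hx'

theorem sum_alternant_mul_conj_dual (P : Paired h₁ h₂ G p) {K : ℕ} (hK : 0 < K)
    [Fintype (weyl (fin A₁) h₁.fin_diag)] [Fintype (alcove b₁ K)] {y y' : Fin n → ℤ}
    (hy : y ∈ alcove b₂ K) (hy' : y' ∈ alcove b₂ K) [Decidable (y = y')] :
    ∑ x : alcove b₁ K, h₁.alternant (character G K y) x * conj (h₁.alternant (character G K y') x) =
      if y = y' then (Nat.card ((Fin n → ℤ) ⧸ h₁.scaledTranslations K) : ℂ) else 0 := by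
  have := P.finite_pairWeyl
  have := Fintype.ofFinite (pairWeyl h₁.fin_diag h₂.fin_diag)
  simp only [P.alternant_character, ← (P.duality hK).altSum_swap]
  exact (P.duality hK).swap.sum_altSum_mul_conj hy hy'

theorem card_ne_zero (P : Paired h₁ h₂ G p) {K : ℕ} (hK : 0 < K) :
    (Nat.card ((Fin n → ℤ) ⧸ h₁.scaledTranslations K) : ℂ) ≠ 0 := by
  have := P.finite_quotient_left hK
  exact Nat.cast_ne_zero.2 Nat.card_pos.ne'

/-- A zero of the denominator would annihilate a whole column, whose squared norm is the nonzero
order of the quotient. -/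
theorem alternant_one_ne_zero (P : Paired h₁ h₂ G p) {K : ℕ} (hK : 0 < K)
    [Fintype (weyl (fin A₁) h₁.fin_diag)] {y : Fin n → ℤ} (hy : y ∈ alcove b₂ K) :
    h₁.alternant (character G K y) 1 ≠ 0 := fun h0 => by
  have := (P.symm.finite_alcove hK).fintype
  have h1 := P.sum_alternant_mul_conj_dual hK hy hy
  rw [if_pos rfl] at h1
  refine P.card_ne_zero hK (h1.symm.trans (Finset.sum_eq_zero fun x _ => ?_))
  rw [h₁.alternant_eq_zero h0, zero_mul]

/-- Two points with equal characters differ by an element of the scaled lattice, and freeness with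
`h = 1` identifies them. -/
theorem character_injOn (P : Paired h₁ h₂ G p) {K : ℕ} (hK : 0 < K) :
    Set.InjOn (character G K) (alcove b₂ K) := fun y hy y' hy' h => by
  refine ((P.duality hK).free_right 1 y hy y' hy' ?_).2
  rw [map_one, LinearEquiv.coe_one, id, (P.duality hK).mem_right]
  intro x
  have h1 : expDiv K (invPair G x y) = expDiv K (invPair G x y') := DFunLike.congr_fun h x
  have h2 : expDiv K (invPair G x (y - y' + y')) = expDiv K (invPair G x y') := by
    rw [sub_add_cancel, h1]
  rw [invPair_add_right, expDiv_add] at h2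
  have h3 : expDiv K (invPair G x y') ≠ 0 := Complex.exp_ne_zero _
  exact mul_right_cancel₀ h3 (h2.trans (one_mul _).symm)

end Paired

end Paired

end CartanForm

namespace CartanForm

open AffineType

/-! ### The infinite families -/

/-- Working with natural number indices turns the axioms into arithmetic. In `hnull` the set `S`
contains all neighbours of `i`, so that the null vector equation is a sum of a few terms even for
symbolic `n`. -/
theorem firstKind_ofBonds {n : ℕ} {β : ℕ → ℕ → ℕ} {m m' : ℕ → ℕ}
    (hm : ∀ i ≤ n, 0 < m i) (hm' : ∀ i ≤ n, 0 < m' i) (h0 : m' 0 = 1)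
    (hsymm : ∀ i ≤ n, ∀ j ≤ n, i ≠ j → m' i * m j * β i j = m' j * m i * β j i)
    (hnull : ∀ i ≤ n, ∃ S : Finset ℕ, (∀ j ∈ S, j ≤ n ∧ j ≠ i) ∧
      (∀ j ≤ n, j ∉ S → j ≠ i → β i j = 0) ∧ ∑ j ∈ S, β i j * m j = 2 * m i)
    (hreach : ∃ v, 1 ≤ v ∧ v ≤ n ∧ m' v = m 0 * m v ∧ ∀ T : ℕ → Prop, T v →
      (∀ j k, 1 ≤ j → j ≤ n → 1 ≤ k → k ≤ n → j ≠ k → β j k = 1 → T j → T k) →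
      ∀ j, 1 ≤ j → j ≤ n → T j)
    (hdvd : ∀ i ≤ n, 1 ≤ i → m 0 ∣ m' i) (hdvd' : ∀ i ≤ n, 1 ≤ i → m' i ∣ m 0 * m i) :
    FirstKind (ofBonds n β) (fun i => (m i : ℤ)) (fun i => (m' i : ℤ)) where
  diag := fun i => if_pos rfl
  off := fun i j hij => by simp [ofBonds, hij]
  a_pos := fun i => by exact_mod_cast hm i (by omega)
  b_pos := fun i => by exact_mod_cast hm' i (by omega)
  symm := fun i j => by
    by_cases hij : i = j
    · subst hij; rfl
    · have := hsymm i (by omega) j (by omega) (fun h => hij (Fin.ext h))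
      simp only [ofBonds, hij, Ne.symm hij, if_false]
      have e : ((m' i * m j * β i j : ℕ) : ℤ) = (m' j * m i * β j i : ℕ) := by rw [this]
      push_cast at e
      linear_combination -e
  null := by
    funext i
    obtain ⟨S, hS, hS0, hsum⟩ := hnull i (by omega)
    have h1 : (ofBonds n β *ᵥ fun j => (m j : ℤ)) i =
        ∑ j ∈ Finset.range (n + 1), (if (i : ℕ) = j then 2 else -(β i j : ℤ)) * m j := by
      rw [← Fin.sum_univ_eq_sum_range
        (fun j => (if (i : ℕ) = j then 2 else -(β i j : ℤ)) * (m j : ℤ))]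
      simp only [Matrix.mulVec, dotProduct, ofBonds, Fin.ext_iff]
    have hi : (i : ℕ) ∉ S := fun h => (hS i h).2 rfl
    have h2 : ∑ j ∈ insert (i : ℕ) S, (if (i : ℕ) = j then 2 else -(β i j : ℤ)) * (m j : ℤ) =
        ∑ j ∈ Finset.range (n + 1), (if (i : ℕ) = j then 2 else -(β i j : ℤ)) * m j := by
      refine Finset.sum_subset (fun j hj => ?_) fun j hj hjS => ?_
      · rcases Finset.mem_insert.1 hj with rfl | hj
        · exact Finset.mem_range.2 i.isLt
        · have := (hS j hj).1
          simp; omega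
      · rw [Finset.mem_insert, not_or] at hjS
        have := hS0 j (by simp at hj; omega) hjS.2 hjS.1
        simp [this, Ne.symm hjS.1]
    rw [h1, ← h2, Finset.sum_insert hi, if_pos rfl]
    have h3 : ∑ j ∈ S, (if (i : ℕ) = j then 2 else -(β i j : ℤ)) * (m j : ℤ) =
        -((∑ j ∈ S, β i j * m j : ℕ) : ℤ) := by
      push_cast
      rw [← Finset.sum_neg_distrib]
      refine Finset.sum_congr rfl fun j hj => ?_
      rw [if_neg (hS j hj).2.symm, neg_mul]
    rw [h3, hsum]
    push_cast
    simp
  b_zero := by simp [h0]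
  reach := by
    obtain ⟨v, h1, h2, h3, h4⟩ := hreach
    refine ⟨⟨v - 1, by omega⟩, ?_, fun S hv hS j => ?_⟩
    · have e : v - 1 + 1 = v := by omega
      simp only [Fin.val_succ, e, Fin.val_zero]
      exact_mod_cast h3
    · obtain ⟨h5, h6⟩ := h4 (fun v => ∃ h : v - 1 < n, S ⟨v - 1, h⟩) ⟨by omega, hv⟩
        (fun j k hj hjn hk hkn hjk hb ⟨h, hs⟩ => ⟨by omega, hS ⟨j - 1, h⟩ ⟨k - 1, by omega⟩ hs (by
          have e1 : j - 1 + 1 = j := by omega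
          have e2 : k - 1 + 1 = k := by omega
          simp [ofBonds, Fin.ext_iff, e1, e2, hjk, hb])⟩) (j + 1) (by omega) (by omega)
      exact h6
  dvd := fun i => by exact_mod_cast hdvd _ (by simp) (by simp)
  dvd' := fun i => by exact_mod_cast hdvd' _ (by simp) (by simp)

theorem forall_of_step_up {n : ℕ} {T : ℕ → Prop} (h1 : T 1)
    (h : ∀ j, 1 ≤ j → j + 1 ≤ n → T j → T (j + 1)) (j : ℕ) (hj : 1 ≤ j) (hjn : j ≤ n) : T j := by
  induction j, hj using Nat.le_induction with
  | base => exact h1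
  | succ j hj ih => exact h j hj hjn (ih (by omega))

theorem forall_of_step_down {n : ℕ} {T : ℕ → Prop} (hn : T n)
    (h : ∀ j, 1 ≤ j → j + 1 ≤ n → T (j + 1) → T j) (j : ℕ) (hj : 1 ≤ j) (hjn : j ≤ n) : T j := by
  induction hd : n - j generalizing j with
  | zero => rwa [show j = n by omega]
  | succ d ih => exact h j hj (by omega) (ih (j + 1) (by omega) (by omega) (by omega))

/-- The statement that the matrix and labels of `X` are of the first kind. -/
abbrev IsFirstKind (X : AffineType) : Prop :=
  FirstKind X.cartan (fun i => (X.marks i : ℤ)) (fun i => (X.comarks i : ℤ))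

theorem firstKind_A (n : ℕ) (hn : 1 ≤ n) : IsFirstKind (A n hn) := by
  refine firstKind_ofBonds (n := n) (β := fun i j => if n = 1 then 2 else if Chain i j ∨ (i = 0 ∧ j = n) ∨ (i = n ∧ j = 0) then 1 else 0) (m := fun _ => 1) (m' := fun _ => 1) (by simp) (by simp) rfl
    ?_ ?_ ⟨1, le_rfl, hn, rfl, fun T h1 hT => forall_of_step_up h1 fun j hj hjn =>
      hT j (j + 1) hj (by omega) (by omega) hjn (by omega) ?_⟩ (by simp) (by simp)
  · grind [Chain]
  · intro i hi
    by_cases h1 : n = 1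
    · exact ⟨{1 - i}, by grind, by grind, by simp [h1]⟩
    by_cases h2 : i = 0
    · exact ⟨{1, n}, by grind, by grind [Chain], by
        rw [Finset.sum_pair (by omega)]; grind [Chain]⟩
    by_cases h3 : i = n
    · exact ⟨{0, n - 1}, by grind, by grind [Chain], by
        rw [Finset.sum_pair (by omega)]; grind [Chain]⟩
    · exact ⟨{i - 1, i + 1}, by grind, by grind [Chain], by
        rw [Finset.sum_pair (by omega)]; grind [Chain]⟩
  · grind [Chain]

theorem firstKind_B (n : ℕ) (hn : 3 ≤ n) : IsFirstKind (B n hn) := by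
  refine firstKind_ofBonds (n := n) (β := fun i j => if i = n ∧ j + 1 = n then 2 else if Fork i j then 1 else 0) (m := fun i => if i ≤ 1 then 1 else 2)
    (m' := fun i => if i ≤ 1 ∨ i = n then 1 else 2) (by grind) (by grind) rfl
    ?_ ?_ ⟨1, le_rfl, by omega, rfl, fun T h1 hT => forall_of_step_up h1 fun j hj hjn =>
      hT j (j + 1) hj (by omega) (by omega) hjn (by omega) ?_⟩ (by simp) (fun i _ _ => by split_ifs <;> omega)
  · grind (splits := 20) [Fork, Chain]
  · intro i hi
    by_cases h1 : i = 0
    · exact ⟨{2}, by grind, by grind [Fork, Chain], by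
        rw [Finset.sum_singleton]; grind [Fork, Chain]⟩
    by_cases h2 : i = 1
    · exact ⟨{2}, by grind, by grind [Fork, Chain], by
        rw [Finset.sum_singleton]; grind [Fork, Chain]⟩
    by_cases h3 : i = n
    · exact ⟨{n - 1}, by grind, by grind [Fork, Chain], by
        rw [Finset.sum_singleton]; grind [Fork, Chain]⟩
    by_cases h4 : i = 2
    · exact ⟨{0, 1, 3}, by grind, by grind [Fork, Chain], by
        rw [Finset.sum_insert (by grind), Finset.sum_pair (by omega)]; grind [Fork, Chain]⟩
    · exact ⟨{i - 1, i + 1}, by grind, by grind [Fork, Chain], by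
        rw [Finset.sum_pair (by omega)]; grind (splits := 20) [Fork, Chain]⟩
  · grind [Fork, Chain]

/-- The walk descends from the long vertex `n`: the entry `-2` is in row `n - 1`, column `n`, so
leaving `n` uses an entry `-1`. -/
theorem firstKind_C (n : ℕ) (hn : 2 ≤ n) : IsFirstKind (C n hn) := by
  refine firstKind_ofBonds (n := n) (β := fun i j => if (i = 1 ∧ j = 0) ∨ (i + 1 = n ∧ j = n) then 2 else if Chain i j then 1 else 0) (m := fun i => if i = 0 ∨ i = n then 1 else 2)
    (m' := fun i => 1) (by grind) (by grind) rfl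
    ?_ ?_ ⟨n, by omega, le_rfl, by grind, fun T h1 hT => forall_of_step_down h1 fun j hj hjn =>
      hT (j + 1) j (by omega) (by omega) (by omega) (by omega) (by omega) ?_⟩ (by simp) (fun i _ _ => by split_ifs <;> omega)
  · grind (splits := 20) [Chain]
  · intro i hi
    by_cases h1 : i = 0
    · exact ⟨{1}, by grind, by grind [Chain], by
        rw [Finset.sum_singleton]; grind [Chain]⟩
    by_cases h2 : i = n
    · exact ⟨{n - 1}, by grind, by grind [Chain], by
        rw [Finset.sum_singleton]; grind [Chain]⟩
    · exact ⟨{i - 1, i + 1}, by grind, by grind [Chain], by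
        rw [Finset.sum_pair (by omega)]; grind (splits := 20) [Chain]⟩
  · grind [Chain]

/-- The walk from `1` reaches `n - 1` along the chain and then branches to `n` from `n - 2`. -/
theorem firstKind_D (n : ℕ) (hn : 4 ≤ n) : IsFirstKind (D n hn) := by
  refine firstKind_ofBonds (n := n) (β := fun i j => if (Fork i j ∧ i ≠ n ∧ j ≠ n) ∨ (i + 2 = n ∧ j = n) ∨ (i = n ∧ j + 2 = n) then 1 else 0) (m := fun i => if i ≤ 1 ∨ n ≤ i + 1 then 1 else 2)
    (m' := fun i => if i ≤ 1 ∨ n ≤ i + 1 then 1 else 2) (by grind) (by grind) (by grind)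
    ?_ ?_ ⟨1, by omega, by omega, by grind, fun T h1 hT => ?_⟩ (fun i _ _ => by split_ifs <;> omega) (fun i _ _ => by split_ifs <;> omega)
  · grind (splits := 20) [Fork, Chain]
  · intro i hi
    by_cases h1 : i = 0
    · exact ⟨{2}, by grind, by grind [Fork, Chain], by
        rw [Finset.sum_singleton]; grind [Fork, Chain]⟩
    by_cases h2 : i = 1
    · exact ⟨{2}, by grind, by grind [Fork, Chain], by
        rw [Finset.sum_singleton]; grind [Fork, Chain]⟩
    by_cases h3 : i = n
    · exact ⟨{n - 2}, by grind, by grind [Fork, Chain], by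
        rw [Finset.sum_singleton]; grind [Fork, Chain]⟩
    by_cases h4 : i = n - 1
    · exact ⟨{n - 2}, by grind, by grind [Fork, Chain], by
        rw [Finset.sum_singleton]; grind [Fork, Chain]⟩
    by_cases h5 : i = 2
    · by_cases h6 : n = 4
      · subst h6 h5
        exact ⟨{0, 1, 3, 4}, by decide, by grind [Fork, Chain], by decide⟩
      · exact ⟨{0, 1, 3}, by grind, by grind [Fork, Chain], by
          rw [Finset.sum_insert (by grind), Finset.sum_pair (by omega)]; grind [Fork, Chain]⟩
    by_cases h6 : i = n - 2
    · exact ⟨{n - 3, n - 1, n}, by grind, by grind [Fork, Chain], by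
        rw [Finset.sum_insert (by grind), Finset.sum_pair (by omega)]
        grind (splits := 20) [Fork, Chain]⟩
    · exact ⟨{i - 1, i + 1}, by grind, by grind [Fork, Chain], by
        rw [Finset.sum_pair (by omega)]; grind (splits := 20) [Fork, Chain]⟩
  · have h2 : ∀ j, 1 ≤ j → j ≤ n - 1 → T j := forall_of_step_up h1 fun j hj hjn =>
      hT j (j + 1) hj (by omega) (by omega) (by omega) (by omega) (by grind [Fork, Chain])
    intro j hj hjn
    by_cases hjn' : j = n
    · exact hT (n - 2) j (by omega) (by omega) hj hjn (by omega) (by grind [Fork, Chain])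
        (h2 _ (by omega) (by omega))
    · exact h2 j hj (by omega)

theorem firstKind_twAeven (n : ℕ) (hn : 1 ≤ n) : IsFirstKind (twAeven n hn) := by
  refine firstKind_ofBonds (n := n) (β := fun i j => if n = 1 then (if i = 0 then 4 else 1)
      else if (i = 0 ∧ j = 1) ∨ (i + 1 = n ∧ j = n) then 2 else if Chain i j then 1 else 0) (m := fun i => if i = n then 1 else 2)
    (m' := fun i => if i = 0 then 1 else 2) (by grind) (by grind) rfl
    ?_ ?_ ⟨n, by omega, le_rfl, by grind, fun T h1 hT => forall_of_step_down h1 fun j hj hjn =>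
      hT (j + 1) j (by omega) (by omega) (by omega) (by omega) (by omega) ?_⟩ (fun i _ _ => by split_ifs <;> omega) (fun i _ _ => by split_ifs <;> omega)
  · grind (splits := 20) [Chain]
  · intro i hi
    by_cases h0 : n = 1
    · subst h0
      interval_cases i
      · exact ⟨{1}, by simp, by grind, by simp⟩
      · exact ⟨{0}, by simp, by grind, by simp⟩
    by_cases h1 : i = 0
    · exact ⟨{1}, by grind, by grind [Chain], by
        rw [Finset.sum_singleton]; grind [Chain]⟩
    by_cases h2 : i = n
    · exact ⟨{n - 1}, by grind, by grind [Chain], by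
        rw [Finset.sum_singleton]; grind [Chain]⟩
    · exact ⟨{i - 1, i + 1}, by grind, by grind [Chain], by
        rw [Finset.sum_pair (by omega)]; grind (splits := 20) [Chain]⟩
  · grind [Chain]

/-! ### The exceptional types -/

/-- Iterating the parent map leads to the base vertex `i`; reading this path backwards proves `S`.
With `n` iterations required of every vertex, the condition is decidable. -/
theorem reach_of_parent {n : ℕ} {A : Matrix (Fin (n + 1)) (Fin (n + 1)) ℤ} (π : Fin n → Fin n)
    (i : Fin n) (hπ : ∀ j, π^[n] j = i) (hA : ∀ j, j = i ∨ A (π j).succ j.succ = -1)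
    (S : Fin n → Prop) (hi : S i) (hS : ∀ j k, S j → A j.succ k.succ = -1 → S k) (j : Fin n) :
    S j := by
  have key : ∀ k j, π^[k] j = i → S j := fun k => by
    induction k with
    | zero => rintro j rfl; exact hi
    | succ k ih =>
      intro j hj
      rcases hA j with rfl | h
      · exact hi
      · exact hS _ _ (ih (π j) hj) h
  exact key n j (hπ j)

/-- A decidable criterion for a matrix with labels to be of the first kind; `π` maps each vertex to
its predecessor on a path from the vertex `i`. -/
def ParentCheck {n : ℕ} (A : Fin (n + 1) → Fin (n + 1) → ℤ) (a b : Fin (n + 1) → ℤ)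
    (π : Fin n → Fin n) (i : Fin n) : Prop :=
  ((∀ i, A i i = 2) ∧ (∀ i j, i ≠ j → A i j ≤ 0) ∧ (∀ i, 0 < a i) ∧ (∀ i, 0 < b i)) ∧
  (∀ i j, b i * a j * A i j = b j * a i * A j i) ∧ (∀ i, ∑ j, A i j * a j = 0) ∧
  (b 0 = 1 ∧ b i.succ = a 0 * a i.succ) ∧
  ((∀ j, π^[n] j = i) ∧ ∀ j, j = i ∨ A (π j).succ j.succ = -1) ∧
  (∀ i : Fin n, a 0 ∣ b i.succ ∧ b i.succ ∣ a 0 * a i.succ)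

instance {n : ℕ} (A : Fin (n + 1) → Fin (n + 1) → ℤ) (a b : Fin (n + 1) → ℤ)
    (π : Fin n → Fin n) (i : Fin n) : Decidable (ParentCheck A a b π i) := by
  unfold ParentCheck; infer_instance

theorem firstKind_of_parentCheck {n : ℕ} {A : Fin (n + 1) → Fin (n + 1) → ℤ}
    {a b : Fin (n + 1) → ℤ} (π : Fin n → Fin n) (i : Fin n)
    (hc : decide (ParentCheck A a b π i) = true) : FirstKind A a b := by
  have h := of_decide_eq_true hc
  exact
  { diag := h.1.1
    off := h.1.2.1
    a_pos := h.1.2.2.1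
    b_pos := h.1.2.2.2
    symm := h.2.1
    null := funext h.2.2.1
    b_zero := h.2.2.2.1.1
    reach := ⟨i, h.2.2.2.1.2, reach_of_parent π i h.2.2.2.2.1.1 h.2.2.2.2.1.2⟩
    dvd := fun i => (h.2.2.2.2.2 i).1
    dvd' := fun i => (h.2.2.2.2.2 i).2 }

theorem firstKind_E6 : IsFirstKind E6 :=
  firstKind_of_parentCheck (n := 6) ![0, 0, 1, 2, 3, 2] 0 (by decide)

theorem firstKind_E7 : IsFirstKind E7 :=
  firstKind_of_parentCheck (n := 7) ![0, 0, 1, 2, 3, 4, 2] 0 (by decide)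

theorem firstKind_E8 : IsFirstKind E8 :=
  firstKind_of_parentCheck (n := 8) ![0, 0, 1, 2, 3, 4, 5, 4] 0 (by decide)

theorem firstKind_F4 : IsFirstKind F4 :=
  firstKind_of_parentCheck (n := 4) ![0, 0, 1, 2] 0 (by decide)

theorem firstKind_G2 : IsFirstKind G2 :=
  firstKind_of_parentCheck (n := 2) ![0, 0] 0 (by decide)

theorem isFirstKind (X : AffineType) (hX : X.UntwistedOrAEven) : IsFirstKind X := by
  cases X with
  | A n hn => exact firstKind_A n hn
  | B n hn => exact firstKind_B n hn
  | C n hn => exact firstKind_C n hn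
  | D n hn => exact firstKind_D n hn
  | E6 => exact firstKind_E6
  | E7 => exact firstKind_E7
  | E8 => exact firstKind_E8
  | F4 => exact firstKind_F4
  | G2 => exact firstKind_G2
  | twAeven n hn => exact firstKind_twAeven n hn
  | twAodd n hn => exact hX.elim
  | twD n hn => exact hX.elim
  | twE6 => exact hX.elim
  | twD4 => exact hX.elim

/-! ### The types of the second kind -/

/-- Transposition turns the second kind into untwisted types: `A_{2n-1}^(2)`, `D_{n+1}^(2)`,
`E_6^(2)`, `D_4^(3)` into `B_n^(1)`, `C_n^(1)`, `F_4^(1)`, `G_2^(1)`, with the labels exchanged. -/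
theorem firstKind_transpose (X : AffineType) (hX : ¬ X.UntwistedOrAEven) :
    FirstKind X.cartanᵀ (fun i => (X.comarks i : ℤ)) (fun i => (X.marks i : ℤ)) ∧
      X.comarks 0 = 1 := by
  cases X with
  | twAodd n hn =>
    refine ⟨?_, rfl⟩
    have e : (B n hn).cartan = (twAodd n hn).cartanᵀ := by
      funext i j
      change ofBonds n (fun i j => if i = n ∧ j + 1 = n then 2 else if Fork i j then 1 else 0) i j =
        ofBonds n (fun i j => if i + 1 = n ∧ j = n then 2 else if Fork i j then 1 else 0) j i
      simp only [ofBonds]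
      grind [Fork, Chain]
    exact e ▸ firstKind_B n hn
  | twD n hn =>
    refine ⟨?_, rfl⟩
    have e : (C n hn).cartan = (twD n hn).cartanᵀ := by
      funext i j
      change ofBonds n (fun i j => if (i = 1 ∧ j = 0) ∨ (i + 1 = n ∧ j = n) then 2 else if Chain i j then 1 else 0) i j =
        ofBonds n (fun i j => if (i = 0 ∧ j = 1) ∨ (i = n ∧ j + 1 = n) then 2 else if Chain i j then 1 else 0) j i
      simp only [ofBonds]
      grind [Chain]
    exact e ▸ firstKind_C n hn
  | twE6 =>
    refine ⟨?_, rfl⟩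
    have e : F4.cartan = twE6.cartanᵀ :=
      have h : ∀ i j : Fin 5, id (α := Fin 5 → Fin 5 → ℤ) F4.cartan i j =
          id (α := Fin 5 → Fin 5 → ℤ) twE6.cartan j i := by decide
      funext fun i => funext (h i)
    exact e ▸ firstKind_F4
  | twD4 =>
    refine ⟨?_, rfl⟩
    have e : G2.cartan = twD4.cartanᵀ :=
      have h : ∀ i j : Fin 3, id (α := Fin 3 → Fin 3 → ℤ) G2.cartan i j =
          id (α := Fin 3 → Fin 3 → ℤ) twD4.cartan j i := by decide
      funext fun i => funext (h i)
    exact e ▸ firstKind_G2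
  | _ => exact absurd trivial hX

theorem sum_range_fork {n : ℕ} (hn : 1 ≤ n) :
    ∑ i ∈ Finset.range (n + 1), (if i ≤ 1 then 1 else 2) = 2 * n := by
  induction n, hn using Nat.le_induction with
  | base => rfl
  | succ n hn ih => rw [Finset.sum_range_succ, ih, if_neg (by omega)]; ring

theorem sum_range_chain {n : ℕ} (hn : 1 ≤ n) :
    ∑ i ∈ Finset.range (n + 1), (if i = 0 ∨ i = n then 1 else 2) = 2 * n := by
  have h : ∀ m, 1 ≤ m → ∑ i ∈ Finset.range m, (if i = 0 then 1 else 2) + 1 = 2 * m := fun m hm => by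
    induction m, hm using Nat.le_induction with
    | base => rfl
    | succ m hm ih => rw [Finset.sum_range_succ, if_neg (by omega)]; omega
  rw [Finset.sum_range_succ, if_pos (Or.inr rfl), ← h n hn, add_left_inj]
  refine Finset.sum_congr rfl fun i hi => ?_
  have := Finset.mem_range.1 hi
  simp [this.ne]

/-- The finite part of a matrix of the second kind extends to an affine matrix of the first kind
with the same Coxeter number. -/
theorem exists_firstKind_extension (X : AffineType) (hX : ¬ X.UntwistedOrAEven) :
    ∃ (A : Matrix (Fin (X.rank + 1)) (Fin (X.rank + 1)) ℤ) (a b : Fin (X.rank + 1) → ℤ),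
      FirstKind A a b ∧ a 0 = 1 ∧ AffineDatum.fin A = X.finCartan ∧
      ∑ i, a i = X.dualCoxeter := by
  cases X with
  | twAodd n hn =>
    refine ⟨_, _, _, firstKind_C n (by omega), rfl, ?_, ?_⟩
    · funext i j
      change ofBonds n (fun i j => if (i = 1 ∧ j = 0) ∨ (i + 1 = n ∧ j = n) then 2 else if Chain i j then 1 else 0) i.succ j.succ =
        ofBonds n (fun i j => if i + 1 = n ∧ j = n then 2 else if Fork i j then 1 else 0) i.succ j.succ
      simp only [ofBonds, Fin.val_succ]
      grind [Fork, Chain]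
    · change ∑ i : Fin (n + 1), ((if i.val = 0 ∨ i.val = n then 1 else 2 : ℕ) : ℤ) =
        ((∑ i : Fin (n + 1), if i.val ≤ 1 then 1 else 2 : ℕ) : ℤ)
      rw [← Nat.cast_sum]
      congr 1
      refine (Fin.sum_univ_eq_sum_range (fun i => if i = 0 ∨ i = n then 1 else 2) (n + 1)).trans
        (Eq.trans ?_ (Fin.sum_univ_eq_sum_range (fun i => if i ≤ 1 then 1 else 2) (n + 1)).symm)
      rw [sum_range_fork (by omega), sum_range_chain (by omega)]
  | twD n hn =>
    -- The family `B` starts at rank 3; in rank 2 the extension is `C_2^(1)` with its vertices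
    -- renumbered to fit the finite part `B_2`.
    by_cases h2 : n = 2
    · subst h2
      have h : ∀ i j : Fin 2, id (α := Fin 2 → Fin 2 → ℤ)
          (AffineDatum.fin !![2, 0, -1; 0, 2, -1; -2, -2, 2]) i j =
          id (α := Fin 2 → Fin 2 → ℤ) (twD 2 le_rfl).finCartan i j := by decide
      have hK : FirstKind (n := 2) !![2, 0, -1; 0, 2, -1; -2, -2, 2] ![1, 1, 2] ![1, 1, 1] :=
        firstKind_of_parentCheck ![0, 0] 0 (by decide)
      exact ⟨!![2, 0, -1; 0, 2, -1; -2, -2, 2], ![1, 1, 2], ![1, 1, 1], hK, rfl,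
        funext fun i => funext (h i), rfl⟩
    · refine ⟨_, _, _, firstKind_B n (by omega), rfl, ?_, ?_⟩
      · funext i j
        change ofBonds n (fun i j => if i = n ∧ j + 1 = n then 2 else if Fork i j then 1 else 0) i.succ j.succ =
        ofBonds n (fun i j => if (i = 0 ∧ j = 1) ∨ (i = n ∧ j + 1 = n) then 2 else if Chain i j then 1 else 0) i.succ j.succ
        simp only [ofBonds, Fin.val_succ]
        grind [Fork, Chain]
      · change ∑ i : Fin (n + 1), ((if i.val ≤ 1 then 1 else 2 : ℕ) : ℤ) =
          ((∑ i : Fin (n + 1), if i.val = 0 ∨ i.val = n then 1 else 2 : ℕ) : ℤ)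
        rw [← Nat.cast_sum]
        congr 1
        refine (Fin.sum_univ_eq_sum_range (fun i => if i ≤ 1 then 1 else 2) (n + 1)).trans
          (Eq.trans ?_
            (Fin.sum_univ_eq_sum_range (fun i => if i = 0 ∨ i = n then 1 else 2) (n + 1)).symm)
        rw [sum_range_fork (by omega), sum_range_chain (by omega)]
  | twE6 =>
    -- This is `F_4^(1)` with its finite vertices in reverse order, since the finite part of
    -- `E_6^(2)` numbers `F_4` from the other end.
    exact ⟨!![2, 0, 0, 0, -1; 0, 2, -1, 0, 0; 0, -1, 2, -2, 0; 0, 0, -1, 2, -1; -1, 0, 0, -1, 2],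
      ![1, 2, 4, 3, 2], ![1, 1, 2, 3, 2],
      firstKind_of_parentCheck (n := 4) ![1, 2, 3, 3] 3 (by decide), rfl,
      by decide, rfl⟩
  | twD4 =>
    -- This is `G_2^(1)` with its two finite vertices exchanged.
    exact ⟨!![2, 0, -1; 0, 2, -3; -1, -1, 2], ![1, 3, 2], ![1, 1, 2],
      firstKind_of_parentCheck (n := 2) ![1, 1] 1 (by decide), rfl,
      by decide, rfl⟩
  | _ => exact absurd trivial hX

end CartanForm

namespace CartanForm

/-! ### Orthonormal families from orthogonal matrices -/

section OrthogonalMatrix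

variable {ι T : Type*} [Fintype ι] [DecidableEq ι] [Fintype T] [DecidableEq T]
  {S : ι → T → ℂ} {s : T → ℂ} {D : ℕ}

/-- The weighted Hermitian form on functions on a finite set. -/
noncomputable def weightedForm (D : ℕ) (s : T → ℂ) (f g : T → ℂ) : ℂ :=
  1 / (D : ℂ) * ∑ t, f t * conj (g t) * ((‖s t‖ ^ 2 : ℝ) : ℂ)

theorem exists_core (hD : 0 < D) (hs : ∀ t, s t ≠ 0) :
    ∃ c : InnerProductSpace.Core ℂ (T → ℂ), ∀ f g, c.inner g f = weightedForm D s f g := by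
  have hself : ∀ f : T → ℂ, weightedForm D s f f =
      ((1 / (D : ℝ) * ∑ t, ‖f t‖ ^ 2 * ‖s t‖ ^ 2 : ℝ) : ℂ) := fun f => by
    rw [weightedForm]
    push_cast
    congr 1
    refine Finset.sum_congr rfl fun t _ => ?_
    rw [Complex.mul_conj, Complex.normSq_eq_norm_sq]
    push_cast; rfl
  refine ⟨{ inner := fun g f => weightedForm D s f g
            conj_inner_symm := fun f g => ?_
            re_inner_nonneg := fun f => ?_
            add_left := fun f g h => ?_
            smul_left := fun f g r => ?_
            definite := fun f hf => ?_ }, fun f g => rfl⟩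
  · simp only [weightedForm, map_mul, map_sum, Complex.conj_conj, Complex.conj_ofReal, map_div₀,
      map_one, map_natCast]
    congr 1
    exact Finset.sum_congr rfl fun t _ => by ring
  · change 0 ≤ (weightedForm D s f f).re
    rw [hself, Complex.ofReal_re]
    positivity
  · change weightedForm D s h (f + g) = weightedForm D s h f + weightedForm D s h g
    simp only [weightedForm, Pi.add_apply, map_add, mul_add, add_mul, Finset.sum_add_distrib]
  · change weightedForm D s g (r • f) = conj r * weightedForm D s g f
    simp only [weightedForm, Pi.smul_apply, smul_eq_mul, map_mul, Finset.mul_sum]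
    exact Finset.sum_congr rfl fun t _ => by ring
  · change weightedForm D s f f = 0 at hf
    rw [hself, Complex.ofReal_eq_zero, mul_eq_zero] at hf
    have h1 := hf.resolve_left (by positivity)
    rw [Finset.sum_eq_zero_iff_of_nonneg fun t _ => by positivity] at h1
    funext t
    have h2 := (mul_eq_zero.1 (h1 t (Finset.mem_univ t))).resolve_right
      (pow_ne_zero 2 (norm_ne_zero_iff.2 (hs t)))
    exact norm_eq_zero.1 (pow_eq_zero_iff two_ne_zero |>.1 h2)

theorem normSq_cancel (hs : ∀ t, s t ≠ 0) (z w : ℂ) (t : T) :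
    z / s t * conj (w / s t) * ((‖s t‖ ^ 2 : ℝ) : ℂ) = z * conj w := by
  have h1 : conj (s t) ≠ 0 := (map_ne_zero _).2 (hs t)
  have h2 : ((‖s t‖ ^ 2 : ℝ) : ℂ) = s t * conj (s t) := by
    rw [Complex.mul_conj, Complex.normSq_eq_norm_sq]
  rw [h2, map_div₀]
  have := hs t
  field_simp

theorem weightedForm_div (hD : 0 < D) (hs : ∀ t, s t ≠ 0)
    (hrow : ∀ x x', ∑ t, S x t * conj (S x' t) = if x = x' then (D : ℂ) else 0) (x x' : ι) :
    weightedForm D s (fun t => S x t / s t) (fun t => S x' t / s t) = if x = x' then 1 else 0 := by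
  have hD' : (D : ℂ) ≠ 0 := Nat.cast_ne_zero.2 hD.ne'
  simp only [weightedForm, normSq_cancel hs, hrow]
  split_ifs
  · field_simp
  · rw [mul_zero]

theorem linearIndependent_div (hD : 0 < D) (hs : ∀ t, s t ≠ 0)
    (hrow : ∀ x x', ∑ t, S x t * conj (S x' t) = if x = x' then (D : ℂ) else 0) :
    LinearIndependent ℂ (fun x t => S x t / s t : ι → T → ℂ) := by
  rw [Fintype.linearIndependent_iff]
  intro c hc y
  have h1 : weightedForm D s (∑ x, c x • fun t => S x t / s t) (fun t => S y t / s t) =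
      ∑ x, c x * weightedForm D s (fun t => S x t / s t) (fun t => S y t / s t) := by
    simp only [weightedForm, Finset.sum_apply, Pi.smul_apply, smul_eq_mul, Finset.mul_sum,
      Finset.sum_mul]
    rw [Finset.sum_comm]
    exact Finset.sum_congr rfl fun x _ => Finset.sum_congr rfl fun t _ => by ring
  rw [hc] at h1
  simp only [weightedForm_div hD hs hrow, mul_ite, mul_one, mul_zero, Finset.sum_ite_eq',
    Finset.mem_univ, if_true] at h1
  rw [← h1]
  simp [weightedForm]

theorem span_div (hD : 0 < D) (hs : ∀ t, s t ≠ 0)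
    (hcol : ∀ t t', ∑ x, S x t * conj (S x t') = if t = t' then (D : ℂ) else 0) :
    Submodule.span ℂ (Set.range (fun x t => S x t / s t : ι → T → ℂ)) = ⊤ := by
  have hD' : (D : ℂ) ≠ 0 := Nat.cast_ne_zero.2 hD.ne'
  refine Submodule.eq_top_iff'.2 fun f => ?_
  -- The coefficients are the weighted products of `f` with `S x / s`, the weight `|s|^2` turning
  -- `conj (S x / s)` into `conj (S x) * s`. Column orthogonality collapses the expansion to `f`.
  have key : f = ∑ x, (1 / (D : ℂ) * ∑ t, f t * conj (S x t) * s t) • fun t => S x t / s t := by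
    funext t₀
    have h1 : ∑ x, (1 / (D : ℂ) * ∑ t, f t * conj (S x t) * s t) * (S x t₀ / s t₀) =
        1 / (D * s t₀) * ∑ t, f t * s t * ∑ x, S x t₀ * conj (S x t) := by
      simp only [Finset.mul_sum, Finset.sum_mul]
      rw [Finset.sum_comm]
      exact Finset.sum_congr rfl fun t _ => Finset.sum_congr rfl fun x _ => by
        have := hs t₀
        field_simp
    simp only [Finset.sum_apply, Pi.smul_apply, smul_eq_mul]
    rw [h1]
    simp only [hcol, mul_ite, mul_zero, Finset.sum_ite_eq, Finset.mem_univ, if_true]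
    have := hs t₀
    field_simp
  rw [key]
  exact Submodule.sum_mem _ fun x _ => Submodule.smul_mem _ _ (Submodule.subset_span ⟨x, rfl⟩)

end OrthogonalMatrix

/-! ### The Hermitian form of an affine type -/

open AffineDatum AffineType

/-- The labels as integers. -/
abbrev intMarks (X : AffineType) : Fin (X.rank + 1) → ℤ := fun i => X.marks i

/-- The dual labels as integers. -/
abbrev intComarks (X : AffineType) : Fin (X.rank + 1) → ℤ := fun i => X.comarks i

/-- A word attaining the minimal length is a product of that many reflections, each of determinant
`-1`. -/
theorem neg_one_pow_length (X : AffineType) (w : X.weylGroup) :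
    (-1 : ℤˣ) ^ X.length w = LinearEquiv.det (w : X.Weight ≃ₗ[ℤ] X.Weight) := by
  have h1 : {m : ℕ | ∃ l : List (Fin X.rank), l.length = m ∧
      (l.map X.simpleReflection).prod = (w : X.Weight ≃ₗ[ℤ] X.Weight)}.Nonempty := by
    obtain ⟨l, hl⟩ := exists_list_of_mem_weyl (C := X.finCartan) (hC := X.finCartan_diag) w.2
    exact ⟨_, l, rfl, hl⟩
  obtain ⟨l, hl, hw⟩ := Nat.sInf_mem h1
  change (-1 : ℤˣ) ^ sInf _ = _
  rw [← hl, ← hw]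
  exact (det_prod_simpleRefl (C := X.finCartan) (hC := X.finCartan_diag) l).symm

theorem J_eq_alternant (X : AffineType)
    (h : AffineDatum X.cartan (intMarks X) (intComarks X))
    [Fintype (weyl (fin X.cartan) h.fin_diag)] (lam : X.Weight) (t : X.Torus) :
    X.J lam t = h.alternant t (lam + X.rho) := by
  let : Fintype X.weylGroup := ‹Fintype (weyl (fin X.cartan) h.fin_diag)›
  rw [J, finsum_eq_sum_of_fintype, alternant]
  refine Fintype.sum_equiv (Equiv.refl _) _ _ fun w => ?_
  have h1 := congrArg (fun u : ℤˣ => ((u : ℤ) : ℂ)) (neg_one_pow_length X w)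
  simp only [Units.val_pow_eq_pow_val, Units.val_neg, Units.val_one, Int.cast_pow, Int.cast_neg,
    Int.cast_one] at h1
  rw [h1]
  rfl

/-- The bijections `λ ↦ λ + ρ` and `y ↦ character G K y` carry the two orthogonality relations
between alcoves to the rows and columns of `J`. -/
theorem orthonormal_of_paired (X : AffineType) (k : ℕ)
    {h₁ : AffineDatum X.cartan (intMarks X) (intComarks X)}
    {A₂ : Matrix (Fin (X.rank + 1)) (Fin (X.rank + 1)) ℤ} {a₂ b₂ : Fin (X.rank + 1) → ℤ}
    {h₂ : AffineDatum A₂ a₂ b₂} {G : Matrix (Fin X.rank) (Fin X.rank) ℤ} {p : Fin X.rank → ℝ}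
    (P : Paired h₁ h₂ G p) (hK : 0 < k + X.dualCoxeter)
    (hweights : ∀ lam, lam ∈ X.levelWeights k ↔
      lam + X.rho ∈ alcove (intComarks X) ((k + X.dualCoxeter : ℕ) : ℤ))
    (hsigma : X.sigmaSet k = Paired.character G (k + X.dualCoxeter) ''
      alcove b₂ ((k + X.dualCoxeter : ℕ) : ℤ))
    (hM : X.scaledM k = h₁.scaledTranslations (k + X.dualCoxeter)) :
    (X.sigmaSet k).Finite ∧
    (∃ c : InnerProductSpace.Core ℂ (X.FusionRing k),
      ∀ f g : X.FusionRing k, c.inner g f = X.hermForm k f g) ∧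
    (∀ lam mu : X.levelWeights k,
      X.hermForm k (X.chi k lam) (X.chi k mu) = if lam = mu then 1 else 0) ∧
    LinearIndependent ℂ (X.chi k) ∧
    Submodule.span ℂ (Set.range (X.chi k)) = ⊤ := by
  classical
  set K := k + X.dualCoxeter with hKdef
  have := P.finite_weyl_left
  have := Fintype.ofFinite (weyl (fin X.cartan) h₁.fin_diag)
  have hC₁ := P.symm.finite_alcove hK
  have hC₂ := P.finite_alcove hK
  have := hC₁.fintype
  have := hC₂.fintype
  have hfin : (X.sigmaSet k).Finite := by rw [hsigma]; exact hC₂.image _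
  have := hfin.fintype
  let eW : X.levelWeights k ≃ alcove (intComarks X) (K : ℤ) :=
    { toFun := fun lam => ⟨lam + X.rho, (hweights _).1 lam.2⟩
      invFun := fun x => ⟨x - X.rho, (hweights _).2 (by rw [sub_add_cancel]; exact x.2)⟩
      left_inv := fun lam => Subtype.ext (add_sub_cancel_right _ _)
      right_inv := fun x => Subtype.ext (sub_add_cancel _ _) }
  have := Fintype.ofEquiv _ eW.symm
  let eS : alcove b₂ (K : ℤ) ≃ X.sigmaSet k :=
    Equiv.ofBijective (fun y => ⟨Paired.character G K y, hsigma ▸ ⟨y, y.2, rfl⟩⟩)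
      ⟨fun y y' h => Subtype.ext (P.character_injOn hK y.2 y'.2 (congrArg Subtype.val h)),
        fun t => by
          have ht : t.1 ∈ Paired.character G K '' alcove b₂ (K : ℤ) := hsigma ▸ t.2
          obtain ⟨y, hy, h⟩ := ht
          exact ⟨⟨y, hy⟩, Subtype.ext h⟩⟩
  set D := Nat.card (X.Weight ⧸ X.scaledM k) with hDdef
  have hDeq : D = Nat.card ((Fin X.rank → ℤ) ⧸ h₁.scaledTranslations K) := by rw [hDdef, hM]
  have hD : 0 < D := by
    rw [Nat.pos_iff_ne_zero, hDeq]
    exact_mod_cast P.card_ne_zero hK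
  let s : X.sigmaSet k → ℂ := fun t => X.J 0 t
  let S : X.levelWeights k → X.sigmaSet k → ℂ := fun lam t => X.J lam t
  have hs : ∀ t, s t ≠ 0 := fun t => by
    obtain ⟨y, rfl⟩ := eS.surjective t
    change X.J 0 (Paired.character G K y) ≠ 0
    rw [J_eq_alternant X h₁, zero_add]
    exact P.alternant_one_ne_zero hK y.2
  have hrow : ∀ lam mu, ∑ t, S lam t * conj (S mu t) = if lam = mu then (D : ℂ) else 0 := by
    intro lam mu
    rw [← eS.sum_comp]
    have h1 := P.sum_alternant_mul_conj hK (eW lam).2 (eW mu).2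
    simp only [← hDeq, ← Subtype.ext_iff, eW.injective.eq_iff] at h1
    rw [← h1]
    refine Finset.sum_congr rfl fun y _ => ?_
    change X.J lam (Paired.character G K y) * conj (X.J mu (Paired.character G K y)) = _
    rw [J_eq_alternant X h₁, J_eq_alternant X h₁]
    rfl
  have hcol : ∀ t t', ∑ lam, S lam t * conj (S lam t') = if t = t' then (D : ℂ) else 0 := by
    intro t t'
    obtain ⟨y, rfl⟩ := eS.surjective t
    obtain ⟨y', rfl⟩ := eS.surjective t'
    have h1 := P.sum_alternant_mul_conj_dual hK y.2 y'.2
    simp only [← hDeq, ← Subtype.ext_iff] at h1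
    simp only [eS.injective.eq_iff]
    rw [← h1, ← eW.sum_comp]
    refine Finset.sum_congr rfl fun lam _ => ?_
    change X.J lam (Paired.character G K y) * conj (X.J lam (Paired.character G K y')) = _
    rw [J_eq_alternant X h₁, J_eq_alternant X h₁]
    rfl
  have hform : ∀ f g, X.hermForm k f g = weightedForm D s f g := fun f g => by
    rw [hermForm, finsum_eq_sum_of_fintype, weightedForm]
  refine ⟨hfin, ?_, fun lam mu => ?_, linearIndependent_div hD hs hrow, span_div hD hs hcol⟩
  · obtain ⟨c, hc⟩ := exists_core hD hs
    exact ⟨c, fun f g => (hc f g).trans (hform f g).symm⟩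
  · rw [hform]
    exact weightedForm_div hD hs hrow lam mu

end CartanForm

namespace CartanForm

open AffineDatum AffineType

/-! ### The lattices of translations -/

theorem mem_closure_range_col {n : ℕ} (G : Matrix (Fin n) (Fin n) ℤ) (t : Fin n → ℤ) :
    t ∈ AddSubgroup.closure (Set.range fun l i => G i l) ↔ ∃ c, t = G *ᵥ c := by
  have hcol : ∀ c : Fin n → ℤ, G *ᵥ c = ∑ l, c l • fun i => G i l := fun c => by
    ext i
    simp [Matrix.mulVec, dotProduct, mul_comm]
  constructor
  · intro h
    induction h using AddSubgroup.closure_induction with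
    | mem x hx =>
      obtain ⟨l, rfl⟩ := hx
      exact ⟨Pi.single l 1, by ext i; simp⟩
    | zero => exact ⟨0, by simp⟩
    | add x y _ _ hx hy =>
      obtain ⟨c, rfl⟩ := hx
      obtain ⟨c', rfl⟩ := hy
      exact ⟨c + c', (Matrix.mulVec_add _ _ _).symm⟩
    | neg x _ hx =>
      obtain ⟨c, rfl⟩ := hx
      exact ⟨-c, (Matrix.mulVec_neg _ _).symm⟩
  · rintro ⟨c, rfl⟩
    rw [hcol]
    exact sum_mem fun l _ => zsmul_mem (AddSubgroup.subset_closure (Set.mem_range_self l)) _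

section Translations

variable {n : ℕ} {A : Matrix (Fin (n + 1)) (Fin (n + 1)) ℤ} {a b : Fin (n + 1) → ℤ}

theorem FirstKind.le_mul (h : FirstKind A a b) (i : Fin n) : b i.succ ≤ a 0 * a i.succ :=
  Int.le_of_dvd (mul_pos (h.a_pos _) (h.a_pos _)) (h.dvd' i)

/-- Along an entry `-1` starting at a vertex whose label ratio is maximal, the ratio stays maximal
and the opposite entry is `-1`. -/
theorem FirstKind.back (h : FirstKind A a b) {k l : Fin n} (hkl : A k.succ l.succ = -1)
    (hl : b l.succ = a 0 * a l.succ) :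
    b k.succ = a 0 * a k.succ ∧ A l.succ k.succ = -1 := by
  have h1 := h.symm k.succ l.succ
  have ha0 := h.a_pos 0
  have hak := h.a_pos k.succ
  have hal := h.a_pos l.succ
  have hbk := h.b_pos k.succ
  have hle := h.le_mul k
  rw [hkl, hl] at h1
  have h2 : b k.succ = a 0 * a k.succ * -A l.succ k.succ := by
    refine mul_left_cancel₀ hal.ne' ?_
    linear_combination -h1
  have h3 : 0 < a 0 * a k.succ := mul_pos ha0 hak
  have h4 : 0 < -A l.succ k.succ := by
    by_contra hcon
    push Not at hcon
    nlinarith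
  have h5 : -A l.succ k.succ ≤ 1 := by
    by_contra hcon
    push Not at hcon
    nlinarith
  have h6 : A l.succ k.succ = -1 := by omega
  exact ⟨by rw [h2, h6]; ring, h6⟩

theorem finNorms_eq_iff {a b : Fin (n + 1) → ℤ} (ha : ∀ i, 0 < a i) (m : ℤ) (j : Fin n) :
    finNorms a b j = m ↔ b j.succ = m * a j.succ := by
  have h1 : (a j.succ : ℚ) ≠ 0 := Int.cast_ne_zero.2 (ha _).ne'
  rw [finNorms, norms, div_eq_iff h1]
  norm_cast

/-- The lattice of translations is spanned by the columns of `C · diag (a / b)`. -/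
theorem FirstKind.translations_eq (h : FirstKind A a b) (G : Matrix (Fin n) (Fin n) ℤ)
    (hG : ∀ i j, b j.succ * G i j = a j.succ * fin A i j) (hsymm : ∀ i j, G i j = G j i) :
    h.affineDatum.translations = AddSubgroup.closure (Set.range fun l i => G i l) := by
  refine h.affineDatum.translations_eq_closure _ (fin A) (fun k l => ?_) (fun j hj => ?_)
    (fun k l hkl hl => ?_) ?_
  · ext i
    simp only [weightRefl, Pi.sub_apply, Pi.smul_apply, smul_eq_mul]
    have h1 : G l k * fin A i l = fin A k l * G i l := by
      refine mul_left_cancel₀ (h.b_pos l.succ).ne' ?_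
      rw [hsymm l k]
      linear_combination fin A i l * hG k l - fin A k l * hG i l
    rw [h1]
  · rw [finNorms_eq_iff h.a_pos] at hj
    ext i
    simp only [Pi.smul_apply, smul_eq_mul]
    refine mul_left_cancel₀ (h.a_pos j.succ).ne' ?_
    rw [← hG, hj]; ring
  · rw [finNorms_eq_iff h.a_pos] at hl ⊢
    exact h.back hkl hl
  · obtain ⟨i, -, hi⟩ := h.reach
    exact ⟨i, hi⟩

/-- For the transposed matrix the lattice of translations is spanned by the simple roots. -/
theorem FirstKind.translations_transpose_eq (h : FirstKind A a b) (ha : a 0 = 1) :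
    (h.affineDatum_transpose ha).translations =
      AddSubgroup.closure (Set.range fun l i => fin Aᵀ i l) := by
  refine (h.affineDatum_transpose ha).translations_eq_closure _ (fin A) (fun k l => rfl)
    (fun j _ => ?_) (fun k l hkl hl => ?_) ?_
  · rw [h.b_zero, one_smul]
  · rw [finNorms_eq_iff h.b_pos, h.b_zero, one_mul] at hl ⊢
    have h1 := h.back hkl (by rw [ha, one_mul, hl])
    rw [ha, one_mul] at h1
    exact ⟨h1.1.symm, h1.2⟩
  · obtain ⟨i, -, hi⟩ := h.reach
    exact ⟨i, hi⟩

/-- Here `G` is the symmetric Gram matrix of the coroots, so its row and column lattices coincide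
and a single datum serves on both sides. -/
theorem FirstKind.paired (h : FirstKind A a b) (G : Matrix (Fin n) (Fin n) ℤ)
    (hG : ∀ i j, b j.succ * G i j = a j.succ * fin A i j) :
    Paired h.affineDatum h.affineDatum G fun i => (b i.succ : ℝ) / a i.succ := by
  have hsymm : ∀ i j, G i j = G j i := fun i j => by
    refine mul_left_cancel₀ (mul_ne_zero (h.b_pos i.succ).ne' (h.b_pos j.succ).ne') ?_
    have h1 : b i.succ * a j.succ * fin A i j = b j.succ * a i.succ * fin A j i :=
      h.symm i.succ j.succ
    linear_combination b i.succ * hG i j + h1 - b j.succ * hG j i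
  have hmem : ∀ t, t ∈ h.affineDatum.translations ↔ ∃ c, t = G *ᵥ c := fun t => by
    rw [h.translations_eq G hG hsymm, mem_closure_range_col]
  have hcol : ∀ i j, (fin A j i : ℝ) = (b i.succ : ℝ) / a i.succ * G j i := fun i j => by
    have h1 : (a i.succ : ℝ) ≠ 0 := Int.cast_ne_zero.2 (h.a_pos _).ne'
    have h2 : (b i.succ : ℝ) * G j i = a i.succ * fin A j i := by exact_mod_cast hG j i
    field_simp
    linear_combination -h2
  have hT : Gᵀ = G := by ext i j; exact hsymm j i
  refine ⟨?_, by rw [hT]; exact hmem, hmem, fun i j => by rw [hsymm i j]; exact hcol i j, hcol⟩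
  have h1 : G * Matrix.diagonal (fun j => b j.succ) =
      fin A * Matrix.diagonal (fun j => a j.succ) := by
    ext i j
    rw [Matrix.mul_diagonal, Matrix.mul_diagonal, mul_comm, hG, mul_comm]
  have h2 := congrArg Matrix.det h1
  rw [Matrix.det_mul, Matrix.det_mul, Matrix.det_diagonal, Matrix.det_diagonal] at h2
  intro h0
  rw [h0, zero_mul] at h2
  exact mul_ne_zero h.affineDatum.det_fin_ne_zero
    (Finset.prod_ne_zero_iff.2 fun j _ => (h.a_pos j.succ).ne') h2.symm

/-- The pairing is now the natural one between weights and coweights; the two translation lattices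
are the root and coroot lattices of the same finite system. -/
theorem FirstKind.paired_transpose (h : FirstKind A a b) (ha : a 0 = 1)
    {A' : Matrix (Fin (n + 1)) (Fin (n + 1)) ℤ} {a' b' : Fin (n + 1) → ℤ}
    (h' : FirstKind A' a' b') (ha' : a' 0 = 1) (hfin : fin A' = (fin A)ᵀ) :
    Paired (h.affineDatum_transpose ha) (h'.affineDatum_transpose ha') (fin A) fun _ => 1 where
  det_ne_zero := h.affineDatum.det_fin_ne_zero
  left := fun t => by
    rw [h.translations_transpose_eq ha, mem_closure_range_col]; rfl
  right := fun t => by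
    have h1 : fin A'ᵀ = fin A := congrArg Matrix.transpose hfin
    rw [h'.translations_transpose_eq ha', mem_closure_range_col, h1]
  col_left := fun i j => (one_mul _).symm
  col_right := fun i j => by
    rw [one_mul]
    exact congrArg _ (congrFun (congrFun hfin i) j)

/-- Since `∑ b i = 1 + height ρ`, the strict bound `height (x + ρ) < K` reads `height x < k + 1`. -/
theorem add_one_mem_alcove (hb : b 0 = 1) {k K : ℕ} (hK : (K : ℤ) = k + ∑ i, b i)
    (x : Fin n → ℤ) :
    x + 1 ∈ alcove b K ↔ (∀ i, 0 ≤ x i) ∧ height b x ≤ k := by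
  rw [mem_alcove, height_add, hK, Fin.sum_univ_succ, hb]
  have h1 : height b (1 : Fin n → ℤ) = ∑ i : Fin n, b i.succ := by simp [height]
  rw [h1]
  refine and_congr (forall_congr' fun i => ?_) ?_
  · simp only [Pi.add_apply, Pi.one_apply]; omega
  · omega

end Translations

/-! ### The two kinds of affine types -/

theorem expPoint_eq_character (X : AffineType) (k : ℕ) (G : Matrix (Fin X.rank) (Fin X.rank) ℤ)
    (y : Fin X.rank → ℤ) :
    X.expPoint k ((G.map (Int.cast : ℤ → ℝ))⁻¹ *ᵥ fun i => (y i : ℝ)) =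
      Paired.character G (k + X.dualCoxeter) y := rfl

theorem mem_levelWeights_iff (X : AffineType) (k : ℕ) (h0 : intComarks X 0 = 1)
    (hθ : X.thetaCheck = fun i => (X.comarks i.succ : ℝ)) (lam : X.Weight) :
    lam ∈ X.levelWeights k ↔
      lam + X.rho ∈ alcove (intComarks X) ((k + X.dualCoxeter : ℕ) : ℤ) := by
  change _ ↔ lam + 1 ∈ _
  rw [add_one_mem_alcove h0 (k := k) (by simp [dualCoxeter])]
  refine and_congr Iff.rfl ?_
  have h1 : X.pairing lam X.thetaCheck = ((height (intComarks X) lam : ℤ) : ℝ) := by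
    rw [hθ]
    simp [pairing, weightCast, dotProduct, height, mul_comm]
  rw [h1]
  exact_mod_cast Iff.rfl

theorem dualCoxeter_pos (X : AffineType) (h0 : intComarks X 0 = 1) : 0 < X.dualCoxeter := by
  rw [dualCoxeter, Fin.sum_univ_succ]
  have : X.comarks 0 = 1 := by exact_mod_cast h0
  omega

/-- This is integrality of the matrix of `κ`. It follows from `dvd'` when `a 0 = 1`; for
`A_{2n}^(2)` the label quotient is `1/2` only at vertex `n`, whose column in the finite Cartan
matrix is even. -/
theorem comarks_dvd (X : AffineType) (hX : X.UntwistedOrAEven) (i j : Fin X.rank) :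
    intComarks X j.succ ∣ intMarks X j.succ * X.finCartan i j := by
  have h1 : intMarks X 0 = 1 → intComarks X j.succ ∣ intMarks X j.succ * X.finCartan i j :=
    fun h0 => by
      have := (isFirstKind X hX).dvd' j
      change _ ∣ intMarks X 0 * intMarks X j.succ at this
      rw [h0, one_mul] at this
      exact this.mul_right _
  cases X with
  | D n hn => exact h1 (by simp [marks])
  | twAodd n hn => exact hX.elim
  | twD n hn => exact hX.elim
  | twE6 => exact hX.elim
  | twD4 => exact hX.elim
  | twAeven n hn =>
    change Fin n at i j
    change ((if j.val + 1 = 0 then 1 else 2 : ℕ) : ℤ) ∣ ((if j.val + 1 = n then 1 else 2 : ℕ) : ℤ) *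
      ofBonds n (fun i j => if n = 1 then (if i = 0 then 4 else 1)
      else if (i = 0 ∧ j = 1) ∨ (i + 1 = n ∧ j = n) then 2 else if Chain i j then 1 else 0)
        i.succ j.succ
    rw [if_neg (Nat.succ_ne_zero _)]
    by_cases hj : j.val + 1 = n
    · rw [if_pos hj]
      simp only [ofBonds, Fin.val_succ, Fin.ext_iff]
      have := i.isLt
      clear h1 hX
      grind [Chain]
    · rw [if_neg hj]
      exact dvd_mul_right _ _
  | _ => exact h1 rfl

theorem orthonormal_of_untwistedOrAEven (X : AffineType) (k : ℕ) (hX : X.UntwistedOrAEven) :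
    (X.sigmaSet k).Finite ∧
    (∃ c : InnerProductSpace.Core ℂ (X.FusionRing k),
      ∀ f g : X.FusionRing k, c.inner g f = X.hermForm k f g) ∧
    (∀ lam mu : X.levelWeights k,
      X.hermForm k (X.chi k lam) (X.chi k mu) = if lam = mu then 1 else 0) ∧
    LinearIndependent ℂ (X.chi k) ∧
    Submodule.span ℂ (Set.range (X.chi k)) = ⊤ := by
  have F : FirstKind X.cartan (intMarks X) (intComarks X) := isFirstKind X hX
  choose G hG using fun i j => comarks_dvd X hX i j
  have hG' : ∀ i j, intComarks X j.succ * G i j = intMarks X j.succ * fin X.cartan i j :=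
    fun i j => (hG i j).symm
  have P := F.paired (Matrix.of G) hG'
  have hkappa : X.kappa = (Matrix.of G).map (Int.cast : ℤ → ℝ) := by
    ext i j
    have h1 : (X.comarks j.succ : ℝ) ≠ 0 := by exact_mod_cast (F.b_pos j.succ).ne'
    have h2 : (X.comarks j.succ : ℝ) * G i j = X.marks j.succ * X.finCartan i j := by
      exact_mod_cast hG' i j
    rw [kappa, Matrix.map_apply, Matrix.of_apply]
    field_simp
    linear_combination -h2
  -- In root coordinates `θ` is the vector of labels, and `κ (α̌_i) = (a_i / ǎ_i) α_i`, so `κ⁻¹ θ =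
  -- ∑ ǎ_i α̌_i`.
  have hθ : X.thetaCheck = fun i => (X.comarks i.succ : ℝ) := by
    have h1 : X.weightCast X.theta = X.kappa *ᵥ fun i => (X.comarks i.succ : ℝ) := by
      rw [theta, show highestRoot X.finCartan = fun i => intMarks X i.succ from
        highestRoot_eq F.isHighestRoot]
      ext i
      simp only [weightCast, AddMonoidHom.coe_mk, ZeroHom.coe_mk, Matrix.mulVec, dotProduct, kappa]
      push_cast
      refine Finset.sum_congr rfl fun j _ => ?_
      have h1 : (X.comarks j.succ : ℝ) ≠ 0 := by exact_mod_cast (F.b_pos j.succ).ne'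
      field_simp
    rw [thetaCheck, if_pos hX, kappaInv, h1, Matrix.mulVec_mulVec, hkappa,
      Matrix.nonsing_inv_mul _ (isUnit_det_cast P.det_ne_zero), Matrix.one_mulVec]
  have hw := mem_levelWeights_iff X k F.b_zero hθ
  refine orthonormal_of_paired X k P (Nat.add_pos_right _ (dualCoxeter_pos X F.b_zero)) hw ?_ ?_
  · have hchar : ∀ y, Paired.character (Matrix.of G) (k + X.dualCoxeter) y =
        X.expPoint k (X.kappaInv y) := fun y => by
      rw [← expPoint_eq_character, kappaInv, hkappa]; rfl
    rw [sigmaSet, if_pos hX]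
    ext t
    constructor
    · rintro ⟨lam, hlam, rfl⟩
      exact ⟨_, (hw lam).1 hlam, by rw [hchar, add_comm]⟩
    · rintro ⟨y, hy, rfl⟩
      exact ⟨y - X.rho, (hw _).2 (by rwa [sub_add_cancel]), by rw [hchar, add_sub_cancel]⟩
  · have hinj : Function.Injective X.weightCast := fun x y h => by
      ext i
      exact Int.cast_injective (congrFun h i)
    have h1 : X.latticeM = F.affineDatum.translations := by
      ext t
      rw [P.right, ← mem_closure_range_col, latticeM, if_pos hX,
        ← AddSubgroup.comap_map_eq_self_of_injective hinj
          (AddSubgroup.closure (Set.range fun l i => (Matrix.of G) i l)),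
        AddMonoidHom.map_closure, ← Set.range_comp]
      have h2 : (X.weightCast ∘ fun l i => (Matrix.of G) i l) =
          fun i : Fin X.rank => X.kappa *ᵥ (Pi.single i 1 : X.CartanSpace) := by
        funext l
        ext i
        simp [hkappa, weightCast]
      rw [h2]
    rw [scaledM, h1]
    rfl

theorem orthonormal_of_not_untwistedOrAEven (X : AffineType) (k : ℕ) (hX : ¬ X.UntwistedOrAEven) :
    (X.sigmaSet k).Finite ∧
    (∃ c : InnerProductSpace.Core ℂ (X.FusionRing k),
      ∀ f g : X.FusionRing k, c.inner g f = X.hermForm k f g) ∧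
    (∀ lam mu : X.levelWeights k,
      X.hermForm k (X.chi k lam) (X.chi k mu) = if lam = mu then 1 else 0) ∧
    LinearIndependent ℂ (X.chi k) ∧
    Submodule.span ℂ (Set.range (X.chi k)) = ⊤ := by
  obtain ⟨F, h0⟩ := firstKind_transpose X hX
  have h0' : intComarks X 0 = 1 := by rw [intComarks, h0]; rfl
  obtain ⟨A', a', b', F', ha', hfin, hsum⟩ := exists_firstKind_extension X hX
  have P := F.paired_transpose h0' F' ha' hfin
  have hθ : X.thetaCheck = fun i => (X.comarks i.succ : ℝ) := by
    rw [thetaCheck, if_neg hX, show highestRoot X.finCartanᵀ = fun i => intComarks X i.succ from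
      highestRoot_eq F.isHighestRoot]
    simp
  have hw := mem_levelWeights_iff X k h0' hθ
  refine orthonormal_of_paired X k (h₁ := F.affineDatum_transpose h0') P
    (Nat.add_pos_right _ (dualCoxeter_pos X h0')) hw ?_ ?_
  -- The vector `R *ᵥ x` lists the values `⟨α_i, x⟩`, the coordinates of `x` in the fundamental
  -- coweights; on coweights they are integers.
  · set R := (X.finCartan.map (Int.cast : ℤ → ℝ))ᵀ with hR
    have hu : IsUnit R.det := isUnit_det_cast P.det_ne_zero
    have hroot : ∀ x i, X.pairing (X.simpleRoot i) x = (R *ᵥ x) i := fun x i => rfl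
    have hrho : X.rhoCheck = R⁻¹ *ᵥ 1 := by
      have h1 : (1 : Fin X.rank → ℝ) = ∑ i, Pi.single i 1 := by
        simpa using (Finset.univ_sum_single (1 : Fin X.rank → ℝ)).symm
      rw [rhoCheck, h1, Matrix.mulVec_sum]
      rfl
    have hlin : ∀ (c : Fin X.rank → ℤ) x,
        X.pairing (X.finCartan *ᵥ c) x = ∑ i, c i * (R *ᵥ x) i := fun c x => by
      have h1 : X.weightCast (X.finCartan *ᵥ c) = (fun i => (c i : ℝ)) ᵥ* R := by
        ext i
        simp [weightCast, Matrix.mulVec, Matrix.vecMul, dotProduct, hR, mul_comm]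
      rw [pairing, h1, ← Matrix.dotProduct_mulVec]
      rfl
    have htheta : ∀ x, X.pairing X.theta x = ∑ i : Fin X.rank, (a' i.succ : ℝ) * (R *ᵥ x) i :=
      fun x => by
        rw [theta, show highestRoot X.finCartan = fun i => a' i.succ from
          highestRoot_eq (hfin ▸ F'.isHighestRoot), hlin]
    -- The coweight alcove is bounded by `θ`, hence by the labels of the extension; their sum must
    -- equal `ȟ` for the shift by `ρ̌` to end at level `K`.
    have hK : ((k + X.dualCoxeter : ℕ) : ℤ) = k + ∑ i, a' i := by rw [hsum]; push_cast; rfl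
    have hlevel : ∀ (m : Fin X.rank → ℤ) x, (R *ᵥ x = fun i => (m i : ℝ)) →
        (x ∈ X.levelCoweights k ↔ m + 1 ∈ alcove a' ((k + X.dualCoxeter : ℕ) : ℤ)) :=
      fun m x hm => by
        rw [add_one_mem_alcove ha' hK]
        have h1 : X.pairing X.theta x = ((height a' m : ℤ) : ℝ) := by
          rw [htheta, hm, height]; push_cast; rfl
        constructor
        · rintro ⟨-, h2, h3⟩
          refine ⟨fun i => ?_, ?_⟩
          · have := h2 i
            rw [hroot, hm] at this
            exact Int.cast_nonneg_iff.1 this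
          · rw [h1] at h3
            exact_mod_cast h3
        · rintro ⟨h2, h3⟩
          refine ⟨fun beta hbeta => ?_, fun i => ?_, ?_⟩
          · obtain ⟨c, rfl⟩ := (mem_closure_range_col X.finCartan beta).1 hbeta
            refine ⟨∑ i, c i * m i, ?_⟩
            rw [hlin, hm]; push_cast; rfl
          · rw [hroot, hm]
            exact Int.cast_nonneg (h2 i)
          · rw [h1]
            exact_mod_cast h3
    have hchar : ∀ y : Fin X.rank → ℤ, Paired.character (fin X.cartanᵀ) (k + X.dualCoxeter) y =
        X.expPoint k (R⁻¹ *ᵥ fun i => (y i : ℝ)) := fun y => rfl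
    have hshift : ∀ (m : Fin X.rank → ℤ),
        (R⁻¹ *ᵥ fun i => ((m + 1) i : ℝ)) = X.rhoCheck + R⁻¹ *ᵥ fun i => (m i : ℝ) := fun m => by
      rw [hrho, ← Matrix.mulVec_add]
      congr 1
      ext i
      simp [add_comm]
    rw [sigmaSet, if_neg hX]
    ext t
    constructor
    · rintro ⟨x, hx, rfl⟩
      choose m hm using fun i => hx.1 (X.simpleRoot i) (AddSubgroup.subset_closure ⟨i, rfl⟩)
      have hm' : R *ᵥ x = fun i => (m i : ℝ) := funext fun i => (hroot x i).symm.trans (hm i)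
      refine ⟨m + 1, (hlevel m x hm').1 hx, ?_⟩
      rw [hchar, hshift, ← hm', Matrix.mulVec_mulVec, Matrix.nonsing_inv_mul _ hu,
        Matrix.one_mulVec]
    · rintro ⟨y, hy, rfl⟩
      have hy' : y = (y - 1) + 1 := (sub_add_cancel _ _).symm
      refine ⟨R⁻¹ *ᵥ fun i => ((y - 1) i : ℝ), (hlevel (y - 1) _ ?_).2 (hy' ▸ hy), ?_⟩
      · rw [Matrix.mulVec_mulVec, Matrix.mul_nonsing_inv _ hu, Matrix.one_mulVec]
      · rw [← hshift, ← hy', hchar]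
  · have h1 : X.latticeM = (F.affineDatum_transpose h0').translations := by
      rw [latticeM, if_neg hX, F.translations_transpose_eq h0']
      rfl
    rw [scaledM, h1]
    rfl

end CartanForm

theorem theorem1 (X : AffineType) (k : ℕ) :
    (X.sigmaSet k).Finite ∧
    (∃ c : InnerProductSpace.Core ℂ (X.FusionRing k),
      ∀ f g : X.FusionRing k, c.inner g f = X.hermForm k f g) ∧
    (∀ lam mu : X.levelWeights k,
      X.hermForm k (X.chi k lam) (X.chi k mu) = if lam = mu then 1 else 0) ∧
    LinearIndependent ℂ (X.chi k) ∧
    Submodule.span ℂ (Set.range (X.chi k)) = ⊤ := by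
  by_cases hX : X.UntwistedOrAEven
  · exact CartanForm.orthonormal_of_untwistedOrAEven X k hX
  · exact CartanForm.orthonormal_of_not_untwistedOrAEven X k hX
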